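/- **Setting.** Let $s>0$, $1\le p<\infty$, $1\le q\le\infty$, $L,T>0$, and let $N\ge 0$ be an integer with $s<N+1$. Write $g_{jk}(x)=2^{j/2}g(2^jx-k)$. Let $\varphi:\mathbb R\to\mathbb R$ be a father wavelet: its integer translates are orthonormal in $L^2(\mathbb R)$, and the closed spans $V_j$ of $\{\varphi_{jk}:k\in\mathbb Z\}$ satisfy $V_j\subset V_{j+1}$ for all $j\in\mathbb Z$ and have a dense union in $L^2(\mathbb R)$. Assume that $\varphi$ has a weak derivative $\varphi^{(N+1)}$ of order $N+1$ with $\operatorname{ess\,sup}_x\sum_{k\in\mathbb Z}|\varphi^{(N+1)}(x-k)|<\infty$, and that $|\varphi(u)|\le\Phi(|u|)$ for some bounded non-increasing $\Phi$ on $[0,\infty)$ with $\int\Phi(|u|)\,du<\infty$ and $\int\Phi(|u|)|u|^N\,du<\infty$. Let $\psi:\mathbb R\to\mathbb R$ be an associated mother wavelet, i.e. $\{\psi_{0k}:k\in\mathbb Z\}$ is an orthonormal basis of the orthogonal complement of $V_0$ in $V_1$. Assume that $\varphi$ and $\psi$ are supported in $[-A,A]$. Let $D^s_{pq}=D^s_{pq}(L,T)$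 be the set of probability densities $f$ with support in $[-T,T]$ such that $$\Big\|\Big(\int f\varphi_{0k}\Big)_{k\in\mathbb Z}\Big\|_{\ell^p}+\Big\|\Big(2^{j(s+1/2-1/p)}\Big\|\Big(\int f\psi_{jk}\Big)_{k\in\mathbb Z}\Big\|_{\ell^p}\Big)_{j\ge0}\Big\|_{\ell^q}\le L .$$ For $n\ge1$, $\alpha>0$ and an integer $j_1\ge0$, let $X_1,\dots,X_n$ have density $f$, let the $W_{ijk}$ have the Laplace density $\tfrac12e^{-|x|}$, and let all these variables be mutually independent. Put $\psi_{-1,k}=\varphi_{0k}$, $c_A=2\lceil A\rceil+1$, $\mathcal N_j=\{k\in\mathbb Z:|k|\le 2^{\max(j,0)}T+A\}$ (the $k$ for which the $k$-th coefficient at level $j$ of a function supported in $[-T,T]$ can be non-zero), and, for $-1\le j\le j_1$ and $k\in\mathcal N_j$, $$Z_{ijk}=\psi_{jk}(X_i)+\tau_jW_{ijk},\qquad \tau_{-1}=\frac{4c_A\|\varphi\|_\infty}{\alpha},\qquad \tau_j=\frac{4c_A\|\psi\|_\infty}{\alpha}\cdot\frac{\sqrt2}{\sqrt2-1}\cdot2^{j_1/2}\quad(0\le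 j\le j_1).$$ The linear wavelet estimator is $$\widehat f_{\mathrm{lin}}(x)=\sum_{j=-1}^{j_1}\sum_{k\in\mathcal N_j}\widehat\beta_{jk}\,\psi_{jk}(x),\qquad \widehat\beta_{jk}=\frac1n\sum_{i=1}^nZ_{ijk}.$$ **Proposition.** (i) For every $\kappa>0$ there is a constant $C>0$, depending only on $\kappa,\varphi,\psi,A,N,s,p,q,L,T$ (and not on $n,\alpha,j_1$), such that for all integers $n\ge1$, $j_1\ge0$ and all $\alpha>0$ for which at least one of $p\le2$, $2^{j_1}\le\kappa n$, $\alpha\le\kappa$ holds, $$\sup_{f\in D^s_{pq}}\mathbb E\|\widehat f_{\mathrm{lin}}-f\|_p^p\le C\Big(2^{-j_1ps}+\Big(\frac{2^{2j_1}}{n\alpha^2}\Big)^{p/2}+\Big(\frac{2^{j_1}}n\Big)^{p/2}\Big).$$ (ii) For all $c_1,c_2>0$ there is a constant $C>0$, depending only on $c_1,c_2,\varphi,\psi,A,N,s,p,q,L,T$, such that for all integers $n\ge1$, $j_1\ge0$ and all $\alpha>0$ with $$c_1\big((n\alpha^2)^{\frac1{2s+2}}\wedge n^{\frac1{2s+1}}\big)\le2^{j_1}\le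 c_2\big((n\alpha^2)^{\frac1{2s+2}}\wedge n^{\frac1{2s+1}}\big),$$ $$\sup_{f\in D^s_{pq}}\mathbb E\|\widehat f_{\mathrm{lin}}-f\|_p^p\le C\Big((n\alpha^2)^{-\frac{ps}{2s+2}}\vee n^{-\frac{ps}{2s+1}}\Big).$$ -/

import Mathlib

open MeasureTheory ProbabilityTheory Set
open scoped ENNReal

universe u

noncomputable section

namespace LDPWavelet

/-! ### Wavelet bases -/

/-- The dilated and translated function `g_{jk} = 2^{j/2} g(2^j · - k)`. -/
def dil (g : ℝ → ℝ) (j k : ℤ) (x : ℝ) : ℝ :=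
  (2 : ℝ) ^ ((j : ℝ) / 2) * g ((2 : ℝ) ^ j * x - k)

/-- The closed linear span in `L²(ℝ)` of the functions `g_{jk}`, `k ∈ ℤ`. -/
def spanSpace (g : ℝ → ℝ) (j : ℤ) : Submodule ℝ (Lp ℝ 2 (volume : Measure ℝ)) :=
  (Submodule.span ℝ {u : Lp ℝ 2 (volume : Measure ℝ) |
    ∃ k : ℤ, (u : ℝ → ℝ) =ᵐ[volume] dil g j k}).topologicalClosure

/-- The integer translates of `g` form an orthonormal system in `L²(ℝ)`. -/
structure OrthonormalTranslates (g : ℝ → ℝ) : Prop where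
  memLp : MemLp g 2 volume
  inner_eq : ∀ k l : ℤ, ∫ x, dil g 0 k x * dil g 0 l x = if k = l then 1 else 0

/-- `φ` is a father wavelet, that is, it generates a multiresolution analysis of `L²(ℝ)`:
its integer translates are orthonormal, and the spaces `V_j` spanned by the `φ_{jk}` increase
with `j` and have a dense union. (That the `V_j` have trivial intersection follows.) -/
structure GeneratesMRA (φ : ℝ → ℝ) : Prop where
  orthonormal : OrthonormalTranslates φ
  nested : ∀ j : ℤ, spanSpace φ j ≤ spanSpace φ (j + 1)
  dense : Dense (⋃ j : ℤ, (spanSpace φ j : Set (Lp ℝ 2 (volume : Measure ℝ))))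

/-- `ψ` is a mother wavelet associated to the father wavelet `φ`: its integer translates form an
orthonormal basis of the orthogonal complement of `V_0` in `V_1`. -/
structure IsMotherWavelet (φ ψ : ℝ → ℝ) : Prop where
  orthonormal : OrthonormalTranslates ψ
  span_eq : spanSpace ψ 0 = spanSpace φ 1 ⊓ (spanSpace φ 0)ᗮ

/-- `v` is the weak derivative of order `m` of `u` on the real line. -/
structure IsWeakDeriv (m : ℕ) (u v : ℝ → ℝ) : Prop where
  locInt_left : LocallyIntegrable u volume
  locInt_right : LocallyIntegrable v volume
  integral_eq : ∀ η : ℝ → ℝ, ContDiff ℝ ((⊤ : ℕ∞) : WithTop ℕ∞) η → HasCompactSupport η →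
    ∫ x, u x * iteratedDeriv m η x = (-1) ^ m * ∫ x, v x * η x

/-- The regularity assumption on the father wavelet `φ`, with the integer `N`. -/
structure FatherAssumption (φ : ℝ → ℝ) (N : ℕ) : Prop where
  mra : GeneratesMRA φ
  weakDeriv : ∃ v : ℝ → ℝ, IsWeakDeriv (N + 1) φ v ∧
    ∃ M : ℝ, ∀ᵐ x : ℝ, ∑' k : ℤ, ENNReal.ofReal |v (x - k)| ≤ ENNReal.ofReal M
  majorant : ∃ Φ : ℝ → ℝ, BddAbove (Φ '' Ici 0) ∧ AntitoneOn Φ (Ici 0) ∧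
    (∀ u, |φ u| ≤ Φ |u|) ∧ Integrable (fun u => Φ |u|) volume ∧
    Integrable (fun u => Φ |u| * |u| ^ N) volume

/-! ### Besov ellipsoids of densities -/

/-- The wavelet coefficient `∫ f g_{jk}`. -/
def coeff (f g : ℝ → ℝ) (j k : ℤ) : ℝ := ∫ x, f x * dil g j k x

/-- The Besov sequence norm `J_{spq}(f)`. The norms of `ℓ^p(ℤ)` and of `ℓ^q(ℕ)` are those of
`L^p` and `L^q` for the counting measure, with values in `[0, ∞]`; `q = ∞` is allowed. -/
def besovJ (φ ψ : ℝ → ℝ) (s p : ℝ) (q : ℝ≥0∞) (f : ℝ → ℝ) : ℝ≥0∞ :=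
  eLpNorm (fun k : ℤ => coeff f φ 0 k) (ENNReal.ofReal p) Measure.count +
  eLpNorm (fun j : ℕ => ENNReal.ofReal ((2 : ℝ) ^ ((j : ℝ) * (s + 1 / 2 - 1 / p))) *
      eLpNorm (fun k : ℤ => coeff f ψ j k) (ENNReal.ofReal p) Measure.count) q Measure.count

/-- The class `D^s_{pq}(L, T)` of probability densities in the Besov ellipsoid of radius `L` with
support in `[-T, T]`. -/
structure MemDensityClass (φ ψ : ℝ → ℝ) (s p : ℝ) (q : ℝ≥0∞) (L T : ℝ) (f : ℝ → ℝ) : Prop where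
  besov : besovJ φ ψ s p q f ≤ ENNReal.ofReal L
  nonneg : ∀ x, 0 ≤ f x
  integrable : Integrable f volume
  integral_eq_one : ∫ x, f x = 1
  support_subset : Function.support f ⊆ Icc (-T) T

/-! ### The privacy mechanism and the linear estimator -/

/-- The centred Laplace distribution with parameter `1`. -/
def laplaceOne : Measure ℝ :=
  volume.withDensity fun x => ENNReal.ofReal (Real.exp (-|x|) / 2)

/-- The basis functions `ψ_{jk}` for `j ≥ 0`, with the convention `ψ_{-1,k} = φ_{0k}`. -/
def basisFun (φ ψ : ℝ → ℝ) (j k : ℤ) : ℝ → ℝ :=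
  if j = -1 then dil φ 0 k else dil ψ j k

/-- The finite set `N_j` of the `k` for which the coefficient with index `(j, k)` of a function
supported in `[-T, T]` may be non-zero, for wavelets supported in `[-A, A]`: those for which
`2^{-j} [k - A, k + A]` meets `[-T, T]`, i.e. `|k| ≤ 2^j T + A`. The index `j = -1` stands for the
functions `φ_{0k}`, which have the scale `2^0`. -/
def translations (A T : ℝ) (j : ℤ) : Finset ℤ :=
  Finset.Icc (-⌊(2 : ℝ) ^ (max j 0) * T + A⌋) ⌊(2 : ℝ) ^ (max j 0) * T + A⌋

/-- The pairs `(j, k)` with `-1 ≤ j ≤ j₁` and `k ∈ N_j`. -/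
def indexSet (A T : ℝ) (j₁ : ℕ) : Set (ℤ × ℤ) :=
  {t | t.1 ∈ Finset.Icc (-1 : ℤ) j₁ ∧ t.2 ∈ translations A T t.1}

/-- The norm of `L^∞(ℝ)`. -/
def supNorm (g : ℝ → ℝ) : ℝ := (eLpNorm g ∞ volume).toReal

/-- The noise levels: `σ_{-1}` for `j = -1` (with `j₀ = 0`) and `σ̃_j` for `0 ≤ j ≤ j₁`. -/
def noiseLevel (φ ψ : ℝ → ℝ) (A α : ℝ) (j₁ : ℕ) (j : ℤ) : ℝ :=
  if j = -1 then 4 * (2 * (⌈A⌉ : ℝ) + 1) * supNorm φ / α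
  else 4 * (2 * (⌈A⌉ : ℝ) + 1) * supNorm ψ / α * (√2 / (√2 - 1)) * (2 : ℝ) ^ ((j₁ : ℝ) / 2)

/-- The private views `Z_{ijk}`, as functions of the observation `x = X_i` and of the noise
`w = W_{ijk}`. -/
def privateView (φ ψ : ℝ → ℝ) (A α : ℝ) (j₁ : ℕ) (j k : ℤ) (x w : ℝ) : ℝ :=
  basisFun φ ψ j k x + noiseLevel φ ψ A α j₁ j * w

/-- The linear wavelet estimator computed from private views `Z_{ijk}`. -/
def linEstimator (φ ψ : ℝ → ℝ) (A T : ℝ) (j₁ n : ℕ) (Z : Fin n → ℤ → ℤ → ℝ) (x : ℝ) : ℝ :=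
  ∑ j ∈ Finset.Icc (-1 : ℤ) j₁, ∑ k ∈ translations A T j,
    ((1 / (n : ℝ)) * ∑ i, Z i j k) * basisFun φ ψ j k x

/-- The `X_i` have the density `f`, the `W_{ijk}` with `(j, k) ∈ I` are Laplace distributed with
parameter `1`, and all these random variables are mutually independent. -/
structure IsSample {Ω : Type*} [MeasurableSpace Ω] (P : Measure Ω) (f : ℝ → ℝ) (n : ℕ)
    (I : Set (ℤ × ℤ)) (X : Fin n → Ω → ℝ) (W : Fin n → ℤ → ℤ → Ω → ℝ) : Prop where
  law_X : ∀ i, HasLaw (X i) (volume.withDensity fun x => ENNReal.ofReal (f x)) P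
  law_W : ∀ i, ∀ t ∈ I, HasLaw (W i t.1 t.2) laplaceOne P
  indep : iIndepFun (β := fun _ : Fin n ⊕ (Fin n × I) => ℝ)
    (Sum.elim X fun t => W t.1 t.2.1.1 t.2.1.2) P

/-- The risk `E ‖f̂_lin - f‖_p^p`, with values in `[0, ∞]`, of the linear estimator built from the
private views of the `X_i` with the noise variables `W_{ijk}`. -/
def linRisk {Ω : Type*} [MeasurableSpace Ω] (P : Measure Ω) (φ ψ : ℝ → ℝ) (A T α p : ℝ)
    (j₁ n : ℕ) (f : ℝ → ℝ) (X : Fin n → Ω → ℝ) (W : Fin n → ℤ → ℤ → Ω → ℝ) : ℝ≥0∞ :=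
  ∫⁻ ω, eLpNorm (fun x => linEstimator φ ψ A T j₁ n
    (fun i j k => privateView φ ψ A α j₁ j k (X i ω) (W i j k ω)) x - f x)
    (ENNReal.ofReal p) volume ^ p ∂P

/-- `sup_f E ‖f̂_lin - f‖_p^p ≤ B`, the supremum being over the densities `f` in
`D^s_{pq}(L, T)`; the sample may be realised on any probability space. -/
def SupRiskLE (φ ψ : ℝ → ℝ) (A s p : ℝ) (q : ℝ≥0∞) (L T : ℝ) (n : ℕ) (α : ℝ) (j₁ : ℕ)
    (B : ℝ) : Prop :=
  ∀ f : ℝ → ℝ, MemDensityClass φ ψ s p q L T f →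
    ∀ (Ω : Type u) [MeasurableSpace Ω] (P : Measure Ω) [IsProbabilityMeasure P]
      (X : Fin n → Ω → ℝ) (W : Fin n → ℤ → ℤ → Ω → ℝ),
      IsSample P f n (indexSet A T j₁) X W →
        linRisk P φ ψ A T α p j₁ n f X W ≤ ENNReal.ofReal B

end LDPWavelet

end

/-!
The estimator is the empirical version of the projection of `f` onto the wavelet space at level
`j₁ + 1`, with noise added to its coefficients, so the `L^p` error splits into a bias and a
stochastic error.

*Bias.* A density in `L¹` is the `L¹` limit of its projections, hence `f` differs from its
projection by the sum of the details at the levels above `j₁`. As `ψ` is bounded with compact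
support, only boundedly many `ψ_{jk}` are non-zero at a point, so the `L^p` norm of the detail at
level `j` is at most a constant times `2^{j(1/2 - 1/p)}` times the `ℓ^p` norm of its coefficients,
which is of order `2^{-js}` by the Besov condition. The same estimates show that the `L^p` norm of
`f` is bounded over the class.

*Stochastic error.* Rosenthal's inequality bounds the `p`-th moment of the error of the coefficient
`(j, k)` in terms of the mass that `f` gives to the support of `ψ_{jk}`. These supports overlap
boundedly, and Hölder's inequality together with the bound for the `L^p` norm of `f` controls the
sums over `k` of the powers of the masses. The sum over the levels is geometric. For `p > 2`
Rosenthal's inequality has a second term, with the `p`-th moments of the summands; it is absorbed by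
one of the two stochastic rates as soon as `2 ^ j₁ ≤ κ n` or `α ≤ κ`.
-/

namespace LDPWavelet

/-! ### Rosenthal's inequality -/

lemma rpow_add_mul_sub_le_rpow {r x y : ℝ} (hr : 1 ≤ r) (hx : 0 < x) (hy : 0 ≤ y) :
    x ^ r + r * x ^ (r - 1) * (y - x) ≤ y ^ r := by
  have bernoulli : 1 + r * (y / x - 1) ≤ (1 + (y / x - 1)) ^ r :=
    one_add_mul_self_le_rpow_one_add (by linarith [div_nonneg hy hx.le]) hr
  rw [add_sub_cancel, Real.div_rpow hy hx.le, le_div_iff₀ (Real.rpow_pos_of_pos hx r)] at bernoulli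
  calc x ^ r + r * x ^ (r - 1) * (y - x) = (1 + r * (y / x - 1)) * x ^ r := by
        rw [Real.rpow_sub_one hx.ne']
        field_simp
    _ ≤ y ^ r := bernoulli

lemma one_add_rpow_le_quadratic {p t : ℝ} (hp : 2 ≤ p) (ht : -1 < t) (ht' : t ≤ 1) :
    (1 + t) ^ p ≤ 1 + p * t + p * (p - 1) * 2 ^ (p - 2) * t ^ 2 := by
  have tangent : (1 + t) ^ p ≤ 1 + p * (t * (1 + t) ^ (p - 1)) := by
    have := rpow_add_mul_sub_le_rpow (r := p) (x := 1 + t) (by linarith) (by linarith) zero_le_one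
    rw [Real.one_rpow] at this
    linarith
  have derivative_increment : t * (1 + t) ^ (p - 1) ≤ t + (p - 1) * 2 ^ (p - 2) * t ^ 2 := by
    rcases le_total 0 t with h | h
    · have := rpow_add_mul_sub_le_rpow (r := p - 1) (x := 1 + t) (by linarith) (by linarith)
        zero_le_one
      have hpow : (1 + t) ^ (p - 2) ≤ 2 ^ (p - 2) :=
        Real.rpow_le_rpow (by linarith) (by linarith) (by linarith)
      rw [Real.one_rpow, sub_sub, one_add_one_eq_two] at this
      calc t * (1 + t) ^ (p - 1) ≤ t * (1 + (p - 1) * (1 + t) ^ (p - 2) * t) := by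
            gcongr
            linarith
        _ ≤ t * (1 + (p - 1) * 2 ^ (p - 2) * t) := by
            gcongr
            linarith
        _ = t + (p - 1) * 2 ^ (p - 2) * t ^ 2 := by ring
    · have := rpow_add_mul_sub_le_rpow (r := p - 1) (y := 1 + t) (by linarith) one_pos
        (by linarith)
      rw [Real.one_rpow, Real.one_rpow] at this
      calc t * (1 + t) ^ (p - 1) ≤ t * (1 + (p - 1) * 1 * (1 + t - 1)) :=
            mul_le_mul_of_nonpos_left this h
        _ = t + (p - 1) * 1 * t ^ 2 := by ring
        _ ≤ t + (p - 1) * 2 ^ (p - 2) * t ^ 2 := by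
            gcongr
            · linarith
            · exact Real.one_le_rpow one_le_two (by linarith)
  calc (1 + t) ^ p ≤ 1 + p * (t + (p - 1) * 2 ^ (p - 2) * t ^ 2) :=
        tangent.trans (by gcongr)
    _ = _ := by ring

/-- The constant in Rosenthal's inequality `integral_abs_sum_rpow_le`. -/
noncomputable def rosenthalConst (p : ℝ) : ℝ := 2 * (p ^ 2 * 2 ^ p)

lemma rosenthalConst_nonneg (p : ℝ) : 0 ≤ rosenthalConst p := by
  unfold rosenthalConst
  positivity

lemma abs_rpow_sub_two_mul_sq {p : ℝ} (hp : 2 ≤ p) (a : ℝ) : |a| ^ (p - 2) * a ^ 2 = |a| ^ p := by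
  rw [← sq_abs, ← Real.rpow_two, ← Real.rpow_add_of_nonneg (abs_nonneg a) (by linarith) two_pos.le,
    sub_add_cancel]

lemma abs_add_rpow_le_of_abs_le {p a b : ℝ} (hp : 2 ≤ p) (hab : |a| ≤ |b|) :
    |a + b| ^ p ≤ |a| ^ p + p * (|a| ^ (p - 2) * a * b) + p ^ 2 * 2 ^ p * |b| ^ p := by
  have sum_le : |a + b| ^ p ≤ 2 ^ p * |b| ^ p := by
    rw [← Real.mul_rpow two_pos.le (abs_nonneg b)]
    exact Real.rpow_le_rpow (abs_nonneg _) ((abs_add_le a b).trans (by linarith)) (by linarith)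
  have cross_le : -(|a| ^ (p - 2) * a * b) ≤ |b| ^ p := by
    calc -(|a| ^ (p - 2) * a * b) ≤ |a| ^ (p - 2) * (|a| * |b|) := by
          rw [← abs_mul, mul_assoc, ← mul_neg]
          gcongr
          exact neg_le_abs _
      _ ≤ |b| ^ (p - 2) * (|b| * |b|) := by
          gcongr
      _ = |b| ^ p := by rw [← sq, sq_abs, abs_rpow_sub_two_mul_sq hp]
  have const_le : 2 ^ p + p ≤ p ^ 2 * 2 ^ p := by
    have : 1 + p * 1 ≤ (1 + 1) ^ p := one_add_mul_self_le_rpow_one_add (by norm_num) (by linarith)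
    rw [one_add_one_eq_two] at this
    have : 4 * 2 ^ p ≤ p ^ 2 * 2 ^ p := by
      gcongr
      nlinarith
    linarith
  nlinarith [Real.rpow_nonneg (abs_nonneg a) p, Real.rpow_nonneg (abs_nonneg b) p]

lemma abs_add_rpow_le_of_abs_lt {p a b : ℝ} (hp : 2 ≤ p) (hab : |b| < |a|) :
    |a + b| ^ p ≤ |a| ^ p + p * (|a| ^ (p - 2) * a * b) +
      p ^ 2 * 2 ^ p * (|a| ^ (p - 2) * b ^ 2) := by
  have ha : a ≠ 0 := abs_pos.mp ((abs_nonneg b).trans_lt hab)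
  have ht : |b / a| < 1 := by rwa [abs_div, div_lt_one (abs_pos.mpr ha)]
  have hb : b = a * (b / a) := by field_simp
  have const_le : p * (p - 1) * 2 ^ (p - 2) ≤ p ^ 2 * 2 ^ p := by
    gcongr
    · nlinarith
    · exact one_le_two
    · linarith
  generalize b / a = t at *
  subst hb
  obtain ⟨ht₁, ht₂⟩ := abs_lt.mp ht
  calc |a + a * t| ^ p = |a| ^ p * (1 + t) ^ p := by
        rw [← mul_one_add, abs_mul, abs_of_pos (by linarith : 0 < 1 + t),
          Real.mul_rpow (abs_nonneg a) (by linarith)]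
    _ ≤ |a| ^ p * (1 + p * t + p ^ 2 * 2 ^ p * t ^ 2) := by
        gcongr
        exact (one_add_rpow_le_quadratic hp ht₁ ht₂.le).trans (by gcongr)
    _ = _ := by
        rw [← abs_rpow_sub_two_mul_sq hp]
        ring

lemma abs_add_rpow_le {p : ℝ} (hp : 2 ≤ p) (a b : ℝ) :
    |a + b| ^ p ≤ |a| ^ p + p * (|a| ^ (p - 2) * a * b) +
      rosenthalConst p / 2 * (|a| ^ (p - 2) * b ^ 2 + |b| ^ p) := by
  have hquad : 0 ≤ p ^ 2 * 2 ^ p * (|a| ^ (p - 2) * b ^ 2) := by positivity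
  have hpow : 0 ≤ p ^ 2 * 2 ^ p * |b| ^ p := by positivity
  rw [rosenthalConst, mul_div_cancel_left₀ _ two_ne_zero, mul_add]
  rcases le_or_gt |a| |b| with h | h
  · linarith [abs_add_rpow_le_of_abs_le hp h]
  · linarith [abs_add_rpow_le_of_abs_lt hp h]

section Moments

variable {Ω : Type*} [MeasurableSpace Ω] {P : Measure Ω} {X Y : Ω → ℝ} {p r : ℝ}

lemma integrable_abs_rpow [IsFiniteMeasure P] (hr : 0 ≤ r) (hrp : r ≤ p)
    (hX : MemLp X (ENNReal.ofReal p) P) : Integrable (fun ω => |X ω| ^ r) P := by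
  have := (hX.mono_exponent (ENNReal.ofReal_le_ofReal hrp)).integrable_norm_rpow'
  simpa only [ENNReal.toReal_ofReal hr, Real.norm_eq_abs] using this

variable [IsProbabilityMeasure P]

lemma integral_abs_rpow_le (hr : 0 ≤ r) (hrp : r ≤ p) (hp : 0 < p)
    (hX : MemLp X (ENNReal.ofReal p) P) :
    ∫ ω, |X ω| ^ r ∂P ≤ (∫ ω, |X ω| ^ p ∂P) ^ (r / p) := by
  have hpow : ∀ ω, |X ω| ^ r = (|X ω| ^ p) ^ (r / p) := fun ω => by
    rw [← Real.rpow_mul (abs_nonneg _), mul_div_cancel₀ _ hp.ne']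
  have hrp₀ : 0 ≤ r / p := div_nonneg hr hp.le
  have jensen := (Real.concaveOn_rpow hrp₀ ((div_le_one hp).mpr hrp)).le_map_integral
    (Real.continuous_rpow_const hrp₀).continuousOn isClosed_Ici
    (ae_of_all P fun ω => Real.rpow_nonneg (abs_nonneg (X ω)) p)
    (integrable_abs_rpow hp.le le_rfl hX)
    (by simpa only [Function.comp_def, ← hpow] using integrable_abs_rpow hr hrp hX)
  simpa only [← hpow] using jensen

lemma integral_abs_add_rpow_le (hp : 2 ≤ p) (hXY : IndepFun X Y P)
    (hX : MemLp X (ENNReal.ofReal p) P) (hY : MemLp Y (ENNReal.ofReal p) P)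
    (hmean : ∫ ω, Y ω ∂P = 0) :
    ∫ ω, |X ω + Y ω| ^ p ∂P ≤ ∫ ω, |X ω| ^ p ∂P + rosenthalConst p / 2 *
      ((∫ ω, |X ω| ^ (p - 2) ∂P) * ∫ ω, Y ω ^ 2 ∂P + ∫ ω, |Y ω| ^ p ∂P) := by
  have hXp := integrable_abs_rpow (by linarith) le_rfl hX
  have hYp := integrable_abs_rpow (by linarith) le_rfl hY
  have hXp2 : Integrable (fun ω => |X ω| ^ (p - 2)) P :=
    integrable_abs_rpow (by linarith) (by linarith) hX
  have hY1 : Integrable Y P :=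
    hY.integrable (by rw [← ENNReal.ofReal_one]; exact ENNReal.ofReal_le_ofReal (by linarith))
  have hY2 : Integrable (fun ω => Y ω ^ 2) P := by
    simpa only [Real.rpow_two, sq_abs] using integrable_abs_rpow two_pos.le hp hY
  have hderiv : Integrable (fun ω => |X ω| ^ (p - 2) * X ω) P := by
    refine (integrable_abs_rpow (r := p - 1) (by linarith) (by linarith) hX).mono'
      ((by fun_prop : Measurable fun x : ℝ => |x| ^ (p - 2) * x).comp_aemeasurable
        hX.1.aemeasurable).aestronglyMeasurable (ae_of_all _ fun ω => le_of_eq ?_)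
    rw [norm_mul, Real.norm_of_nonneg (Real.rpow_nonneg (abs_nonneg _) _), Real.norm_eq_abs,
      ← Real.rpow_add_one' (abs_nonneg _) (by linarith)]
    ring_nf
  have indep_linear : IndepFun (fun ω => |X ω| ^ (p - 2) * X ω) Y P :=
    hXY.comp (by fun_prop : Measurable fun x : ℝ => |x| ^ (p - 2) * x) measurable_id
  have indep_quadratic : IndepFun (fun ω => |X ω| ^ (p - 2)) (fun ω => Y ω ^ 2) P :=
    hXY.comp (by fun_prop : Measurable fun x : ℝ => |x| ^ (p - 2))
      (by fun_prop : Measurable fun x : ℝ => x ^ 2)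
  have integrable_linear : Integrable (fun ω => p * (|X ω| ^ (p - 2) * X ω * Y ω)) P :=
    (indep_linear.integrable_mul hderiv hY1).const_mul p
  have integrable_quadratic : Integrable (fun ω => |X ω| ^ (p - 2) * Y ω ^ 2) P :=
    indep_quadratic.integrable_mul hXp2 hY2
  have integrable_tangent : Integrable
      (fun ω => |X ω| ^ p + p * (|X ω| ^ (p - 2) * X ω * Y ω)) P := hXp.add integrable_linear
  have integrable_remainder : Integrable (fun ω => rosenthalConst p / 2 *
      (|X ω| ^ (p - 2) * Y ω ^ 2 + |Y ω| ^ p)) P := (integrable_quadratic.add hYp).const_mul _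
  have linear_term : ∫ ω, |X ω| ^ (p - 2) * X ω * Y ω ∂P = 0 := by
    rw [indep_linear.integral_fun_mul_eq_mul_integral hderiv.1 hY1.1, hmean, mul_zero]
  calc ∫ ω, |X ω + Y ω| ^ p ∂P
      ≤ ∫ ω, (|X ω| ^ p + p * (|X ω| ^ (p - 2) * X ω * Y ω) + rosenthalConst p / 2 *
          (|X ω| ^ (p - 2) * Y ω ^ 2 + |Y ω| ^ p)) ∂P :=
        integral_mono_of_nonneg (ae_of_all _ fun ω => Real.rpow_nonneg (abs_nonneg _) _)
          (integrable_tangent.add integrable_remainder)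
          (ae_of_all _ fun ω => abs_add_rpow_le hp (X ω) (Y ω))
    _ = _ := by
        rw [integral_add integrable_tangent integrable_remainder,
          integral_add hXp integrable_linear, integral_const_mul, linear_term, mul_zero, add_zero,
          integral_const_mul, integral_add integrable_quadratic hYp,
          indep_quadratic.integral_fun_mul_eq_mul_integral hXp2.1 hY2.1]

lemma mul_rpow_one_sub_add_le {K V R p : ℝ} (hp : 2 ≤ p) (hK : 0 ≤ K) (hV : 0 ≤ V)
    (hR : 0 ≤ R) : K / 2 * (((K * V) ^ (p / 2) + K * R) ^ (1 - 2 / p) * V + R) ≤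
      (K * V) ^ (p / 2) + K * R := by
  have hp0 : 0 < p := by linarith
  set B := (K * V) ^ (p / 2) + K * R
  have hB0 : 0 ≤ B := by positivity
  have hKR : K * R ≤ B := le_add_of_nonneg_left (by positivity)
  have hKV : K * V ≤ B ^ (2 / p) := by
    calc K * V = ((K * V) ^ (p / 2)) ^ (2 / p) := by
          rw [← Real.rpow_mul (by positivity), div_mul_div_comm, mul_comm p 2,
            div_self (by positivity), Real.rpow_one]
      _ ≤ B ^ (2 / p) := by
          gcongr
          exact le_add_of_nonneg_right (by positivity)
  have hBV : B ^ (1 - 2 / p) * (K * V) ≤ B := by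
    calc B ^ (1 - 2 / p) * (K * V) ≤ B ^ (1 - 2 / p) * B ^ (2 / p) := by gcongr
      _ = B := by
          rw [← Real.rpow_add_of_nonneg hB0 (sub_nonneg.mpr ((div_le_one hp0).mpr hp))
            (by positivity), sub_add_cancel, Real.rpow_one]
  linarith

lemma integral_abs_sum_insert_rpow_le {ι : Type*} [DecidableEq ι] {ξ : ι → Ω → ℝ} (hp : 2 ≤ p)
    (hind : iIndepFun ξ P) (hξ : ∀ i, MemLp (ξ i) (ENNReal.ofReal p) P)
    (hmean : ∀ i, ∫ ω, ξ i ω ∂P = 0) {s : Finset ι} {a : ι} (ha : a ∉ s) :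
    ∫ ω, |∑ i ∈ insert a s, ξ i ω| ^ p ∂P ≤ ∫ ω, |∑ i ∈ s, ξ i ω| ^ p ∂P +
      rosenthalConst p / 2 * ((∫ ω, |∑ i ∈ s, ξ i ω| ^ p ∂P) ^ (1 - 2 / p) *
        ∫ ω, ξ a ω ^ 2 ∂P + ∫ ω, |ξ a ω| ^ p ∂P) := by
  have hp0 : 0 < p := by linarith
  have hS : MemLp (fun ω => ∑ i ∈ s, ξ i ω) (ENNReal.ofReal p) P :=
    memLp_finsetSum s fun i _ => hξ i
  have hSa : IndepFun (fun ω => ∑ i ∈ s, ξ i ω) (ξ a) P := by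
    simpa only [Finset.sum_fn] using
      hind.indepFun_finsetSum_of_notMem₀ (fun i => (hξ i).1.aemeasurable) ha
  have lyapunov := integral_abs_rpow_le (r := p - 2) (by linarith) (by linarith) hp0 hS
  rw [sub_div, div_self hp0.ne'] at lyapunov
  have hK := rosenthalConst_nonneg p
  have : 0 ≤ ∫ ω, ξ a ω ^ 2 ∂P := integral_nonneg fun ω => sq_nonneg _
  simp only [Finset.sum_insert ha, add_comm (ξ a _)]
  exact (integral_abs_add_rpow_le hp hSa hS (hξ a) (hmean a)).trans (by gcongr)

lemma integral_abs_sum_rpow_le {ι : Type*} [Fintype ι] {ξ : ι → Ω → ℝ} (hp : 2 ≤ p)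
    (hind : iIndepFun ξ P) (hξ : ∀ i, MemLp (ξ i) (ENNReal.ofReal p) P)
    (hmean : ∀ i, ∫ ω, ξ i ω ∂P = 0) :
    ∫ ω, |∑ i, ξ i ω| ^ p ∂P ≤ (rosenthalConst p * ∑ i, ∫ ω, ξ i ω ^ 2 ∂P) ^ (p / 2) +
      rosenthalConst p * ∑ i, ∫ ω, |ξ i ω| ^ p ∂P := by
  classical
  have hK := rosenthalConst_nonneg p
  set K := rosenthalConst p
  set v : ι → ℝ := fun i => ∫ ω, ξ i ω ^ 2 ∂P
  set r : ι → ℝ := fun i => ∫ ω, |ξ i ω| ^ p ∂P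
  have hv : ∀ i, 0 ≤ v i := fun i => integral_nonneg fun ω => sq_nonneg _
  have hr : ∀ i, 0 ≤ r i := fun i => integral_nonneg fun ω => Real.rpow_nonneg (abs_nonneg _) _
  have hV : 0 ≤ ∑ i, v i := Finset.sum_nonneg fun i _ => hv i
  have hR : 0 ≤ ∑ i, r i := Finset.sum_nonneg fun i _ => hr i
  set B := (K * ∑ i, v i) ^ (p / 2) + K * ∑ i, r i
  have : 0 ≤ B := by positivity
  have majorant_le (s : Finset ι) :
      K / 2 * (B ^ (1 - 2 / p) * ∑ i ∈ s, v i + ∑ i ∈ s, r i) ≤ B := by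
    refine le_trans ?_ (mul_rpow_one_sub_add_le hp hK hV hR)
    gcongr K / 2 * (B ^ (1 - 2 / p) * ?_ + ?_)
    exacts [Finset.sum_le_univ_sum_of_nonneg hv, Finset.sum_le_univ_sum_of_nonneg hr]
  -- `B` bounds every partial sum, so it may replace the partial sum in the increment.
  have partial_le (s : Finset ι) : ∫ ω, |∑ i ∈ s, ξ i ω| ^ p ∂P ≤
      K / 2 * (B ^ (1 - 2 / p) * ∑ i ∈ s, v i + ∑ i ∈ s, r i) := by
    induction s using Finset.induction_on with
    | empty => simp [Real.zero_rpow (by linarith : p ≠ 0)]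
    | insert a s ha ih =>
      have partial_rpow_le : (∫ ω, |∑ i ∈ s, ξ i ω| ^ p ∂P) ^ (1 - 2 / p) ≤ B ^ (1 - 2 / p) :=
        Real.rpow_le_rpow (integral_nonneg fun ω => Real.rpow_nonneg (abs_nonneg _) _)
          (ih.trans (majorant_le s)) (sub_nonneg.mpr ((div_le_one (by linarith)).mpr hp))
      calc ∫ ω, |∑ i ∈ insert a s, ξ i ω| ^ p ∂P
          ≤ ∫ ω, |∑ i ∈ s, ξ i ω| ^ p ∂P +
              K / 2 * ((∫ ω, |∑ i ∈ s, ξ i ω| ^ p ∂P) ^ (1 - 2 / p) * v a + r a) :=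
            integral_abs_sum_insert_rpow_le hp hind hξ hmean ha
        _ ≤ K / 2 * (B ^ (1 - 2 / p) * ∑ i ∈ s, v i + ∑ i ∈ s, r i) +
              K / 2 * (B ^ (1 - 2 / p) * v a + r a) :=
            add_le_add ih (by have := hv a; gcongr)
        _ = _ := by
            rw [Finset.sum_insert ha, Finset.sum_insert ha]
            ring
  exact (partial_le Finset.univ).trans (majorant_le Finset.univ)

lemma integral_abs_sum_rpow_le_of_le_two {ι : Type*} [Fintype ι] {ξ : ι → Ω → ℝ} (hp0 : 0 ≤ p)
    (hp : p ≤ 2) (hind : iIndepFun ξ P) (hξ : ∀ i, MemLp (ξ i) 2 P)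
    (hmean : ∀ i, ∫ ω, ξ i ω ∂P = 0) :
    ∫ ω, |∑ i, ξ i ω| ^ p ∂P ≤ (∑ i, ∫ ω, ξ i ω ^ 2 ∂P) ^ (p / 2) := by
  have hS : MemLp (∑ i, ξ i) 2 P := memLp_finsetSum' Finset.univ fun i _ => hξ i
  have sum_mean : ∫ ω, (∑ i, ξ i) ω ∂P = 0 := by
    simp only [Finset.sum_apply]
    rw [integral_finsetSum _ fun i _ => (hξ i).integrable one_le_two]
    exact Finset.sum_eq_zero fun i _ => hmean i
  have second_moment : ∫ ω, (∑ i, ξ i) ω ^ 2 ∂P = ∑ i, ∫ ω, ξ i ω ^ 2 ∂P := by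
    rw [← variance_of_integral_eq_zero hS.1.aemeasurable sum_mean,
      IndepFun.variance_sum (fun i _ => hξ i) fun i _ j _ hij => hind.indepFun hij]
    exact Finset.sum_congr rfl fun i _ =>
      variance_of_integral_eq_zero (hξ i).1.aemeasurable (hmean i)
  have lyapunov := integral_abs_rpow_le hp0 hp two_pos (X := ∑ i, ξ i) (P := P)
    (by simpa only [ENNReal.ofReal_ofNat] using hS)
  simp only [Real.rpow_two, sq_abs, second_moment] at lyapunov
  simpa only [Finset.sum_apply] using lyapunov

/-- The weight of the moments of order `p` in the moment inequality `integral_abs_sum_rpow_le_add`.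
It vanishes for `p ≤ 2`, where the variances suffice. -/
noncomputable def highMomentWeight (p : ℝ) : ℝ := if p ≤ 2 then 0 else rosenthalConst p

lemma highMomentWeight_nonneg (p : ℝ) : 0 ≤ highMomentWeight p := by
  unfold highMomentWeight
  split_ifs
  exacts [le_rfl, rosenthalConst_nonneg p]

lemma integral_abs_sum_rpow_le_add {ι : Type*} [Fintype ι] {ξ : ι → Ω → ℝ} (hp : 0 ≤ p)
    (hind : iIndepFun ξ P) (hξ : ∀ i, MemLp (ξ i) (ENNReal.ofReal p) P)
    (hξ2 : ∀ i, MemLp (ξ i) 2 P) (hmean : ∀ i, ∫ ω, ξ i ω ∂P = 0) :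
    ∫ ω, |∑ i, ξ i ω| ^ p ∂P ≤ ((1 + rosenthalConst p) * ∑ i, ∫ ω, ξ i ω ^ 2 ∂P) ^ (p / 2) +
      highMomentWeight p * ∑ i, ∫ ω, |ξ i ω| ^ p ∂P := by
  have hV : 0 ≤ ∑ i, ∫ ω, ξ i ω ^ 2 ∂P :=
    Finset.sum_nonneg fun i _ => integral_nonneg fun ω => sq_nonneg _
  have hR := rosenthalConst_nonneg p
  unfold highMomentWeight
  split_ifs with hp2
  · rw [zero_mul, add_zero]
    refine (integral_abs_sum_rpow_le_of_le_two hp hp2 hind hξ2 hmean).trans ?_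
    gcongr
    exact le_mul_of_one_le_left hV (le_add_of_nonneg_right hR)
  · refine (integral_abs_sum_rpow_le (not_le.1 hp2).le hind hξ hmean).trans ?_
    gcongr
    exact le_add_of_nonneg_left zero_le_one

end Moments

section Laplace

lemma integrable_abs_rpow_mul_exp_neg_abs {r : ℝ} (hr : 0 ≤ r) :
    Integrable (fun x : ℝ => |x| ^ r * Real.exp (-|x|)) volume := by
  have on_Ioi : IntegrableOn (fun x : ℝ => |x| ^ r * Real.exp (-|x|)) (Ioi 0) volume := by
    refine (Real.GammaIntegral_convergent (s := r + 1) (by linarith)).congr_fun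
      (fun x hx => ?_) measurableSet_Ioi
    rw [abs_of_pos (mem_Ioi.1 hx), add_sub_cancel_right, mul_comm]
  have on_Iio : IntegrableOn (fun x : ℝ => |x| ^ r * Real.exp (-|x|)) (Iio 0) volume := by
    simpa using IntegrableOn.comp_neg_Iio (c := (0 : ℝ))
      (f := fun x : ℝ => |x| ^ r * Real.exp (-|x|)) (by rwa [neg_zero])
  rw [← integrableOn_univ, ← Iic_union_Ioi (a := (0 : ℝ))]
  exact (integrableOn_Iic_iff_integrableOn_Iio (by simp)|>.2 on_Iio).union on_Ioi

lemma integrable_abs_rpow_laplaceOne {r : ℝ} (hr : 0 ≤ r) :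
    Integrable (fun x : ℝ => |x| ^ r) laplaceOne := by
  unfold laplaceOne
  rw [integrable_withDensity_iff_integrable_smul' (by fun_prop) (ae_of_all _ fun x => by simp)]
  refine ((integrable_abs_rpow_mul_exp_neg_abs hr).const_mul (1 / 2)).congr
    (ae_of_all _ fun x => ?_)
  dsimp only
  rw [smul_eq_mul, ENNReal.toReal_ofReal (by positivity)]
  ring

lemma memLp_id_laplaceOne {r : ℝ} (hr : 0 < r) :
    MemLp (fun x : ℝ => x) (ENNReal.ofReal r) laplaceOne := by
  rw [← integrable_norm_rpow_iff (by fun_prop) (by simpa using hr) ENNReal.ofReal_ne_top]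
  simpa [ENNReal.toReal_ofReal hr.le] using integrable_abs_rpow_laplaceOne hr.le

lemma integral_id_laplaceOne : ∫ x, x ∂laplaceOne = 0 := by
  unfold laplaceOne
  rw [integral_withDensity_eq_integral_toReal_smul (by fun_prop) (ae_of_all _ fun x => by simp)]
  have reflection := integral_neg_eq_self
    (fun x : ℝ => (ENNReal.ofReal (Real.exp (-|x|) / 2)).toReal • x) volume
  simp only [abs_neg, smul_neg, integral_neg] at reflection
  linarith

/-- The absolute moment of order `r` of the Laplace distribution. -/
noncomputable def laplaceMoment (r : ℝ) : ℝ := ∫ x, |x| ^ r ∂laplaceOne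

lemma laplaceMoment_nonneg (r : ℝ) : 0 ≤ laplaceMoment r :=
  integral_nonneg fun _ => Real.rpow_nonneg (abs_nonneg _) _

variable {Ω : Type*} [MeasurableSpace Ω] {P : Measure Ω} {Y : Ω → ℝ}

lemma memLp_of_hasLaw_laplaceOne (hY : HasLaw Y laplaceOne P) {r : ℝ} (hr : 0 < r) :
    MemLp Y (ENNReal.ofReal r) P :=
  (hY.map_eq.symm ▸ memLp_id_laplaceOne hr : MemLp (fun x => x) _ (P.map Y)).comp_of_map
    hY.aemeasurable

lemma integral_of_hasLaw_laplaceOne (hY : HasLaw Y laplaceOne P) : ∫ ω, Y ω ∂P = 0 := by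
  rw [hY.integral_eq, integral_id_laplaceOne]

lemma integral_abs_rpow_of_hasLaw_laplaceOne (hY : HasLaw Y laplaceOne P) (r : ℝ) :
    ∫ ω, |Y ω| ^ r ∂P = laplaceMoment r :=
  hY.integral_comp (f := fun x : ℝ => |x| ^ r)
    (by fun_prop : Measurable fun x : ℝ => |x| ^ r).aestronglyMeasurable

end Laplace

/-! ### Bounded compactly supported functions and their dilations -/

/-- `g` is measurable, almost everywhere bounded by `B`, and supported in `[-A, A]`. Both wavelets
have this property. -/
structure IsLocalized (A B : ℝ) (g : ℝ → ℝ) : Prop where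
  radius_nonneg : 0 ≤ A
  bound_nonneg : 0 ≤ B
  aestronglyMeasurable : AEStronglyMeasurable g volume
  ae_abs_le : ∀ᵐ x, |g x| ≤ B
  support_subset : Function.support g ⊆ Icc (-A) A

/-- The interval `2^{-j} [k - A, k + A]`, outside of which `g_{jk}` vanishes when `g` is supported
in `[-A, A]`. -/
def cell (A : ℝ) (j k : ℤ) : Set ℝ := {x | |(2 : ℝ) ^ j * x - k| ≤ A}

lemma quasiMeasurePreserving_mul_sub {c : ℝ} (hc : c ≠ 0) (d : ℝ) :
    Measure.QuasiMeasurePreserving (fun x : ℝ => c * x - d) volume volume :=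
  (measurePreserving_sub_right volume d).quasiMeasurePreserving.comp
    (Measure.quasiMeasurePreserving_smul volume hc)

lemma cell_eq_Icc (A : ℝ) (j k : ℤ) :
    cell A j k = Icc ((k - A) / (2 : ℝ) ^ j) ((k + A) / (2 : ℝ) ^ j) := by
  ext x
  have two_zpow_pos : (0 : ℝ) < 2 ^ j := by positivity
  simp only [cell, mem_ofPred_eq, mem_Icc, abs_le, div_le_iff₀ two_zpow_pos,
    le_div_iff₀ two_zpow_pos, neg_le_sub_iff_le_add, sub_le_iff_le_add, mul_comm x,
    add_comm (k : ℝ)]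

lemma measurableSet_cell (A : ℝ) (j k : ℤ) : MeasurableSet (cell A j k) := by
  rw [cell_eq_Icc]
  exact measurableSet_Icc

lemma volume_cell (A : ℝ) (j k : ℤ) :
    volume (cell A j k) = ENNReal.ofReal (2 * A * (2 : ℝ) ^ (-j)) := by
  rw [cell_eq_Icc, Real.volume_Icc, ← sub_div, zpow_neg, div_eq_mul_inv]
  congr 2
  ring

section Overlap

variable {A : ℝ} (hA : 0 ≤ A) (j : ℤ) (x : ℝ) (S : Finset ℤ)

include hA

lemma card_le_of_mem_cell (hS : ∀ k ∈ S, x ∈ cell A j k) : (S.card : ℝ) ≤ 2 * A + 1 := by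
  set y := (2 : ℝ) ^ j * x
  have S_subset : S ⊆ Finset.Icc ⌈y - A⌉ ⌊y + A⌋ := fun k hk => by
    have := abs_le.1 (mem_ofPred_eq.mp (hS k hk))
    rw [Finset.mem_Icc, Int.ceil_le, Int.le_floor]
    constructor <;> linarith
  calc (S.card : ℝ) ≤ (((⌊y + A⌋ + 1 - ⌈y - A⌉).toNat : ℤ) : ℝ) := by
        rw [← Int.card_Icc]
        exact_mod_cast Finset.card_le_card S_subset
    _ = max (⌊y + A⌋ + 1 - ⌈y - A⌉ : ℝ) 0 := by
        rw [Int.toNat_eq_max]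
        push_cast
        rfl
    _ ≤ 2 * A + 1 := max_le
        (by linarith [Int.floor_le (y + A), Int.le_ceil (y - A)]) (by linarith)

lemma sum_indicator_cell_le : ∑ k ∈ S, (cell A j k).indicator (fun _ => (1 : ℝ)) x ≤ 2 * A + 1 := by
  classical
  simp only [indicator_apply, Finset.sum_boole]
  exact card_le_of_mem_cell hA j x _ fun k hk => (Finset.mem_filter.1 hk).2

lemma abs_sum_rpow_le_of_cell {p : ℝ} (hp : 1 ≤ p) {b : ℤ → ℝ}
    (hb : ∀ k, x ∉ cell A j k → b k = 0) :
    |∑ k ∈ S, b k| ^ p ≤ (2 * A + 1) ^ (p - 1) * ∑ k ∈ S, |b k| ^ p := by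
  classical
  set S' := S.filter fun k => x ∈ cell A j k
  have card_le : (S'.card : ℝ) ≤ 2 * A + 1 :=
    card_le_of_mem_cell hA j x _ fun k hk => (Finset.mem_filter.1 hk).2
  calc |∑ k ∈ S, b k| ^ p = |∑ k ∈ S', b k| ^ p := by
        rw [Finset.sum_filter_of_ne fun k _ hk => not_imp_comm.1 (hb k) hk]
    _ ≤ (∑ k ∈ S', |b k|) ^ p := by
        gcongr
        exact Finset.abs_sum_le_sum_abs _ _
    _ ≤ (S'.card : ℝ) ^ (p - 1) * ∑ k ∈ S', |b k| ^ p :=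
        Real.rpow_sum_le_const_mul_sum_rpow _ _ hp
    _ ≤ (2 * A + 1) ^ (p - 1) * ∑ k ∈ S, |b k| ^ p := by
        have : 0 ≤ p - 1 := by linarith
        gcongr
        exact Finset.filter_subset _ _

end Overlap

lemma eLpNorm_le_of_ae_abs_rpow_le {X : Type*} [MeasurableSpace X] {μ : Measure X} {p : ℝ}
    (hp : 0 < p) {f h : X → ℝ} (hh : Integrable h μ) (hfh : ∀ᵐ x ∂μ, |f x| ^ p ≤ h x) :
    eLpNorm f (ENNReal.ofReal p) μ ≤ ENNReal.ofReal ((∫ x, h x ∂μ) ^ (1 / p)) := by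
  have h_nonneg : 0 ≤ᵐ[μ] h := hfh.mono fun x hx =>
    (Real.rpow_nonneg (abs_nonneg _) _).trans hx
  rw [eLpNorm_eq_lintegral_rpow_enorm_toReal (by simpa using hp) ENNReal.ofReal_ne_top,
    ENNReal.toReal_ofReal hp.le,
    ← ENNReal.ofReal_rpow_of_nonneg (integral_nonneg_of_ae h_nonneg) (by positivity),
    ofReal_integral_eq_lintegral_ofReal hh h_nonneg]
  gcongr ?_ ^ (1 / p)
  refine lintegral_mono_ae (hfh.mono fun x hx => ?_)
  rw [Real.enorm_eq_ofReal_abs, ENNReal.ofReal_rpow_of_nonneg (abs_nonneg _) hp.le]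
  exact ENNReal.ofReal_le_ofReal hx

/-- The norm bound of the synthesis map `a ↦ ∑ a_k g_{0k}` from `ℓ^p` to `L^p`, for `g` localized
with radius `A` and bound `B`. -/
noncomputable def synthConst (A B p : ℝ) : ℝ :=
  ((2 * A + 1) ^ (p - 1) * B ^ p * (2 * A)) ^ (1 / p)

lemma synthConst_nonneg {A B : ℝ} (hA : 0 ≤ A) (hB : 0 ≤ B) (p : ℝ) : 0 ≤ synthConst A B p := by
  unfold synthConst
  positivity

namespace IsLocalized

variable {A B : ℝ} {g : ℝ → ℝ}

lemma dil_eq_zero (hg : IsLocalized A B g) {j k : ℤ} {x : ℝ} (hx : x ∉ cell A j k) :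
    dil g j k x = 0 := by
  have g_eq_zero : g ((2 : ℝ) ^ j * x - k) = 0 :=
    Function.notMem_support.1 fun h => hx (abs_le.2 (hg.support_subset h))
  rw [dil, g_eq_zero, mul_zero]

lemma aestronglyMeasurable_dil (hg : IsLocalized A B g) (j k : ℤ) :
    AEStronglyMeasurable (dil g j k) volume :=
  (hg.aestronglyMeasurable.comp_quasiMeasurePreserving
    (quasiMeasurePreserving_mul_sub (by positivity) _)).const_mul _

lemma ae_abs_dil_le (hg : IsLocalized A B g) :
    ∀ᵐ x, ∀ j k : ℤ, |dil g j k x| ≤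
      (cell A j k).indicator (fun _ => B * (2 : ℝ) ^ ((j : ℝ) / 2)) x := by
  refine ae_all_iff.2 fun j => ae_all_iff.2 fun k => ?_
  filter_upwards [(quasiMeasurePreserving_mul_sub (c := (2 : ℝ) ^ j) (by positivity)
    (k : ℝ)).ae hg.ae_abs_le] with x hx
  by_cases hc : x ∈ cell A j k
  · rw [indicator_of_mem hc, dil, abs_mul, abs_of_pos (by positivity), mul_comm]
    gcongr
  · rw [indicator_of_notMem hc, hg.dil_eq_zero hc, abs_zero]

lemma ae_abs_sum_dil_rpow_le (hg : IsLocalized A B g) {p : ℝ} (hp : 1 ≤ p) (j : ℤ)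
    (S : Finset ℤ) (a : ℤ → ℝ) :
    ∀ᵐ x, |∑ k ∈ S, a k * dil g j k x| ^ p ≤
      (2 * A + 1) ^ (p - 1) * (B * (2 : ℝ) ^ ((j : ℝ) / 2)) ^ p *
        ∑ k ∈ S, (cell A j k).indicator (fun _ => |a k| ^ p) x := by
  filter_upwards [hg.ae_abs_dil_le] with x hx
  have := hg.radius_nonneg
  have := hg.bound_nonneg
  have term_le (k : ℤ) : |a k * dil g j k x| ^ p ≤ (B * (2 : ℝ) ^ ((j : ℝ) / 2)) ^ p *
      (cell A j k).indicator (fun _ => |a k| ^ p) x := by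
    have dil_le := hx j k
    by_cases hk : x ∈ cell A j k
    · rw [indicator_of_mem hk] at dil_le ⊢
      rw [abs_mul, mul_comm, Real.mul_rpow (abs_nonneg _) (abs_nonneg _)]
      gcongr
    · rw [hg.dil_eq_zero hk, indicator_of_notMem hk, mul_zero, mul_zero, abs_zero,
        Real.zero_rpow (by linarith)]
  calc |∑ k ∈ S, a k * dil g j k x| ^ p
      ≤ (2 * A + 1) ^ (p - 1) * ∑ k ∈ S, |a k * dil g j k x| ^ p :=
        abs_sum_rpow_le_of_cell hg.radius_nonneg j x S hp fun k hk => by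
          rw [hg.dil_eq_zero hk, mul_zero]
    _ ≤ (2 * A + 1) ^ (p - 1) * ∑ k ∈ S, (B * (2 : ℝ) ^ ((j : ℝ) / 2)) ^ p *
          (cell A j k).indicator (fun _ => |a k| ^ p) x := by
        gcongr with k
        exact term_le k
    _ = _ := by rw [← Finset.mul_sum, mul_assoc]

lemma eLpNorm_sum_dil_le (hg : IsLocalized A B g) {p : ℝ} (hp : 1 ≤ p) (j : ℤ) (S : Finset ℤ)
    (a : ℤ → ℝ) :
    eLpNorm (fun x => ∑ k ∈ S, a k * dil g j k x) (ENNReal.ofReal p) volume ≤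
      ENNReal.ofReal (synthConst A B p * (2 : ℝ) ^ ((j : ℝ) * (1 / 2 - 1 / p)) *
        (∑ k ∈ S, |a k| ^ p) ^ (1 / p)) := by
  have hp0 : 0 < p := by linarith
  have hA := hg.radius_nonneg
  have hB := hg.bound_nonneg
  have integrable_term (k : ℤ) :
      Integrable ((cell A j k).indicator fun _ => |a k| ^ p) volume :=
    (integrable_indicator_iff (measurableSet_cell A j k)).2
      (integrableOn_const (by rw [volume_cell]; exact ENNReal.ofReal_ne_top))
  have integral_term (k : ℤ) :
      ∫ x, (cell A j k).indicator (fun _ => |a k| ^ p) x = 2 * A * 2 ^ (-j) * |a k| ^ p := by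
    rw [integral_indicator_const _ (measurableSet_cell A j k), smul_eq_mul, Measure.real,
      volume_cell, ENNReal.toReal_ofReal (by positivity)]
  have scale : (2 : ℝ) ^ ((j : ℝ) * (1 / 2 - 1 / p)) =
      (((2 : ℝ) ^ ((j : ℝ) / 2)) ^ p * (2 : ℝ) ^ (-j)) ^ (1 / p) := by
    rw [← Real.rpow_mul two_pos.le, ← Real.rpow_intCast, ← Real.rpow_add two_pos,
      ← Real.rpow_mul two_pos.le]
    congr 1
    push_cast
    field_simp
    ring
  refine (eLpNorm_le_of_ae_abs_rpow_le hp0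
    ((integrable_finsetSum _ fun k _ => integrable_term k).const_mul _)
    (hg.ae_abs_sum_dil_rpow_le hp j S a)).trans_eq (congrArg ENNReal.ofReal ?_)
  rw [integral_const_mul, integral_finsetSum _ fun k _ => integrable_term k, synthConst, scale,
    ← Real.mul_rpow (by positivity) (by positivity),
    ← Real.mul_rpow (by positivity) (by positivity)]
  simp only [integral_term, ← Finset.mul_sum]
  rw [Real.mul_rpow hB (by positivity)]
  congr 1
  ring

end IsLocalized

/-! ### Orthogonal projections onto the spaces of a multiresolution analysis -/

section Hilbert

variable {H : Type*} [NormedAddCommGroup H] [InnerProductSpace ℝ H]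

lemma starProjection_eq_add_of_eq_inf_orthogonal {V₀ V₁ W : Submodule ℝ H}
    [V₀.HasOrthogonalProjection] [V₁.HasOrthogonalProjection] [W.HasOrthogonalProjection]
    (hV : V₀ ≤ V₁) (hW : W = V₁ ⊓ V₀ᗮ) (v : H) :
    V₁.starProjection v = V₀.starProjection v + W.starProjection v := by
  rw [← sub_eq_iff_eq_add']
  refine (Submodule.eq_starProjection_of_mem_orthogonal ?_ ?_).symm
  · rw [hW]
    refine ⟨V₁.sub_mem (V₁.starProjection_apply_mem v) (hV (V₀.starProjection_apply_mem v)), ?_⟩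
    rw [← sub_sub_sub_cancel_left _ _ v]
    exact V₀ᗮ.sub_mem (V₀.sub_starProjection_mem_orthogonal v)
      (Submodule.orthogonal_le hV (V₁.sub_starProjection_mem_orthogonal v))
  · rw [hW, sub_sub_eq_add_sub, add_sub_right_comm]
    exact Submodule.add_mem _
      (Submodule.orthogonal_le inf_le_left (V₁.sub_starProjection_mem_orthogonal v))
      (Submodule.orthogonal_le inf_le_right
        (V₀.le_orthogonal_orthogonal (V₀.starProjection_apply_mem v)))

lemma starProjection_eq_sum {ι : Type*} {e : ι → H} (he : Orthonormal ℝ e) {V : Submodule ℝ H}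
    [V.HasOrthogonalProjection] (hV : V = (Submodule.span ℝ (range e)).topologicalClosure)
    (S : Finset ι) {v : H} (hS : ∀ k ∉ S, inner ℝ (e k) v = 0) :
    V.starProjection v = ∑ k ∈ S, inner ℝ (e k) v • e k := by
  classical
  subst hV
  refine (Submodule.eq_starProjection_of_mem_orthogonal ?_ ?_)
  · exact Submodule.le_topologicalClosure _ (Submodule.sum_mem _ fun k _ =>
      Submodule.smul_mem _ _ (Submodule.subset_span (mem_range_self k)))
  · rw [Submodule.orthogonal_closure, Submodule.mem_orthogonal]
    intro w hw
    induction hw using Submodule.span_induction with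
    | mem _ hx =>
      obtain ⟨l, rfl⟩ := hx
      by_cases hl : l ∈ S <;>
        simp [inner_sub_right, inner_sum, inner_smul_right, orthonormal_iff_ite.1 he, hl, hS]
    | zero => exact inner_zero_left _
    | add x y _ _ hx hy => rw [inner_add_left, hx, hy, add_zero]
    | smul a x _ hx => rw [inner_smul_left, hx, mul_zero]

end Hilbert

instance (g : ℝ → ℝ) (j : ℤ) : CompleteSpace (spanSpace g j) := by
  unfold spanSpace
  infer_instance

lemma dil_add (g : ℝ → ℝ) (j i k : ℤ) (x : ℝ) :
    dil g (j + i) k x = (2 : ℝ) ^ ((j : ℝ) / 2) * dil g i k ((2 : ℝ) ^ j * x) := by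
  rw [dil, dil, ← mul_assoc, ← Real.rpow_add two_pos, ← mul_assoc, zpow_add₀ two_ne_zero,
    mul_comm ((2 : ℝ) ^ j), Int.cast_add, add_div]

lemma dil_zero_zero (g : ℝ → ℝ) : dil g 0 0 = g := by
  ext x
  simp [dil]

lemma two_rpow_half_mul_self (j : ℤ) :
    (2 : ℝ) ^ ((j : ℝ) / 2) * (2 : ℝ) ^ ((j : ℝ) / 2) = (2 : ℝ) ^ j := by
  rw [← Real.rpow_add two_pos, add_halves, Real.rpow_intCast]

lemma mul_integral_comp_two_zpow_mul (h : ℝ → ℝ) (j : ℤ) :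
    (2 : ℝ) ^ j * ∫ x, h ((2 : ℝ) ^ j * x) = ∫ x, h x := by
  rw [Measure.integral_comp_mul_left, abs_of_pos (by positivity), smul_eq_mul,
    mul_inv_cancel_left₀ (by positivity)]

lemma OrthonormalTranslates.integral_dil_mul_dil {g : ℝ → ℝ} (hg : OrthonormalTranslates g)
    (j k l : ℤ) : ∫ x, dil g j k x * dil g j l x = if k = l then 1 else 0 := by
  have dil_eq (k : ℤ) (x : ℝ) :
      dil g j k x = (2 : ℝ) ^ ((j : ℝ) / 2) * dil g 0 k ((2 : ℝ) ^ j * x) := by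
    rw [← dil_add, add_zero]
  rw [← hg.inner_eq k l, ← mul_integral_comp_two_zpow_mul (fun x => dil g 0 k x * dil g 0 l x) j,
    ← integral_const_mul]
  simp only [dil_eq, mul_mul_mul_comm, two_rpow_half_mul_self]

lemma mem_translations {A T : ℝ} {j k : ℤ} :
    k ∈ translations A T j ↔ |(k : ℝ)| ≤ (2 : ℝ) ^ (max j 0) * T + A := by
  rw [translations, Finset.mem_Icc, neg_le, Int.le_floor, Int.le_floor, abs_le, Int.cast_neg,
    neg_le]

/-- The partial wavelet expansion `∑_k ⟨f, g_{jk}⟩ g_{jk}` of `f` at level `j`; for `f` supported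
in `[-T, T]` it is the projection of `f` onto the space spanned by the `g_{jk}`. -/
noncomputable def proj (A T : ℝ) (g : ℝ → ℝ) (j : ℤ) (f : ℝ → ℝ) (x : ℝ) : ℝ :=
  ∑ k ∈ translations A T j, coeff f g j k * dil g j k x

lemma inner_toLp {u v : ℝ → ℝ} (hu : MemLp u 2 volume) (hv : MemLp v 2 volume) :
    inner ℝ (hu.toLp u) (hv.toLp v) = ∫ x, u x * v x := by
  rw [L2.inner_def]
  refine integral_congr_ae ?_
  filter_upwards [hu.coeFn_toLp, hv.coeFn_toLp] with x u_eq v_eq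
  rw [u_eq, v_eq, Real.inner_apply, mul_comm]

namespace IsLocalized

variable {A B T : ℝ} {g f : ℝ → ℝ}

lemma memLp_dil (hg : IsLocalized A B g) {p : ℝ} (hp : 1 ≤ p) (j k : ℤ) :
    MemLp (dil g j k) (ENNReal.ofReal p) volume := by
  refine ⟨hg.aestronglyMeasurable_dil j k, ?_⟩
  have synthesis := hg.eLpNorm_sum_dil_le hp j {k} fun _ => 1
  simp only [Finset.sum_singleton, one_mul] at synthesis
  exact synthesis.trans_lt ENNReal.ofReal_lt_top

lemma memLp_two_dil (hg : IsLocalized A B g) (j k : ℤ) : MemLp (dil g j k) 2 volume := by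
  simpa only [ENNReal.ofReal_ofNat] using hg.memLp_dil one_le_two j k

lemma coeff_eq_zero (hg : IsLocalized A B g) (hf : Function.support f ⊆ Icc (-T) T) {j k : ℤ}
    (hj : 0 ≤ j) (hk : k ∉ translations A T j) : coeff f g j k = 0 := by
  refine integral_eq_zero_of_ae (ae_of_all _ fun x => ?_)
  by_cases hx : x ∈ cell A j k
  · have f_eq_zero : f x = 0 := by
      by_contra hfx
      refine hk (mem_translations.2 ?_)
      have abs_x_le : |x| ≤ T := abs_le.2 (hf hfx)
      have near : |(2 : ℝ) ^ j * x - k| ≤ A := hx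
      calc |(k : ℝ)| ≤ |(2 : ℝ) ^ j * x| + |(2 : ℝ) ^ j * x - k| := by
            simpa only [sub_sub_cancel] using abs_sub ((2 : ℝ) ^ j * x) ((2 : ℝ) ^ j * x - k)
        _ ≤ (2 : ℝ) ^ max j 0 * T + A := by
            rw [max_eq_left hj, abs_mul, abs_of_pos (by positivity)]
            gcongr
    exact mul_eq_zero_of_left f_eq_zero _
  · exact mul_eq_zero_of_right _ (hg.dil_eq_zero hx)

lemma memLp_two_proj (hg : IsLocalized A B g) (j : ℤ) : MemLp (proj A T g j f) 2 volume :=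
  memLp_finsetSum _ fun k _ => (hg.memLp_two_dil j k).const_mul _

lemma spanSpace_eq (hg : IsLocalized A B g) (j : ℤ) :
    spanSpace g j = (Submodule.span ℝ
      (range fun k => (hg.memLp_two_dil j k).toLp (dil g j k))).topologicalClosure := by
  unfold spanSpace
  congr 2
  ext u
  refine exists_congr fun k => ⟨fun hu => ?_, fun hu => ?_⟩
  · exact Lp.ext ((hg.memLp_two_dil j k).coeFn_toLp.trans hu.symm)
  · exact hu ▸ (hg.memLp_two_dil j k).coeFn_toLp

lemma toLp_proj (hg : IsLocalized A B g) (ho : OrthonormalTranslates g) (hf : MemLp f 2 volume)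
    (hT : Function.support f ⊆ Icc (-T) T) {j : ℤ} (hj : 0 ≤ j) :
    (hg.memLp_two_proj j).toLp (proj A T g j f) = (spanSpace g j).starProjection (hf.toLp f) := by
  set e : ℤ → Lp ℝ 2 (volume : Measure ℝ) := fun k => (hg.memLp_two_dil j k).toLp (dil g j k)
  have e_orthonormal : Orthonormal ℝ e := orthonormal_iff_ite.2 fun k l => by
    rw [inner_toLp, ho.integral_dil_mul_dil]
  have inner_e (k : ℤ) : inner ℝ (e k) (hf.toLp f) = coeff f g j k := by
    simp only [e, inner_toLp, coeff, mul_comm]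
  have toLp_eq_sum : (hg.memLp_two_proj j).toLp (proj A T g j f) =
      ∑ k ∈ translations A T j, coeff f g j k • e k := by
    refine Lp.ext ((hg.memLp_two_proj j).coeFn_toLp.trans
      (Filter.EventuallyEq.trans ?_ (Lp.coeFn_finsetSum _ _).symm))
    have coeFn_term : ∀ᵐ x, ∀ k, (coeff f g j k • e k : Lp ℝ 2 (volume : Measure ℝ)) x =
        coeff f g j k * dil g j k x := ae_all_iff.2 fun k => by
      filter_upwards [Lp.coeFn_smul (coeff f g j k) (e k), (hg.memLp_two_dil j k).coeFn_toLp]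
        with x smul_eq e_eq
      rw [smul_eq, Pi.smul_apply, e_eq, smul_eq_mul]
    filter_upwards [coeFn_term] with x hx
    simp only [Finset.sum_apply, hx, proj]
  rw [toLp_eq_sum, starProjection_eq_sum e_orthonormal (hg.spanSpace_eq j) (translations A T j)
    fun k hk => by rw [inner_e, hg.coeff_eq_zero hT hj hk]]
  simp only [inner_e]

end IsLocalized

section Density

variable {X : Type*} [MeasurableSpace X] {μ : Measure X} {S : Set X} {f : X → ℝ}

lemma exists_memLp_two_eLpNorm_one_sub_le (hS : MeasurableSet S) (hμS : μ S ≠ ∞)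
    (hf : Integrable f μ) (hfS : Function.support f ⊆ S) {ε : ℝ≥0∞} (hε : ε ≠ 0) :
    ∃ g : X → ℝ, MemLp g 2 μ ∧ Integrable g μ ∧ Function.support g ⊆ S ∧
      eLpNorm (f - g) 1 μ ≤ ε := by
  have : IsFiniteMeasure (μ.restrict S) := isFiniteMeasure_restrict.2 hμS
  obtain ⟨g, g_close, -⟩ := (memLp_one_iff_integrable.2
    hf.integrableOn).exists_simpleFunc_eLpNorm_sub_lt ENNReal.one_ne_top hε
  have memLp_indicator (p : ℝ≥0∞) : MemLp (S.indicator g) p μ :=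
    (memLp_indicator_iff_restrict hS).2 (g.memLp_of_isFiniteMeasure p _)
  refine ⟨S.indicator g, memLp_indicator 2, memLp_one_iff_integrable.1 (memLp_indicator 1),
    support_indicator_subset, ?_⟩
  rw [← indicator_eq_self.2 hfS, ← indicator_sub', eLpNorm_indicator_eq_eLpNorm_restrict hS]
  exact g_close.le

lemma tendsto_eLpNorm_one_of_memLp_two (hS : MeasurableSet S) (hμS : μ S ≠ ∞) {ι : Type*}
    {l : Filter ι} {D : ι → (X → ℝ) → X → ℝ} {K : ℝ≥0∞} (hK : K ≠ ∞)
    (hmeas : ∀ i u, Integrable u μ → AEStronglyMeasurable (D i u) μ)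
    (hsub : ∀ i u v, Integrable u μ → Integrable v μ → D i (u - v) = D i u - D i v)
    (hbound : ∀ i u, Integrable u μ → eLpNorm (D i u) 1 μ ≤ K * eLpNorm u 1 μ)
    (hlim : ∀ u, MemLp u 2 μ → Function.support u ⊆ S →
      Filter.Tendsto (fun i => eLpNorm (D i u) 1 μ) l (nhds 0))
    (hf : Integrable f μ) (hfS : Function.support f ⊆ S) :
    Filter.Tendsto (fun i => eLpNorm (D i f) 1 μ) l (nhds 0) := by
  rw [ENNReal.tendsto_nhds_zero]
  intro ε hε
  have half_pos : 0 < ε / 2 := ENNReal.half_pos hε.ne'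
  obtain ⟨g, g_memLp, g_integrable, g_support, g_close⟩ := exists_memLp_two_eLpNorm_one_sub_le
    hS hμS hf hfS (ENNReal.div_ne_zero.2 ⟨half_pos.ne', hK⟩)
  filter_upwards [ENNReal.tendsto_nhds_zero.1 (hlim g g_memLp g_support) _ half_pos] with i hi
  have D_f : D i f = D i (f - g) + D i g := by rw [hsub i f g hf g_integrable, sub_add_cancel]
  calc eLpNorm (D i f) 1 μ ≤ eLpNorm (D i (f - g)) 1 μ + eLpNorm (D i g) 1 μ := by
        rw [D_f]
        exact eLpNorm_add_le (hmeas i _ (hf.sub g_integrable)) (hmeas i g g_integrable) le_rfl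
    _ ≤ K * (ε / 2 / K) + ε / 2 := by
        gcongr
        exact (hbound i _ (hf.sub g_integrable)).trans (by gcongr)
    _ ≤ ε / 2 + ε / 2 := by
        gcongr
        exact ENNReal.mul_div_le
    _ = ε := ENNReal.add_halves ε

end Density

lemma coeff_dil (f g : ℝ → ℝ) (j i k : ℤ) :
    coeff (dil f (-j) 0) g i k = coeff f g (j + i) k := by
  have two_zpow_mul (x : ℝ) : (2 : ℝ) ^ (-j) * ((2 : ℝ) ^ j * x) = x := by
    rw [← mul_assoc, ← zpow_add₀ two_ne_zero, neg_add_cancel, zpow_zero, one_mul]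
  have scale : (2 : ℝ) ^ j * (2 : ℝ) ^ (((-j : ℤ) : ℝ) / 2) = (2 : ℝ) ^ ((j : ℝ) / 2) := by
    rw [← Real.rpow_intCast, ← Real.rpow_add two_pos]
    congr 1
    push_cast
    ring
  rw [coeff, coeff, ← mul_integral_comp_two_zpow_mul _ j, ← integral_const_mul]
  refine integral_congr_ae (ae_of_all _ fun x => ?_)
  simp only [dil_add]
  rw [dil, two_zpow_mul, Int.cast_zero, sub_zero, ← scale]
  ring

lemma translations_add (A T : ℝ) {j i : ℤ} (hj : 0 ≤ j) (hi : 0 ≤ i) :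
    translations A ((2 : ℝ) ^ j * T) i = translations A T (j + i) := by
  ext k
  rw [mem_translations, mem_translations, max_eq_left hi, max_eq_left (by lia),
    zpow_add₀ two_ne_zero, mul_left_comm, mul_assoc]

lemma proj_add (A T : ℝ) (g f : ℝ → ℝ) {j i : ℤ} (hj : 0 ≤ j) (hi : 0 ≤ i) (x : ℝ) :
    proj A T g (j + i) f x = (2 : ℝ) ^ ((j : ℝ) / 2) *
      proj A ((2 : ℝ) ^ j * T) g i (dil f (-j) 0) ((2 : ℝ) ^ j * x) := by
  simp only [proj, translations_add A T hj hi, coeff_dil, dil_add, Finset.mul_sum, mul_left_comm]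

lemma support_dil_neg_subset {f : ℝ → ℝ} {T : ℝ} (hT : Function.support f ⊆ Icc (-T) T) (j : ℤ) :
    Function.support (dil f (-j) 0) ⊆ Icc (-((2 : ℝ) ^ j * T)) ((2 : ℝ) ^ j * T) := by
  intro x hx
  have abs_le_T : |(2 : ℝ) ^ (-j) * x - (0 : ℤ)| ≤ T :=
    abs_le.2 (hT (Function.mem_support.2 (right_ne_zero_of_mul hx)))
  rw [Int.cast_zero, sub_zero, zpow_neg, abs_mul, abs_of_pos (by positivity),
    inv_mul_le_iff₀ (by positivity)] at abs_le_T
  exact abs_le.1 abs_le_T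

lemma memLp_two_dil_neg {f : ℝ → ℝ} (hf : MemLp f 2 volume) (j : ℤ) :
    MemLp (dil f (-j) 0) 2 volume := by
  have dil_aesm : AEStronglyMeasurable (fun x => f ((2 : ℝ) ^ (-j) * x - (0 : ℤ))) volume :=
    hf.1.comp_quasiMeasurePreserving (quasiMeasurePreserving_mul_sub (by positivity) _)
  refine MemLp.const_mul ((memLp_two_iff_integrable_sq dil_aesm).2 ?_) _
  simp only [Int.cast_zero, sub_zero]
  exact hf.integrable_sq.comp_mul_left' (by positivity)

namespace IsLocalized

variable {A B T : ℝ} {g f : ℝ → ℝ}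

lemma integrable_mul_dil (hg : IsLocalized A B g) (hf : Integrable f volume) (j k : ℤ) :
    Integrable (fun x => f x * dil g j k x) volume := by
  have := hg.bound_nonneg
  refine hf.mul_bdd (c := B * (2 : ℝ) ^ ((j : ℝ) / 2)) (hg.aestronglyMeasurable_dil j k) ?_
  filter_upwards [hg.ae_abs_dil_le] with x hx
  exact (hx j k).trans (indicator_le_self' (fun _ _ => by positivity) x)

lemma proj_sub (hg : IsLocalized A B g) {u v : ℝ → ℝ} (hu : Integrable u volume)
    (hv : Integrable v volume) (j : ℤ) :
    proj A T g j (u - v) = proj A T g j u - proj A T g j v := by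
  ext x
  simp only [proj, Pi.sub_apply, ← Finset.sum_sub_distrib, ← sub_mul, coeff,
    ← integral_sub (hg.integrable_mul_dil hu j _) (hg.integrable_mul_dil hv j _)]

lemma sum_abs_coeff_le (hg : IsLocalized A B g) (hf : Integrable f volume) (j : ℤ)
    (S : Finset ℤ) :
    ∑ k ∈ S, |coeff f g j k| ≤ B * (2 : ℝ) ^ ((j : ℝ) / 2) * (2 * A + 1) * ∫ x, |f x| := by
  classical
  have := hg.bound_nonneg
  have integrable_abs (k : ℤ) := (hg.integrable_mul_dil hf j k).abs
  calc ∑ k ∈ S, |coeff f g j k| ≤ ∑ k ∈ S, ∫ x, |f x * dil g j k x| := by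
        gcongr
        exact abs_integral_le_integral_abs
    _ = ∫ x, ∑ k ∈ S, |f x * dil g j k x| :=
        (integral_finsetSum _ fun k _ => integrable_abs k).symm
    _ ≤ ∫ x, B * (2 : ℝ) ^ ((j : ℝ) / 2) * (2 * A + 1) * |f x| := by
        refine integral_mono_ae (integrable_finsetSum _ fun k _ => integrable_abs k)
          (hf.abs.const_mul _) ?_
        filter_upwards [hg.ae_abs_dil_le] with x hx
        calc ∑ k ∈ S, |f x * dil g j k x|
            ≤ ∑ k ∈ S, |f x| * (cell A j k).indicator (fun _ => B * (2 : ℝ) ^ ((j : ℝ) / 2)) x := by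
              simp only [abs_mul]
              gcongr with k
              exact hx j k
          _ = |f x| * (B * (2 : ℝ) ^ ((j : ℝ) / 2)) *
                ∑ k ∈ S, (cell A j k).indicator (fun _ => (1 : ℝ)) x := by
              simp only [Finset.mul_sum, indicator_apply, mul_ite, mul_one, mul_zero]
          _ ≤ |f x| * (B * (2 : ℝ) ^ ((j : ℝ) / 2)) * (2 * A + 1) := by
              gcongr
              exact sum_indicator_cell_le hg.radius_nonneg j x S
          _ = _ := by ring
    _ = _ := integral_const_mul _ _

lemma eLpNorm_one_proj_le (hg : IsLocalized A B g) (hf : Integrable f volume) (j : ℤ) :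
    eLpNorm (proj A T g j f) 1 volume ≤
      ENNReal.ofReal (synthConst A B 1 * (B * (2 * A + 1))) * eLpNorm f 1 volume := by
  have hA := hg.radius_nonneg
  have hB := hg.bound_nonneg
  have := synthConst_nonneg hA hB 1
  have synthesis := hg.eLpNorm_sum_dil_le le_rfl j (translations A T j) (coeff f g j)
  simp only [ENNReal.ofReal_one, Real.rpow_one, one_div_one] at synthesis
  have eLpNorm_f : eLpNorm f 1 volume = ENNReal.ofReal (∫ x, |f x|) := by
    rw [eLpNorm_one_eq_lintegral_enorm, ← ofReal_integral_norm_eq_lintegral_enorm hf]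
    rfl
  have scale : (2 : ℝ) ^ ((j : ℝ) * (1 / 2 - 1)) * (2 : ℝ) ^ ((j : ℝ) / 2) = 1 := by
    rw [← Real.rpow_add two_pos, mul_sub, mul_one, mul_one_div, sub_add_eq_add_sub, add_halves,
      sub_self, Real.rpow_zero]
  rw [eLpNorm_f, ← ENNReal.ofReal_mul (by positivity)]
  refine synthesis.trans (ENNReal.ofReal_le_ofReal ?_)
  calc _ ≤ synthConst A B 1 * (2 : ℝ) ^ ((j : ℝ) * (1 / 2 - 1)) *
        (B * (2 : ℝ) ^ ((j : ℝ) / 2) * (2 * A + 1) * ∫ x, |f x|) := by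
        gcongr
        exact hg.sum_abs_coeff_le hf j _
    _ = synthConst A B 1 * (B * (2 * A + 1)) * (∫ x, |f x|) *
        ((2 : ℝ) ^ ((j : ℝ) * (1 / 2 - 1)) * (2 : ℝ) ^ ((j : ℝ) / 2)) := by ring
    _ = _ := by rw [scale, mul_one]

lemma support_proj_subset (hg : IsLocalized A B g) {j : ℤ} (hj : 0 ≤ j) :
    Function.support (proj A T g j f) ⊆ Icc (-(T + 2 * A)) (T + 2 * A) := by
  intro x hx
  have hA := hg.radius_nonneg
  obtain ⟨k, hk, term_ne_zero⟩ := Finset.exists_ne_zero_of_sum_ne_zero hx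
  have near : |(2 : ℝ) ^ j * x - k| ≤ A := by
    by_contra not_mem
    exact term_ne_zero (by rw [hg.dil_eq_zero not_mem, mul_zero])
  rw [mem_translations, max_eq_left hj] at hk
  have one_le : (1 : ℝ) ≤ 2 ^ j := one_le_zpow₀ one_le_two hj
  have scaled : (2 : ℝ) ^ j * |x| ≤ (2 : ℝ) ^ j * (T + 2 * A) := by
    have triangle := abs_add_le ((2 : ℝ) ^ j * x - k) k
    rw [sub_add_cancel, abs_mul, abs_of_pos (by positivity)] at triangle
    nlinarith
  exact abs_le.1 (le_of_mul_le_mul_left scaled (by positivity))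

end IsLocalized

lemma eLpNorm_one_le_of_support {u : ℝ → ℝ} {R : ℝ} (hu : AEStronglyMeasurable u volume)
    (hR : Function.support u ⊆ Icc (-R) R) :
    eLpNorm u 1 volume ≤ eLpNorm u 2 volume * ENNReal.ofReal (2 * R) ^ (1 / 2 : ℝ) := by
  rw [← eLpNorm_restrict_eq_of_support_subset (p := 1) hR,
    ← eLpNorm_restrict_eq_of_support_subset (p := 2) hR]
  refine (eLpNorm_le_eLpNorm_mul_rpow_measure_univ one_le_two hu.restrict).trans_eq ?_
  rw [Measure.restrict_apply_univ, Real.volume_Icc, sub_neg_eq_add, ← two_mul]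
  norm_num

/-- `φ` and `ψ` are a father wavelet and an associated mother wavelet, both of them supported in
`[-A, A]` and bounded by `B`. -/
structure IsWaveletPair (A B : ℝ) (φ ψ : ℝ → ℝ) : Prop where
  father : IsLocalized A B φ
  mother : IsLocalized A B ψ
  mra : GeneratesMRA φ
  isMother : IsMotherWavelet φ ψ

namespace IsWaveletPair

variable {A B T : ℝ} {φ ψ f : ℝ → ℝ}

lemma proj_one_ae_eq (h : IsWaveletPair A B φ ψ) (hf : MemLp f 2 volume)
    (hT : Function.support f ⊆ Icc (-T) T) :
    proj A T φ 1 f =ᵐ[volume] proj A T φ 0 f + proj A T ψ 0 f := by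
  rw [← MemLp.toLp_eq_toLp_iff (h.father.memLp_two_proj 1)
      ((h.father.memLp_two_proj 0).add (h.mother.memLp_two_proj 0)),
    MemLp.toLp_add (h.father.memLp_two_proj 0) (h.mother.memLp_two_proj 0),
    h.father.toLp_proj h.mra.orthonormal hf hT zero_le_one,
    h.father.toLp_proj h.mra.orthonormal hf hT le_rfl,
    h.mother.toLp_proj h.isMother.orthonormal hf hT le_rfl]
  exact starProjection_eq_add_of_eq_inf_orthogonal (h.mra.nested 0) h.isMother.span_eq _

lemma proj_succ_ae_eq_of_memLp_two (h : IsWaveletPair A B φ ψ) (hf : MemLp f 2 volume)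
    (hT : Function.support f ⊆ Icc (-T) T) {j : ℤ} (hj : 0 ≤ j) :
    proj A T φ (j + 1) f =ᵐ[volume] proj A T φ j f + proj A T ψ j f := by
  have at_scale_zero := h.proj_one_ae_eq (memLp_two_dil_neg hf j) (support_dil_neg_subset hT j)
  have rescale (g : ℝ → ℝ) (x : ℝ) := proj_add A T g f hj le_rfl x
  simp only [add_zero] at rescale
  filter_upwards [(Measure.quasiMeasurePreserving_smul volume
    (show (2 : ℝ) ^ j ≠ 0 by positivity)).ae at_scale_zero] with x hx
  rw [smul_eq_mul, Pi.add_apply] at hx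
  rw [proj_add A T φ f hj zero_le_one, hx, Pi.add_apply, rescale, rescale, mul_add]

lemma proj_succ_ae_eq (h : IsWaveletPair A B φ ψ) (hf : Integrable f volume)
    (hT : Function.support f ⊆ Icc (-T) T) {j : ℤ} (hj : 0 ≤ j) :
    proj A T φ (j + 1) f =ᵐ[volume] proj A T φ j f + proj A T ψ j f := by
  set K := ENNReal.ofReal (synthConst A B 1 * (B * (2 * A + 1)))
  have measurable_φ (i : ℤ) (u : ℝ → ℝ) := (h.father.memLp_two_proj (T := T) (f := u) i).1
  have measurable_ψ (i : ℤ) (u : ℝ → ℝ) := (h.mother.memLp_two_proj (T := T) (f := u) i).1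
  let D (u : ℝ → ℝ) : ℝ → ℝ := proj A T φ (j + 1) u - (proj A T φ j u + proj A T ψ j u)
  have measurable_D (u : ℝ → ℝ) : AEStronglyMeasurable (D u) volume :=
    (measurable_φ _ u).sub ((measurable_φ _ u).add (measurable_ψ _ u))
  have D_limit : Filter.Tendsto (fun _ : ℕ => eLpNorm (D f) 1 volume) Filter.atTop (nhds 0) := by
    refine tendsto_eLpNorm_one_of_memLp_two (D := fun _ => D) (K := K + (K + K))
      measurableSet_Icc measure_Icc_lt_top.ne (by finiteness) (fun _ u _ => measurable_D u)
      (fun _ u v hu hv => ?_) (fun _ u hu => ?_) (fun u hu huT => ?_) hf hT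
    · simp only [D, h.father.proj_sub hu hv, h.mother.proj_sub hu hv]
      abel
    · rw [add_mul, add_mul]
      refine (eLpNorm_sub_le (measurable_φ _ u) ((measurable_φ _ u).add (measurable_ψ _ u))
        le_rfl).trans (add_le_add (h.father.eLpNorm_one_proj_le hu _) ?_)
      exact (eLpNorm_add_le (measurable_φ _ u) (measurable_ψ _ u) le_rfl).trans
        (add_le_add (h.father.eLpNorm_one_proj_le hu _) (h.mother.eLpNorm_one_proj_le hu _))
    · have D_u : D u =ᵐ[volume] 0 := by
        filter_upwards [h.proj_succ_ae_eq_of_memLp_two hu huT hj] with x hx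
        exact sub_eq_zero.2 hx
      simp only [eLpNorm_congr_ae D_u, eLpNorm_zero, tendsto_const_nhds]
  have D_f :=
    (eLpNorm_eq_zero_iff (measurable_D f) one_ne_zero).1 (tendsto_const_nhds_iff.1 D_limit)
  filter_upwards [D_f] with x hx
  exact sub_eq_zero.1 hx

lemma proj_add_ae_eq_sum (h : IsWaveletPair A B φ ψ) (hf : Integrable f volume)
    (hT : Function.support f ⊆ Icc (-T) T) (j m : ℕ) :
    proj A T φ (j + m : ℕ) f =ᵐ[volume]
      proj A T φ j f + ∑ i ∈ Finset.range m, proj A T ψ (j + i : ℕ) f := by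
  induction m with
  | zero => simp
  | succ m ih =>
    have proj_succ := h.proj_succ_ae_eq hf hT (j := (j + m : ℕ)) (by positivity)
    rw [Finset.sum_range_succ, ← add_assoc (proj A T φ j f)]
    exact_mod_cast proj_succ.trans (ih.add .rfl)

end IsWaveletPair

namespace IsLocalized

variable {A B T : ℝ} {φ f : ℝ → ℝ}

lemma tendsto_eLpNorm_two_proj (hφ : IsLocalized A B φ) (hm : GeneratesMRA φ)
    (hf : MemLp f 2 volume) (hT : Function.support f ⊆ Icc (-T) T) :
    Filter.Tendsto (fun j : ℕ => eLpNorm (proj A T φ j f - f) 2 volume) Filter.atTop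
      (nhds 0) := by
  have spanSpace_mono : Monotone (spanSpace φ) := monotone_int_of_le_succ hm.nested
  have iSup_dense : ⊤ ≤ (⨆ j, spanSpace φ j).topologicalClosure := by
    refine (Submodule.dense_iff_topologicalClosure_eq_top.1 (hm.dense.mono ?_)).ge
    exact iUnion_subset fun j => le_iSup (spanSpace φ) j
  rw [← Lp.tendsto_Lp_iff_tendsto_eLpNorm'' (fun j : ℕ => proj A T φ j f)
    (fun j => hφ.memLp_two_proj j) f hf]
  simp only [hφ.toLp_proj hm.orthonormal hf hT (Int.natCast_nonneg _)]
  exact (Submodule.starProjection_tendsto_self _ spanSpace_mono _ iSup_dense).comp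
    tendsto_natCast_atTop_atTop

lemma tendsto_eLpNorm_one_proj (hφ : IsLocalized A B φ) (hm : GeneratesMRA φ)
    (hf : Integrable f volume) (hT : Function.support f ⊆ Icc (-T) T) :
    Filter.Tendsto (fun j : ℕ => eLpNorm (proj A T φ j f - f) 1 volume) Filter.atTop
      (nhds 0) := by
  have measurable_proj (j : ℤ) (u : ℝ → ℝ) := (hφ.memLp_two_proj (T := T) (f := u) j).1
  set K := ENNReal.ofReal (synthConst A B 1 * (B * (2 * A + 1)))
  refine tendsto_eLpNorm_one_of_memLp_two (D := fun (j : ℕ) u => proj A T φ j u - u) (K := K + 1)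
    measurableSet_Icc measure_Icc_lt_top.ne (by finiteness)
    (fun j u hu => (measurable_proj j u).sub hu.1) (fun j u v hu hv => ?_) (fun j u hu => ?_)
    (fun u hu huT => ?_) hf hT
  · rw [hφ.proj_sub hu hv, sub_sub_sub_comm]
  · rw [add_mul, one_mul]
    exact (eLpNorm_sub_le (measurable_proj j u) hu.1 le_rfl).trans
      (add_le_add_left (hφ.eLpNorm_one_proj_le hu j) _)
  · have hA := hφ.radius_nonneg
    have L2_limit := ENNReal.Tendsto.mul_const
      (b := ENNReal.ofReal (2 * (T + 2 * A)) ^ (1 / 2 : ℝ))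
      (hφ.tendsto_eLpNorm_two_proj hm hu huT) (Or.inr (by finiteness))
    rw [zero_mul] at L2_limit
    refine tendsto_of_tendsto_of_tendsto_of_le_of_le tendsto_const_nhds L2_limit
      (fun _ => zero_le) fun j => eLpNorm_one_le_of_support ((measurable_proj j u).sub hu.1) ?_
    exact (Function.support_sub _ _).trans (union_subset
      (hφ.support_proj_subset (Int.natCast_nonneg j))
      (huT.trans (Icc_subset_Icc (by linarith) (by linarith))))

end IsLocalized

lemma ofReal_sum_rpow_le_eLpNorm_count {ι : Type*} [MeasurableSpace ι]
    [MeasurableSingletonClass ι] {p : ℝ} (hp : 0 < p) (a : ι → ℝ) (S : Finset ι) :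
    ENNReal.ofReal ((∑ k ∈ S, |a k| ^ p) ^ (1 / p)) ≤
      eLpNorm a (ENNReal.ofReal p) Measure.count := by
  rw [eLpNorm_eq_lintegral_rpow_enorm_toReal (ENNReal.ofReal_pos.2 hp).ne' ENNReal.ofReal_ne_top,
    ENNReal.toReal_ofReal hp.le, lintegral_count,
    ← ENNReal.ofReal_rpow_of_nonneg (Finset.sum_nonneg fun k _ => by positivity) (by positivity),
    ENNReal.ofReal_sum_of_nonneg fun k _ => by positivity]
  gcongr
  refine le_trans (Finset.sum_le_sum fun k _ => ?_) (ENNReal.sum_le_tsum S)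
  rw [Real.enorm_eq_ofReal_abs, ENNReal.ofReal_rpow_of_nonneg (abs_nonneg _) hp.le]

lemma two_rpow_neg_lt_one {s : ℝ} (hs : 0 < s) : (2 : ℝ) ^ (-s) < 1 :=
  Real.rpow_lt_one_of_one_lt_of_neg one_lt_two (neg_neg_of_pos hs)

lemma sum_two_rpow_neg_le {s : ℝ} (hs : 0 < s) (j m : ℕ) :
    ∑ i ∈ Finset.range m, (2 : ℝ) ^ (-(((j + i : ℕ) : ℝ) * s)) ≤
      (2 : ℝ) ^ (-((j : ℝ) * s)) * (1 - (2 : ℝ) ^ (-s))⁻¹ := by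
  have split_exponent (i : ℕ) : (2 : ℝ) ^ (-(((j + i : ℕ) : ℝ) * s)) =
      (2 : ℝ) ^ (-((j : ℝ) * s)) * ((2 : ℝ) ^ (-s)) ^ i := by
    rw [← Real.rpow_natCast, ← Real.rpow_mul two_pos.le, ← Real.rpow_add two_pos]
    congr 1
    push_cast
    ring
  simp only [split_exponent, ← Finset.mul_sum]
  gcongr
  rw [← tsum_geometric_of_lt_one (by positivity) (two_rpow_neg_lt_one hs)]
  exact (summable_geometric_of_lt_one (by positivity) (two_rpow_neg_lt_one hs)).sum_le_tsum _
    fun i _ => by positivity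

section CoefficientBounds

variable {A B T L s p : ℝ} {q : ℝ≥0∞} {φ ψ f : ℝ → ℝ}

lemma father_coeff_le_of_besovJ_le (hp : 0 < p) (hL : 0 ≤ L)
    (hf : besovJ φ ψ s p q f ≤ ENNReal.ofReal L) (S : Finset ℤ) :
    (∑ k ∈ S, |coeff f φ 0 k| ^ p) ^ (1 / p) ≤ L := by
  rw [← ENNReal.ofReal_le_ofReal_iff hL]
  exact (ofReal_sum_rpow_le_eLpNorm_count hp _ S).trans (le_self_add.trans hf)

lemma mother_coeff_le_of_besovJ_le (hp : 0 < p) (hq : q ≠ 0) (hL : 0 ≤ L)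
    (hf : besovJ φ ψ s p q f ≤ ENNReal.ofReal L) (j : ℕ) (S : Finset ℤ) :
    (2 : ℝ) ^ ((j : ℝ) * (s + 1 / 2 - 1 / p)) * (∑ k ∈ S, |coeff f ψ j k| ^ p) ^ (1 / p) ≤ L := by
  let level (j : ℕ) := ENNReal.ofReal ((2 : ℝ) ^ ((j : ℝ) * (s + 1 / 2 - 1 / p))) *
    eLpNorm (fun k : ℤ => coeff f ψ j k) (ENNReal.ofReal p) Measure.count
  rw [← ENNReal.ofReal_le_ofReal_iff hL, ENNReal.ofReal_mul (by positivity)]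
  calc _ ≤ level j := by
        simp only [level]
        gcongr
        exact ofReal_sum_rpow_le_eLpNorm_count hp _ S
    _ ≤ eLpNorm level q Measure.count := enorm_le_eLpNorm_count level j hq
    _ ≤ besovJ φ ψ s p q f := le_add_self
    _ ≤ ENNReal.ofReal L := hf

lemma IsLocalized.eLpNorm_proj_father_le (hφ : IsLocalized A B φ) (hp : 1 ≤ p) (hL : 0 ≤ L)
    (hf : besovJ φ ψ s p q f ≤ ENNReal.ofReal L) :
    eLpNorm (proj A T φ 0 f) (ENNReal.ofReal p) volume ≤
      ENNReal.ofReal (synthConst A B p * L) := by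
  refine (hφ.eLpNorm_sum_dil_le hp 0 _ _).trans (ENNReal.ofReal_le_ofReal ?_)
  have := synthConst_nonneg hφ.radius_nonneg hφ.bound_nonneg p
  have coeff_le := father_coeff_le_of_besovJ_le (by linarith) hL hf (translations A T 0)
  simp only [Int.cast_zero, zero_mul, Real.rpow_zero, mul_one]
  gcongr

lemma IsLocalized.eLpNorm_proj_mother_le (hψ : IsLocalized A B ψ) (hp : 1 ≤ p) (hq : q ≠ 0)
    (hL : 0 ≤ L) (hf : besovJ φ ψ s p q f ≤ ENNReal.ofReal L) (j : ℕ) :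
    eLpNorm (proj A T ψ j f) (ENNReal.ofReal p) volume ≤
      ENNReal.ofReal (synthConst A B p * L * (2 : ℝ) ^ (-(j * s))) := by
  refine (hψ.eLpNorm_sum_dil_le hp j _ _).trans (ENNReal.ofReal_le_ofReal ?_)
  have := synthConst_nonneg hψ.radius_nonneg hψ.bound_nonneg p
  have coeff_le := mother_coeff_le_of_besovJ_le (by linarith) hq hL hf j (translations A T j)
  have split_exponent : (2 : ℝ) ^ (((j : ℤ) : ℝ) * (1 / 2 - 1 / p)) =
      (2 : ℝ) ^ (-(j * s)) * (2 : ℝ) ^ ((j : ℝ) * (s + 1 / 2 - 1 / p)) := by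
    rw [← Real.rpow_add two_pos, Int.cast_natCast]
    congr 1
    ring
  rw [split_exponent, mul_assoc, mul_assoc, mul_assoc, mul_comm L]
  gcongr

/-- The constant in the bound of the approximation error of the wavelet projections over a Besov
ball of radius `L`. -/
noncomputable def biasConst (A B s p L : ℝ) : ℝ :=
  synthConst A B p * L * (1 - (2 : ℝ) ^ (-s))⁻¹

lemma biasConst_nonneg (hA : 0 ≤ A) (hB : 0 ≤ B) (hs : 0 < s) (hL : 0 ≤ L) :
    0 ≤ biasConst A B s p L :=
  mul_nonneg (mul_nonneg (synthConst_nonneg hA hB p) hL)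
    (inv_nonneg.2 (sub_nonneg.2 (two_rpow_neg_lt_one hs).le))

lemma IsLocalized.eLpNorm_sum_proj_mother_le (hψ : IsLocalized A B ψ) (hs : 0 < s) (hp : 1 ≤ p)
    (hq : q ≠ 0) (hL : 0 ≤ L) (hf : besovJ φ ψ s p q f ≤ ENNReal.ofReal L) (j m : ℕ) :
    eLpNorm (∑ i ∈ Finset.range m, proj A T ψ (j + i : ℕ) f) (ENNReal.ofReal p) volume ≤
      ENNReal.ofReal (biasConst A B s p L * (2 : ℝ) ^ (-(j * s))) := by
  have := synthConst_nonneg hψ.radius_nonneg hψ.bound_nonneg p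
  refine (eLpNorm_sum_le (fun i _ => (hψ.memLp_two_proj _).1)
    (ENNReal.one_le_ofReal.2 hp)).trans ?_
  refine (Finset.sum_le_sum fun i _ => hψ.eLpNorm_proj_mother_le hp hq hL hf (j + i)).trans ?_
  rw [← ENNReal.ofReal_sum_of_nonneg fun i _ => by positivity, ← Finset.mul_sum, biasConst,
    mul_assoc _ (_ - _)⁻¹, mul_comm (_ - _)⁻¹]
  gcongr
  exact sum_two_rpow_neg_le hs j m

namespace IsWaveletPair

/-- The finite sums of detail projections converge to `f - proj f` in `L¹`, hence in measure, so the
`L^p` bound survives in the limit although `f` is not known to be in `L^p`. -/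
lemma eLpNorm_proj_sub_le (h : IsWaveletPair A B φ ψ) (hs : 0 < s) (hp : 1 ≤ p) (hq : q ≠ 0)
    (hL : 0 ≤ L) (hf : MemDensityClass φ ψ s p q L T f) (j : ℕ) :
    eLpNorm (proj A T φ j f - f) (ENNReal.ofReal p) volume ≤
      ENNReal.ofReal (biasConst A B s p L * (2 : ℝ) ^ (-(j * s))) := by
  have measurable_proj (i : ℤ) := (h.father.memLp_two_proj (T := T) (f := f) i).1
  have converges : TendstoInMeasure volume
      (fun m : ℕ => proj A T φ j f - proj A T φ (j + m : ℕ) f) Filter.atTop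
      (proj A T φ j f - f) := by
    refine tendstoInMeasure_of_tendsto_eLpNorm one_ne_zero
      (fun m => (measurable_proj _).sub (measurable_proj _))
      ((measurable_proj _).sub hf.integrable.1) ?_
    simp only [sub_sub_sub_cancel_left, eLpNorm_sub_comm f]
    exact (h.father.tendsto_eLpNorm_one_proj h.mra hf.integrable hf.support_subset).comp
      (Filter.tendsto_atTop_mono (Nat.le_add_left · j) Filter.tendsto_id)
  refine eLpNorm_le_of_tendstoInMeasure (.of_forall fun m => ?_) converges
    fun m => (measurable_proj _).sub (measurable_proj _)
  have details : proj A T φ (j + m : ℕ) f - proj A T φ j f =ᵐ[volume]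
      ∑ i ∈ Finset.range m, proj A T ψ (j + i : ℕ) f := by
    filter_upwards [h.proj_add_ae_eq_sum hf.integrable hf.support_subset j m] with x hx
    rw [Pi.sub_apply, hx, Pi.add_apply, add_sub_cancel_left]
  rw [eLpNorm_sub_comm, eLpNorm_congr_ae details]
  exact h.mother.eLpNorm_sum_proj_mother_le hs hp hq hL hf.besov j m

lemma eLpNorm_density_le (h : IsWaveletPair A B φ ψ) (hs : 0 < s) (hp : 1 ≤ p) (hq : q ≠ 0)
    (hL : 0 ≤ L) (hf : MemDensityClass φ ψ s p q L T f) :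
    eLpNorm f (ENNReal.ofReal p) volume ≤
      ENNReal.ofReal (synthConst A B p * L + biasConst A B s p L) := by
  have hA := h.father.radius_nonneg
  have hB := h.father.bound_nonneg
  have measurable_proj := (h.father.memLp_two_proj (T := T) (f := f) 0).1
  have bias_le := h.eLpNorm_proj_sub_le hs hp hq hL hf 0
  simp only [Nat.cast_zero, zero_mul, neg_zero, Real.rpow_zero, mul_one] at bias_le
  rw [← sub_sub_self (proj A T φ 0 f) f,
    ENNReal.ofReal_add (mul_nonneg (synthConst_nonneg hA hB p) hL) (biasConst_nonneg hA hB hs hL)]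
  exact (eLpNorm_sub_le measurable_proj (measurable_proj.sub hf.integrable.1)
    (ENNReal.one_le_ofReal.2 hp)).trans
    (add_le_add (h.father.eLpNorm_proj_father_le hp hL hf.besov) bias_le)

end IsWaveletPair

end CoefficientBounds

/-! ### The error of one empirical coefficient -/

lemma add_rpow_le_two_rpow_mul {x y r : ℝ} (hx : 0 ≤ x) (hy : 0 ≤ y) (hr : 0 ≤ r) :
    (x + y) ^ r ≤ 2 ^ r * (x ^ r + y ^ r) := by
  have hmax : max x y ^ r ≤ x ^ r + y ^ r := by
    rcases max_cases x y with ⟨h, -⟩ | ⟨h, -⟩ <;> rw [h]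
    · exact le_add_of_nonneg_right (Real.rpow_nonneg hy r)
    · exact le_add_of_nonneg_left (Real.rpow_nonneg hx r)
  calc (x + y) ^ r ≤ (2 * max x y) ^ r := by
        gcongr
        linarith [le_max_left x y, le_max_right x y]
    _ = 2 ^ r * max x y ^ r := Real.mul_rpow two_pos.le (le_max_of_le_left hx)
    _ ≤ 2 ^ r * (x ^ r + y ^ r) := by gcongr

lemma rpow_half_sq {x : ℝ} (hx : 0 ≤ x) (p : ℝ) : (x ^ (p / 2)) ^ 2 = x ^ p := by
  rw [← Real.rpow_mul_natCast hx, Nat.cast_ofNat, div_mul_cancel₀ p two_ne_zero]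

lemma sq_rpow_half {x : ℝ} (hx : 0 ≤ x) (p : ℝ) : (x ^ 2) ^ (p / 2) = x ^ p := by
  rw [← Real.rpow_natCast_mul hx, Nat.cast_ofNat, mul_div_cancel₀ p two_ne_zero]

section CoefficientError

variable {Ω : Type*} [MeasurableSpace Ω] {P : Measure Ω} {f h : ℝ → ℝ} {E : Set ℝ} {b p : ℝ}
  {X : Ω → ℝ}

lemma integral_comp_of_hasLaw_density
    (hX : HasLaw X (volume.withDensity fun x => ENNReal.ofReal (f x)) P)
    (hf : Integrable f volume) (hf0 : ∀ x, 0 ≤ f x) (hh : AEStronglyMeasurable h volume) :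
    ∫ ω, h (X ω) ∂P = ∫ x, f x * h x := by
  have hcomp := hX.integral_comp (hh.mono_ac (withDensity_absolutelyContinuous _ _))
  simp only [Function.comp_def] at hcomp
  rw [hcomp, integral_withDensity_eq_integral_toReal_smul₀ hf.1.aemeasurable.ennreal_ofReal
    (ae_of_all _ fun x => ENNReal.ofReal_lt_top)]
  simp only [ENNReal.toReal_ofReal (hf0 _), smul_eq_mul]

lemma aemeasurable_comp_of_hasLaw_density
    (hX : HasLaw X (volume.withDensity fun x => ENNReal.ofReal (f x)) P)
    (hh : AEStronglyMeasurable h volume) : AEMeasurable h (P.map X) := by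
  rw [hX.map_eq]
  exact (hh.mono_ac (withDensity_absolutelyContinuous _ _)).aemeasurable

lemma integral_abs_comp_rpow_le
    (hX : HasLaw X (volume.withDensity fun x => ENNReal.ofReal (f x)) P)
    (hf : Integrable f volume) (hf0 : ∀ x, 0 ≤ f x) (hh : AEStronglyMeasurable h volume)
    (hE : MeasurableSet E) (hbd : ∀ᵐ x, |h x| ≤ E.indicator (fun _ => b) x) (hp : 0 < p) :
    ∫ ω, |h (X ω)| ^ p ∂P ≤ b ^ p * ∫ x in E, f x := by
  have hmeas : AEStronglyMeasurable (fun x => |h x| ^ p) volume :=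
    (hh.norm.aemeasurable.pow_const p).aestronglyMeasurable
  rw [integral_comp_of_hasLaw_density (h := fun x => |h x| ^ p) hX hf hf0 hmeas,
    ← integral_indicator hE, ← integral_const_mul]
  refine integral_mono_of_nonneg (ae_of_all _ fun x => mul_nonneg (hf0 x) (by positivity))
    ((hf.indicator hE).const_mul _) ?_
  filter_upwards [hbd] with x hx
  by_cases hxE : x ∈ E
  · rw [indicator_of_mem hxE] at hx ⊢
    rw [mul_comm]
    exact mul_le_mul_of_nonneg_right (Real.rpow_le_rpow (abs_nonneg _) hx hp.le) (hf0 x)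
  · rw [indicator_of_notMem hxE] at hx ⊢
    rw [le_antisymm hx (abs_nonneg _), Real.zero_rpow hp.ne', mul_zero, mul_zero]

variable [IsProbabilityMeasure P]

lemma memLp_comp_of_hasLaw_density
    (hX : HasLaw X (volume.withDensity fun x => ENNReal.ofReal (f x)) P)
    (hh : AEStronglyMeasurable h volume) (hb : 0 ≤ b)
    (hbd : ∀ᵐ x, |h x| ≤ E.indicator (fun _ => b) x) (r : ℝ≥0∞) :
    MemLp (fun ω => h (X ω)) r P := by
  refine MemLp.of_bound ((aemeasurable_comp_of_hasLaw_density hX hh).comp_aemeasurable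
    hX.aemeasurable).aestronglyMeasurable b (ae_of_ae_map (p := fun x => |h x| ≤ b)
    hX.aemeasurable ?_)
  rw [hX.map_eq]
  refine (withDensity_absolutelyContinuous _ _).ae_le ?_
  filter_upwards [hbd] with x hx
  exact hx.trans (indicator_le_self' (fun _ _ => hb) x)

lemma integral_abs_sub_integral_rpow_le (hp : 1 ≤ p) (hX : MemLp X (ENNReal.ofReal p) P) :
    ∫ ω, |X ω - ∫ ω', X ω' ∂P| ^ p ∂P ≤ 2 ^ p * (2 * ∫ ω, |X ω| ^ p ∂P) := by
  have hp0 : 0 < p := by linarith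
  have integrable_pow : Integrable (fun ω => |X ω| ^ p) P := integrable_abs_rpow hp0.le le_rfl hX
  set m := ∫ ω', X ω' ∂P
  have hm : |m| ^ p ≤ ∫ ω, |X ω| ^ p ∂P := by
    have hjensen := integral_abs_rpow_le zero_le_one hp hp0 hX
    simp only [Real.rpow_one] at hjensen
    have hnonneg : 0 ≤ ∫ ω, |X ω| ^ p ∂P := integral_nonneg fun ω => by positivity
    calc |m| ^ p ≤ ((∫ ω, |X ω| ^ p ∂P) ^ (1 / p)) ^ p := by
          gcongr
          exact abs_integral_le_integral_abs.trans hjensen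
      _ = _ := by rw [← Real.rpow_mul hnonneg, one_div_mul_cancel hp0.ne', Real.rpow_one]
  calc ∫ ω, |X ω - m| ^ p ∂P ≤ ∫ ω, 2 ^ p * (|X ω| ^ p + |m| ^ p) ∂P := by
        refine integral_mono_of_nonneg (ae_of_all _ fun ω => by positivity)
          ((integrable_pow.add (integrable_const _)).const_mul _) (ae_of_all _ fun ω => ?_)
        exact (Real.rpow_le_rpow (abs_nonneg _) (abs_sub _ _) hp0.le).trans
          (add_rpow_le_two_rpow_mul (abs_nonneg _) (abs_nonneg _) hp0.le)
    _ = 2 ^ p * (∫ ω, |X ω| ^ p ∂P + |m| ^ p) := by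
        rw [integral_const_mul, integral_add integrable_pow (integrable_const _), integral_const,
          probReal_univ, one_smul]
    _ ≤ 2 ^ p * (2 * ∫ ω, |X ω| ^ p ∂P) := by
        gcongr
        linarith

/-- The centred summands of the error of the empirical mean of the `h (X i) + τ * Y i`, where `β`
is the common mean of the `h (X i)` and the noise variables `Y i` are centred. -/
def errorSummand {n : ℕ} (h : ℝ → ℝ) (β τ : ℝ) (X Y : Fin n → Ω → ℝ) (t : Fin n ⊕ Fin n)
    (ω : Ω) : ℝ :=
  Sum.elim (fun i => h (X i ω) - β) (fun i => τ * Y i ω) t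

variable {n : ℕ} {β τ : ℝ} {X Y : Fin n → Ω → ℝ}

omit [MeasurableSpace Ω] in
lemma mean_sub_eq_sum_errorSummand (hn : 1 ≤ n) (ω : Ω) :
    (1 / (n : ℝ)) * ∑ i, (h (X i ω) + τ * Y i ω) - β =
      (1 / (n : ℝ)) * ∑ t, errorSummand h β τ X Y t ω := by
  have hn0 : (n : ℝ) ≠ 0 := by positivity
  simp only [errorSummand, Fintype.sum_sum_type, Sum.elim_inl, Sum.elim_inr,
    Finset.sum_add_distrib, Finset.sum_sub_distrib, Finset.sum_const, Finset.card_univ,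
    Fintype.card_fin, nsmul_eq_mul]
  field_simp
  ring

omit [IsProbabilityMeasure P] in
lemma iIndepFun_errorSummand
    (hX : ∀ i, HasLaw (X i) (volume.withDensity fun x => ENNReal.ofReal (f x)) P)
    (hY : ∀ i, AEMeasurable (Y i) P)
    (hind : iIndepFun (β := fun _ : Fin n ⊕ Fin n => ℝ) (Sum.elim X Y) P)
    (hh : AEStronglyMeasurable h volume) : iIndepFun (errorSummand h β τ X Y) P := by
  have hcomp : errorSummand h β τ X Y = fun t => (Sum.elim (fun _ x => h x - β)
      (fun _ y => τ * y) t : ℝ → ℝ) ∘ (Sum.elim X Y t : Ω → ℝ) := by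
    ext (i | i) ω <;> rfl
  rw [hcomp]
  refine hind.comp₀ _ ?_ ?_
  · rintro (i | i)
    exacts [(hX i).aemeasurable, hY i]
  · rintro (i | i)
    exacts [(aemeasurable_comp_of_hasLaw_density (hX i) hh).sub_const β,
      aemeasurable_id.const_mul τ]

lemma memLp_errorSummand (hX : ∀ i, MemLp (fun ω => h (X i ω)) (ENNReal.ofReal p) P)
    (hY : ∀ i, HasLaw (Y i) laplaceOne P) (hp : 0 < p) (t : Fin n ⊕ Fin n) :
    MemLp (errorSummand h β τ X Y t) (ENNReal.ofReal p) P := by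
  rcases t with i | i
  exacts [(hX i).sub (memLp_const β), (memLp_of_hasLaw_laplaceOne (hY i) hp).const_mul τ]

lemma integral_errorSummand (hX : ∀ i, Integrable (fun ω => h (X i ω)) P)
    (hβ : ∀ i, ∫ ω, h (X i ω) ∂P = β) (hY : ∀ i, HasLaw (Y i) laplaceOne P)
    (t : Fin n ⊕ Fin n) : ∫ ω, errorSummand h β τ X Y t ω ∂P = 0 := by
  rcases t with i | i
  · simp only [errorSummand, Sum.elim_inl]
    rw [integral_sub (hX i) (integrable_const _), hβ, integral_const, probReal_univ, one_smul,
      sub_self]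
  · simp only [errorSummand, Sum.elim_inr]
    rw [integral_const_mul, integral_of_hasLaw_laplaceOne (hY i), mul_zero]

omit [IsProbabilityMeasure P] in
lemma sum_integral_abs_errorSummand_rpow_le {v : ℝ}
    (hX : ∀ i, ∫ ω, |h (X i ω) - β| ^ p ∂P ≤ v) (hY : ∀ i, HasLaw (Y i) laplaceOne P) :
    ∑ t, ∫ ω, |errorSummand h β τ X Y t ω| ^ p ∂P ≤
      n * (v + |τ| ^ p * laplaceMoment p) := by
  have hnoise : ∀ i, ∫ ω, |τ * Y i ω| ^ p ∂P = |τ| ^ p * laplaceMoment p := fun i => by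
    simp only [abs_mul, Real.mul_rpow (abs_nonneg _) (abs_nonneg _)]
    rw [integral_const_mul, integral_abs_rpow_of_hasLaw_laplaceOne (hY i)]
  simp only [errorSummand, Fintype.sum_sum_type, Sum.elim_inl, Sum.elim_inr, hnoise]
  refine (add_le_add_left (Finset.sum_le_sum fun i _ => hX i) _).trans_eq ?_
  simp only [Finset.sum_const, Finset.card_univ, Fintype.card_fin, nsmul_eq_mul, mul_add]

/-- The bound for the moment of order `p` of the error of an empirical coefficient based on `n`
private views, in terms of the bound `b` for the basis function, the mass `a` of its support and
the noise level `τ`. -/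
noncomputable def coeffErrorBound (p : ℝ) (n : ℕ) (b a τ : ℝ) : ℝ :=
  ((1 + rosenthalConst p) * ((b ^ 2 * a + τ ^ 2 * laplaceMoment 2) / n)) ^ (p / 2) +
    highMomentWeight p * ((n : ℝ) ^ (1 - p) *
      (2 ^ p * (2 * (b ^ p * a)) + |τ| ^ p * laplaceMoment p))

lemma memLp_coeff_error
    (hX : ∀ i, HasLaw (X i) (volume.withDensity fun x => ENNReal.ofReal (f x)) P)
    (hY : ∀ i, HasLaw (Y i) laplaceOne P) (hh : AEStronglyMeasurable h volume) (hb : 0 ≤ b)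
    (hbd : ∀ᵐ x, |h x| ≤ E.indicator (fun _ => b) x) (hp : 0 < p) (c : ℝ) :
    MemLp (fun ω => (1 / (n : ℝ)) * ∑ i, (h (X i ω) + τ * Y i ω) - c) (ENNReal.ofReal p) P :=
  ((memLp_finsetSum _ fun i _ => (memLp_comp_of_hasLaw_density (hX i) hh hb hbd _).add
    ((memLp_of_hasLaw_laplaceOne (hY i) hp).const_mul τ)).const_mul _).sub (memLp_const c)

lemma integral_abs_sum_errorSummand_rpow_le (hp : 1 ≤ p)
    (hX : ∀ i, HasLaw (X i) (volume.withDensity fun x => ENNReal.ofReal (f x)) P)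
    (hY : ∀ i, HasLaw (Y i) laplaceOne P)
    (hind : iIndepFun (β := fun _ : Fin n ⊕ Fin n => ℝ) (Sum.elim X Y) P)
    (hf : Integrable f volume) (hf0 : ∀ x, 0 ≤ f x) (hh : AEStronglyMeasurable h volume)
    (hE : MeasurableSet E) (hb : 0 ≤ b) (hbd : ∀ᵐ x, |h x| ≤ E.indicator (fun _ => b) x) :
    ∫ ω, |∑ t, errorSummand h (∫ x, f x * h x) τ X Y t ω| ^ p ∂P ≤
      ((1 + rosenthalConst p) *
        (n * (b ^ 2 * (∫ x in E, f x) + τ ^ 2 * laplaceMoment 2))) ^ (p / 2) +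
      highMomentWeight p * (n * (2 ^ p * (2 * (b ^ p * ∫ x in E, f x)) +
        |τ| ^ p * laplaceMoment p)) := by
  have hp0 : 0 < p := by linarith
  have hXm : ∀ i r, MemLp (fun ω => h (X i ω)) r P := fun i r =>
    memLp_comp_of_hasLaw_density (hX i) hh hb hbd r
  have hβ : ∀ i, ∫ ω, h (X i ω) ∂P = ∫ x, f x * h x := fun i =>
    integral_comp_of_hasLaw_density (hX i) hf hf0 hh
  set β := ∫ x, f x * h x
  have variance_le : ∀ i, ∫ ω, |h (X i ω) - β| ^ (2 : ℝ) ∂P ≤ b ^ 2 * ∫ x in E, f x := fun i => by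
    have hvar := variance_le_expectation_sq (hXm i 2).1
    rw [variance_eq_integral (hXm i 2).1.aemeasurable, hβ] at hvar
    have hsq := integral_abs_comp_rpow_le (hX i) hf hf0 hh hE hbd two_pos
    simp only [Real.rpow_two, sq_abs] at hsq ⊢
    exact hvar.trans hsq
  have moment_le : ∀ i, ∫ ω, |h (X i ω) - β| ^ p ∂P ≤
      2 ^ p * (2 * (b ^ p * ∫ x in E, f x)) := fun i => by
    have hcentred := integral_abs_sub_integral_rpow_le hp (hXm i (ENNReal.ofReal p))
    rw [hβ] at hcentred
    refine hcentred.trans ?_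
    gcongr
    exact integral_abs_comp_rpow_le (hX i) hf hf0 hh hE hbd hp0
  have sum_variance_le := sum_integral_abs_errorSummand_rpow_le (τ := τ) variance_le hY
  simp only [Real.rpow_two, sq_abs] at sum_variance_le
  have hmem : ∀ r, 0 < r → ∀ t, MemLp (errorSummand h β τ X Y t) (ENNReal.ofReal r) P :=
    fun r hr => memLp_errorSummand (fun i => hXm i _) hY hr
  refine (integral_abs_sum_rpow_le_add hp0.le
    (iIndepFun_errorSummand hX (fun i => (hY i).aemeasurable) hind hh) (hmem p hp0)
    (fun t => by simpa only [ENNReal.ofReal_ofNat] using hmem 2 two_pos t)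
    (integral_errorSummand (fun i => (hXm i 1).integrable le_rfl) hβ hY)).trans ?_
  have := rosenthalConst_nonneg p
  have := highMomentWeight_nonneg p
  have : 0 ≤ ∑ t, ∫ ω, errorSummand h β τ X Y t ω ^ 2 ∂P :=
    Finset.sum_nonneg fun t _ => integral_nonneg fun ω => sq_nonneg _
  gcongr
  exact sum_integral_abs_errorSummand_rpow_le moment_le hY

lemma integral_abs_coeff_error_rpow_le (hn : 1 ≤ n) (hp : 1 ≤ p)
    (hX : ∀ i, HasLaw (X i) (volume.withDensity fun x => ENNReal.ofReal (f x)) P)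
    (hY : ∀ i, HasLaw (Y i) laplaceOne P)
    (hind : iIndepFun (β := fun _ : Fin n ⊕ Fin n => ℝ) (Sum.elim X Y) P)
    (hf : Integrable f volume) (hf0 : ∀ x, 0 ≤ f x) (hh : AEStronglyMeasurable h volume)
    (hE : MeasurableSet E) (hb : 0 ≤ b) (hbd : ∀ᵐ x, |h x| ≤ E.indicator (fun _ => b) x) :
    ∫ ω, |(1 / (n : ℝ)) * ∑ i, (h (X i ω) + τ * Y i ω) - ∫ x, f x * h x| ^ p ∂P ≤
      coeffErrorBound p n b (∫ x in E, f x) τ := by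
  have hn0 : (0 : ℝ) < n := by positivity
  have hn1 : (0 : ℝ) ≤ 1 / n := by positivity
  have ha : 0 ≤ ∫ x in E, f x := integral_nonneg hf0
  have := laplaceMoment_nonneg 2
  have := rosenthalConst_nonneg p
  simp only [mean_sub_eq_sum_errorSummand hn, abs_mul, abs_of_nonneg hn1,
    Real.mul_rpow hn1 (abs_nonneg _)]
  rw [integral_const_mul]
  refine (mul_le_mul_of_nonneg_left (integral_abs_sum_errorSummand_rpow_le hp hX hY hind hf hf0
    hh hE hb hbd) (by positivity)).trans_eq ?_
  have hpow : (1 / (n : ℝ)) ^ p * n = (n : ℝ) ^ (1 - p) := by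
    rw [one_div, Real.inv_rpow hn0.le, Real.rpow_sub hn0, Real.rpow_one]
    field_simp
  rw [coeffErrorBound, mul_add]
  congr 1
  · rw [← sq_rpow_half hn1, ← Real.mul_rpow (by positivity) (by positivity)]
    congr 1
    field_simp
  · rw [← hpow]
    ring

end CoefficientError

/-! ### The errors at one resolution level -/

section CellMass

variable {f : ℝ → ℝ} {A T F p : ℝ}

lemma card_translations_le (hA : 0 ≤ A) (hT : 0 ≤ T) (j : ℤ) :
    ((translations A T j).card : ℝ) ≤ (2 : ℝ) ^ (max j 0) * (2 * T + 2 * A + 1) := by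
  have hscale : (1 : ℝ) ≤ 2 ^ (max j 0) := one_le_zpow₀ one_le_two (le_max_right _ _)
  set y := (2 : ℝ) ^ (max j 0) * T + A with hy
  have hfloor : 0 ≤ ⌊y⌋ := Int.floor_nonneg.2 (by positivity)
  have hcard : ((translations A T j).card : ℝ) = 2 * ⌊y⌋ + 1 := by
    rw [translations, Int.card_Icc, ← hy, ← Int.cast_natCast, Int.toNat_of_nonneg (by lia)]
    push_cast
    ring
  nlinarith [Int.floor_le y]

/-- The mass of the density `f` in a cell, that is, the probability that an observation affects
the coefficient with index `(j, k)`. -/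
noncomputable def cellMass (A : ℝ) (f : ℝ → ℝ) (j k : ℤ) : ℝ := ∫ x in cell A j k, f x

lemma cellMass_nonneg (hf0 : ∀ x, 0 ≤ f x) (j k : ℤ) : 0 ≤ cellMass A f j k :=
  integral_nonneg hf0

lemma sum_setLIntegral_cell_le (hA : 0 ≤ A) {u : ℝ → ℝ≥0∞} (hu : AEMeasurable u volume) (j : ℤ)
    (S : Finset ℤ) :
    ∑ k ∈ S, ∫⁻ x in cell A j k, u x ≤ ENNReal.ofReal (2 * A + 1) * ∫⁻ x, u x := by
  have hind : ∀ k x, (cell A j k).indicator u x =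
      ENNReal.ofReal ((cell A j k).indicator (fun _ => (1 : ℝ)) x) * u x := fun k x => by
    by_cases hx : x ∈ cell A j k <;> simp [hx]
  simp only [← lintegral_indicator (measurableSet_cell A j _)]
  rw [← lintegral_finsetSum' _ fun k _ => hu.indicator (measurableSet_cell A j k),
    ← lintegral_const_mul'' _ hu]
  refine lintegral_mono fun x => ?_
  simp only [hind]
  rw [← Finset.sum_mul,
    ← ENNReal.ofReal_sum_of_nonneg fun k _ => indicator_nonneg (fun _ _ => zero_le_one) x]
  gcongr
  exact sum_indicator_cell_le hA j x S

lemma ofReal_cellMass_rpow_le (hf : Integrable f volume) (hf0 : ∀ x, 0 ≤ f x) (hp : 1 ≤ p)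
    (j k : ℤ) : ENNReal.ofReal (cellMass A f j k) ^ p ≤
      ENNReal.ofReal (2 * A * (2 : ℝ) ^ (-j)) ^ (p - 1) * ∫⁻ x in cell A j k, ‖f x‖ₑ ^ p := by
  have hp0 : 0 < p := by linarith
  have hmass : ENNReal.ofReal (cellMass A f j k) = eLpNorm f 1 (volume.restrict (cell A j k)) := by
    rw [eLpNorm_one_eq_lintegral_enorm, cellMass,
      ofReal_integral_eq_lintegral_ofReal hf.integrableOn (ae_of_all _ hf0)]
    exact lintegral_congr fun x => (Real.enorm_eq_ofReal (hf0 x)).symm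
  have holder := eLpNorm_le_eLpNorm_mul_rpow_measure_univ
    (μ := volume.restrict (cell A j k)) (ENNReal.one_le_ofReal.2 hp) hf.1.restrict
  rw [← hmass, Measure.restrict_apply_univ, volume_cell,
    eLpNorm_eq_lintegral_rpow_enorm_toReal (ENNReal.ofReal_pos.2 hp0).ne' ENNReal.ofReal_ne_top,
    ENNReal.toReal_ofReal hp0.le, ENNReal.toReal_one] at holder
  refine (ENNReal.rpow_le_rpow holder hp0.le).trans_eq ?_
  rw [ENNReal.mul_rpow_of_nonneg _ _ hp0.le, ← ENNReal.rpow_mul, ← ENNReal.rpow_mul,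
    one_div_mul_cancel hp0.ne', ENNReal.rpow_one, mul_comm]
  congr 2
  field_simp

lemma lintegral_enorm_rpow_le_of_eLpNorm_le (hp : 0 < p) (hF : 0 ≤ F)
    (hfF : eLpNorm f (ENNReal.ofReal p) volume ≤ ENNReal.ofReal F) :
    ∫⁻ x, ‖f x‖ₑ ^ p ≤ ENNReal.ofReal (F ^ p) := by
  rw [eLpNorm_eq_lintegral_rpow_enorm_toReal (ENNReal.ofReal_pos.2 hp).ne' ENNReal.ofReal_ne_top,
    ENNReal.toReal_ofReal hp.le, one_div] at hfF
  rw [← ENNReal.ofReal_rpow_of_nonneg hF hp.le]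
  exact (ENNReal.rpow_inv_le_iff hp).1 hfF

lemma sum_cellMass_rpow_le (hA : 0 ≤ A) (hf : Integrable f volume) (hf0 : ∀ x, 0 ≤ f x)
    (hp : 1 ≤ p) (hF : 0 ≤ F) (hfF : eLpNorm f (ENNReal.ofReal p) volume ≤ ENNReal.ofReal F)
    (j : ℤ) (S : Finset ℤ) :
    ∑ k ∈ S, cellMass A f j k ^ p ≤
      (2 * A * (2 : ℝ) ^ (-j)) ^ (p - 1) * ((2 * A + 1) * F ^ p) := by
  have hp0 : 0 < p := by linarith
  have hmass : ∀ k, 0 ≤ cellMass A f j k := cellMass_nonneg hf0 j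
  rw [← ENNReal.ofReal_le_ofReal_iff (by positivity),
    ENNReal.ofReal_sum_of_nonneg fun k _ => Real.rpow_nonneg (hmass k) _]
  calc ∑ k ∈ S, ENNReal.ofReal (cellMass A f j k ^ p)
      = ∑ k ∈ S, ENNReal.ofReal (cellMass A f j k) ^ p :=
        Finset.sum_congr rfl fun k _ => (ENNReal.ofReal_rpow_of_nonneg (hmass k) hp0.le).symm
    _ ≤ ENNReal.ofReal (2 * A * (2 : ℝ) ^ (-j)) ^ (p - 1) *
          ∑ k ∈ S, ∫⁻ x in cell A j k, ‖f x‖ₑ ^ p := by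
        rw [Finset.mul_sum]
        exact Finset.sum_le_sum fun k _ => ofReal_cellMass_rpow_le hf hf0 hp j k
    _ ≤ ENNReal.ofReal (2 * A * (2 : ℝ) ^ (-j)) ^ (p - 1) *
          (ENNReal.ofReal (2 * A + 1) * ENNReal.ofReal (F ^ p)) := by
        gcongr
        refine (sum_setLIntegral_cell_le hA (hf.1.enorm.pow_const p) j S).trans ?_
        gcongr
        exact lintegral_enorm_rpow_le_of_eLpNorm_le hp0 hF hfF
    _ = _ := by
        rw [ENNReal.ofReal_rpow_of_nonneg (by positivity) (by linarith),
          ← ENNReal.ofReal_mul (by positivity), ← ENNReal.ofReal_mul (by positivity)]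

lemma sum_cellMass_le (hA : 0 ≤ A) (hf : Integrable f volume) (hf0 : ∀ x, 0 ≤ f x)
    (hf1 : ∫ x, f x = 1) (j : ℤ) (S : Finset ℤ) : ∑ k ∈ S, cellMass A f j k ≤ 2 * A + 1 := by
  have hnorm : eLpNorm f (ENNReal.ofReal 1) volume ≤ ENNReal.ofReal 1 := by
    rw [ENNReal.ofReal_one, eLpNorm_one_eq_lintegral_enorm,
      lintegral_congr fun x => Real.enorm_eq_ofReal (hf0 x),
      ← ofReal_integral_eq_lintegral_ofReal hf (ae_of_all _ hf0), hf1, ENNReal.ofReal_one]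
  simpa only [Real.rpow_one, sub_self, Real.rpow_zero, one_mul, mul_one] using
    sum_cellMass_rpow_le hA hf hf0 le_rfl zero_le_one hnorm j S

/-- The constant in `sum_cellMass_rpow_half_le`. -/
noncomputable def massConst (A T F p : ℝ) : ℝ :=
  √((2 * T + 2 * A + 1) * ((2 * A) ^ (p - 1) * ((2 * A + 1) * F ^ p)))

lemma sum_cellMass_rpow_half_le (hA : 0 ≤ A) (hT : 0 ≤ T) (hf : Integrable f volume)
    (hf0 : ∀ x, 0 ≤ f x) (hp : 1 ≤ p) (hF : 0 ≤ F)
    (hfF : eLpNorm f (ENNReal.ofReal p) volume ≤ ENNReal.ofReal F) (l : ℕ) :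
    ∑ k ∈ translations A T l, cellMass A f l k ^ (p / 2) ≤
      massConst A T F p * (2 : ℝ) ^ ((l : ℝ) * (1 - p / 2)) := by
  have hmass : ∀ k, 0 ≤ cellMass A f l k := cellMass_nonneg hf0 l
  have hcard := card_translations_le hA hT l
  rw [max_eq_left (Int.natCast_nonneg l), zpow_natCast] at hcard
  have cauchy_schwarz := sq_sum_le_card_mul_sum_sq (s := translations A T l)
    (f := fun k => cellMass A f l k ^ (p / 2))
  simp only [rpow_half_sq (hmass _)] at cauchy_schwarz
  have hscale : ((2 : ℝ) ^ ((l : ℝ) * (1 - p / 2))) ^ 2 =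
      (2 : ℝ) ^ l * ((2 : ℝ) ^ (-(l : ℤ))) ^ (p - 1) := by
    rw [← Real.rpow_natCast, ← Real.rpow_natCast, ← Real.rpow_intCast, ← Real.rpow_mul two_pos.le,
      ← Real.rpow_mul two_pos.le, ← Real.rpow_add two_pos]
    congr 1
    push_cast
    ring
  refine abs_le_of_sq_le_sq' ?_ (by unfold massConst; positivity) |>.2
  calc (∑ k ∈ translations A T l, cellMass A f l k ^ (p / 2)) ^ 2
      ≤ (2 ^ l * (2 * T + 2 * A + 1)) *
          ((2 * A * (2 : ℝ) ^ (-(l : ℤ))) ^ (p - 1) * ((2 * A + 1) * F ^ p)) :=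
        cauchy_schwarz.trans (mul_le_mul hcard
          (sum_cellMass_rpow_le hA hf hf0 hp hF hfF l (translations A T l))
          (Finset.sum_nonneg fun k _ => Real.rpow_nonneg (hmass k) _) (by positivity))
    _ = (massConst A T F p * (2 : ℝ) ^ ((l : ℝ) * (1 - p / 2))) ^ 2 := by
        rw [massConst, mul_pow, Real.sq_sqrt (by positivity), hscale,
          Real.mul_rpow (by positivity) (by positivity)]
        ring

end CellMass

section LevelSum

variable {f : ℝ → ℝ} {A B T F p : ℝ} {n l : ℕ}

lemma mul_two_rpow_half_rpow (hB : 0 ≤ B) (l : ℕ) (p : ℝ) :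
    (B * (2 : ℝ) ^ ((l : ℝ) / 2)) ^ p = B ^ p * (2 : ℝ) ^ ((l : ℝ) * (p / 2)) := by
  rw [Real.mul_rpow hB (by positivity), ← Real.rpow_mul two_pos.le]
  ring_nf

lemma coeffErrorBound_variance_term_le {b a τ : ℝ} (hb : 0 ≤ b) (ha : 0 ≤ a) (hp : 0 ≤ p) :
    ((1 + rosenthalConst p) * ((b ^ 2 * a + τ ^ 2 * laplaceMoment 2) / n)) ^ (p / 2) ≤
      (2 * (1 + rosenthalConst p)) ^ (p / 2) * (n : ℝ) ^ (-(p / 2)) *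
        (b ^ p * a ^ (p / 2) + |τ| ^ p * laplaceMoment 2 ^ (p / 2)) := by
  have := rosenthalConst_nonneg p
  have := laplaceMoment_nonneg 2
  have hadd := add_rpow_le_two_rpow_mul (x := b ^ 2 * a) (y := τ ^ 2 * laplaceMoment 2)
    (r := p / 2) (by positivity) (by positivity) (by positivity)
  rw [Real.mul_rpow (sq_nonneg b) ha, Real.mul_rpow (sq_nonneg τ) (by positivity),
    sq_rpow_half hb, ← sq_abs τ, sq_rpow_half (abs_nonneg τ)] at hadd
  rw [Real.mul_rpow (by positivity) (by positivity), Real.div_rpow (by positivity) (by positivity),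
    Real.mul_rpow two_pos.le (by positivity), Real.rpow_neg n.cast_nonneg, ← sq_abs τ]
  calc _ ≤ (1 + rosenthalConst p) ^ (p / 2) * (2 ^ (p / 2) *
        (b ^ p * a ^ (p / 2) + |τ| ^ p * laplaceMoment 2 ^ (p / 2)) / (n : ℝ) ^ (p / 2)) := by
        gcongr
    _ = _ := by ring

lemma sum_variance_term_le (hA : 0 ≤ A) (hB : 0 ≤ B) (hT : 0 ≤ T) (hf : Integrable f volume)
    (hf0 : ∀ x, 0 ≤ f x) (hp : 1 ≤ p) (hF : 0 ≤ F)
    (hfF : eLpNorm f (ENNReal.ofReal p) volume ≤ ENNReal.ofReal F) (τ : ℝ) :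
    ∑ k ∈ translations A T l, ((1 + rosenthalConst p) *
        (((B * (2 : ℝ) ^ ((l : ℝ) / 2)) ^ 2 * cellMass A f l k + τ ^ 2 * laplaceMoment 2) / n)) ^
          (p / 2) ≤
      (2 * (1 + rosenthalConst p)) ^ (p / 2) * (B ^ p * massConst A T F p +
        (2 * T + 2 * A + 1) * laplaceMoment 2 ^ (p / 2) * |τ| ^ p) *
          ((n : ℝ) ^ (-(p / 2)) * 2 ^ l) := by
  have := rosenthalConst_nonneg p
  have := laplaceMoment_nonneg 2
  have hcard := card_translations_le hA hT l
  rw [max_eq_left (Int.natCast_nonneg l), zpow_natCast] at hcard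
  have hscale : (2 : ℝ) ^ ((l : ℝ) * (p / 2)) * (2 : ℝ) ^ ((l : ℝ) * (1 - p / 2)) = 2 ^ l := by
    rw [← Real.rpow_add two_pos, ← Real.rpow_natCast]
    ring_nf
  refine (Finset.sum_le_sum fun k _ => coeffErrorBound_variance_term_le
    (by positivity) (cellMass_nonneg hf0 l k) (by linarith)).trans ?_
  rw [← Finset.mul_sum, Finset.sum_add_distrib, ← Finset.mul_sum, Finset.sum_const, nsmul_eq_mul,
    mul_two_rpow_half_rpow hB]
  set c := (2 * (1 + rosenthalConst p)) ^ (p / 2)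
  set ν := (n : ℝ) ^ (-(p / 2))
  set m := laplaceMoment 2 ^ (p / 2)
  calc _ ≤ c * ν * (B ^ p * (2 : ℝ) ^ ((l : ℝ) * (p / 2)) *
          (massConst A T F p * (2 : ℝ) ^ ((l : ℝ) * (1 - p / 2))) +
          2 ^ l * (2 * T + 2 * A + 1) * (|τ| ^ p * m)) := by
        gcongr
        exact sum_cellMass_rpow_half_le hA hT hf hf0 hp hF hfF l
    _ = c * ν * (B ^ p * massConst A T F p *
          ((2 : ℝ) ^ ((l : ℝ) * (p / 2)) * (2 : ℝ) ^ ((l : ℝ) * (1 - p / 2))) +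
          2 ^ l * (2 * T + 2 * A + 1) * (|τ| ^ p * m)) := by ring
    _ = _ := by
        rw [hscale]
        ring

lemma natCast_rpow_mul_two_rpow_eq (hn : 1 ≤ n) (l : ℕ) (p : ℝ) :
    (n : ℝ) ^ (1 - p) * (2 : ℝ) ^ ((l : ℝ) * (p / 2)) =
      (n : ℝ) ^ (-(p / 2)) * 2 ^ l * ((2 : ℝ) ^ l / n) ^ (p / 2 - 1) := by
  have hn0 : (0 : ℝ) < n := by positivity
  have hn_split : (n : ℝ) ^ (1 - p) = (n : ℝ) ^ (-(p / 2)) * (n : ℝ) ^ (-(p / 2 - 1)) := by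
    rw [← Real.rpow_add hn0]
    ring_nf
  have hl_split : (2 : ℝ) ^ ((l : ℝ) * (p / 2)) = 2 ^ l * ((2 : ℝ) ^ l) ^ (p / 2 - 1) := by
    rw [← Real.rpow_natCast, ← Real.rpow_mul two_pos.le, ← Real.rpow_add two_pos]
    ring_nf
  rw [hn_split, hl_split, Real.div_rpow (by positivity) hn0.le, Real.rpow_neg hn0.le (p / 2 - 1)]
  ring

lemma sum_high_moment_term_le (hA : 0 ≤ A) (hB : 0 ≤ B) (hT : 0 ≤ T) (hf : Integrable f volume)
    (hf0 : ∀ x, 0 ≤ f x) (hf1 : ∫ x, f x = 1) (hp : 2 ≤ p) (hn : 1 ≤ n) (τ : ℝ) :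
    ∑ k ∈ translations A T l, (n : ℝ) ^ (1 - p) *
        (2 ^ p * (2 * ((B * (2 : ℝ) ^ ((l : ℝ) / 2)) ^ p * cellMass A f l k)) +
          |τ| ^ p * laplaceMoment p) ≤
      (2 ^ p * 2 * B ^ p * (2 * A + 1) * ((2 : ℝ) ^ l / n) ^ (p / 2 - 1) +
        (2 * T + 2 * A + 1) * laplaceMoment p * |τ| ^ p) * ((n : ℝ) ^ (-(p / 2)) * 2 ^ l) := by
  have := laplaceMoment_nonneg p
  have hcard := card_translations_le hA hT l
  rw [max_eq_left (Int.natCast_nonneg l), zpow_natCast] at hcard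
  have hn_le : (n : ℝ) ^ (1 - p) ≤ (n : ℝ) ^ (-(p / 2)) :=
    Real.rpow_le_rpow_of_exponent_le (by exact_mod_cast hn) (by linarith)
  rw [← Finset.mul_sum, Finset.sum_add_distrib, ← Finset.mul_sum, ← Finset.mul_sum,
    ← Finset.mul_sum, Finset.sum_const, nsmul_eq_mul, mul_two_rpow_half_rpow hB, mul_add]
  set K := 2 * T + 2 * A + 1
  have hK : 0 ≤ K := by positivity
  calc _ ≤ (n : ℝ) ^ (1 - p) *
          (2 ^ p * (2 * (B ^ p * (2 : ℝ) ^ ((l : ℝ) * (p / 2)) * (2 * A + 1)))) +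
        (n : ℝ) ^ (-(p / 2)) * (2 ^ l * K * (|τ| ^ p * laplaceMoment p)) := by
        gcongr
        exact sum_cellMass_le hA hf hf0 hf1 l _
    _ = 2 ^ p * 2 * B ^ p * (2 * A + 1) *
          ((n : ℝ) ^ (1 - p) * (2 : ℝ) ^ ((l : ℝ) * (p / 2))) +
        (n : ℝ) ^ (-(p / 2)) * (2 ^ l * K * (|τ| ^ p * laplaceMoment p)) := by ring
    _ = _ := by
        rw [natCast_rpow_mul_two_rpow_eq hn]
        ring

/-- The constant in `sum_coeffErrorBound_le`. -/
noncomputable def levelConst (A B T F p : ℝ) : ℝ :=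
  (2 * (1 + rosenthalConst p)) ^ (p / 2) *
      (B ^ p * massConst A T F p + (2 * T + 2 * A + 1) * laplaceMoment 2 ^ (p / 2)) +
    rosenthalConst p *
      (2 ^ p * 2 * B ^ p * (2 * A + 1) + (2 * T + 2 * A + 1) * laplaceMoment p)

lemma massConst_nonneg (A T F p : ℝ) : 0 ≤ massConst A T F p := Real.sqrt_nonneg _

lemma levelConst_nonneg (hA : 0 ≤ A) (hB : 0 ≤ B) (hT : 0 ≤ T) : 0 ≤ levelConst A B T F p := by
  have := rosenthalConst_nonneg p
  have := laplaceMoment_nonneg 2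
  have := laplaceMoment_nonneg p
  have := massConst_nonneg A T F p
  unfold levelConst
  positivity

/-- The relative size of the contribution of the moments of order `p > 2` of the observations to
the stochastic error at the levels up to `j₁`. -/
noncomputable def highMoment (p : ℝ) (n j₁ : ℕ) : ℝ :=
  if p ≤ 2 then 0 else ((2 : ℝ) ^ j₁ / n) ^ (p / 2 - 1)

lemma highMoment_nonneg (p : ℝ) (n j₁ : ℕ) : 0 ≤ highMoment p n j₁ := by
  unfold highMoment
  split_ifs <;> positivity

lemma sum_weighted_high_moment_term_le (hA : 0 ≤ A) (hB : 0 ≤ B) (hT : 0 ≤ T)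
    (hf : Integrable f volume) (hf0 : ∀ x, 0 ≤ f x) (hf1 : ∫ x, f x = 1) (hn : 1 ≤ n) {j₁ : ℕ}
    (hl : l ≤ j₁) (τ : ℝ) :
    highMomentWeight p * ∑ k ∈ translations A T l, (n : ℝ) ^ (1 - p) *
        (2 ^ p * (2 * ((B * (2 : ℝ) ^ ((l : ℝ) / 2)) ^ p * cellMass A f l k)) +
          |τ| ^ p * laplaceMoment p) ≤
      rosenthalConst p * (2 ^ p * 2 * B ^ p * (2 * A + 1) * highMoment p n j₁ +
        (2 * T + 2 * A + 1) * laplaceMoment p * |τ| ^ p) * ((n : ℝ) ^ (-(p / 2)) * 2 ^ l) := by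
  have := rosenthalConst_nonneg p
  have := laplaceMoment_nonneg p
  unfold highMomentWeight highMoment
  split_ifs with hp
  · rw [zero_mul]
    positivity
  · have hp2 : 0 ≤ p / 2 - 1 := by linarith
    rw [mul_assoc]
    gcongr
    refine (sum_high_moment_term_le hA hB hT hf hf0 hf1 (not_le.1 hp).le hn τ).trans ?_
    gcongr
    exact one_le_two

lemma sum_coeffErrorBound_le (hA : 0 ≤ A) (hB : 0 ≤ B) (hT : 0 ≤ T) (hf : Integrable f volume)
    (hf0 : ∀ x, 0 ≤ f x) (hf1 : ∫ x, f x = 1) (hp : 1 ≤ p) (hF : 0 ≤ F)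
    (hfF : eLpNorm f (ENNReal.ofReal p) volume ≤ ENNReal.ofReal F) (hn : 1 ≤ n) {j₁ : ℕ}
    (hl : l ≤ j₁) (τ : ℝ) :
    ∑ k ∈ translations A T l,
        coeffErrorBound p n (B * (2 : ℝ) ^ ((l : ℝ) / 2)) (cellMass A f l k) τ ≤
      levelConst A B T F p * (1 + |τ| ^ p + highMoment p n j₁) *
        ((n : ℝ) ^ (-(p / 2)) * 2 ^ l) := by
  have := rosenthalConst_nonneg p
  have := laplaceMoment_nonneg 2
  have := laplaceMoment_nonneg p
  have := massConst_nonneg A T F p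
  have := highMoment_nonneg p n j₁
  have : 0 ≤ |τ| ^ p := by positivity
  simp only [coeffErrorBound]
  rw [Finset.sum_add_distrib, ← Finset.mul_sum]
  refine (add_le_add (sum_variance_term_le hA hB hT hf hf0 hp hF hfF τ)
    (sum_weighted_high_moment_term_le hA hB hT hf hf0 hf1 hn hl τ)).trans ?_
  set M := 1 + |τ| ^ p + highMoment p n j₁
  have one_le : 1 ≤ M := by linarith
  have noise_le : |τ| ^ p ≤ M := by linarith
  have high_le : highMoment p n j₁ ≤ M := by linarith
  rw [← mul_one (B ^ p * massConst A T F p)]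
  calc _ ≤ (2 * (1 + rosenthalConst p)) ^ (p / 2) * (B ^ p * massConst A T F p * M +
          (2 * T + 2 * A + 1) * laplaceMoment 2 ^ (p / 2) * M) * ((n : ℝ) ^ (-(p / 2)) * 2 ^ l) +
        rosenthalConst p * (2 ^ p * 2 * B ^ p * (2 * A + 1) * M +
          (2 * T + 2 * A + 1) * laplaceMoment p * M) * ((n : ℝ) ^ (-(p / 2)) * 2 ^ l) := by
        gcongr
    _ = _ := by
        rw [levelConst]
        ring

end LevelSum

/-! ### The risk of the linear estimator -/

/-- The wavelet whose translates are the basis functions at level `j`: the father wavelet for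
`j = -1`, the mother wavelet for `j ≥ 0`. -/
noncomputable def generator (φ ψ : ℝ → ℝ) (j : ℤ) : ℝ → ℝ := if j = -1 then φ else ψ

lemma basisFun_eq_dil (φ ψ : ℝ → ℝ) {j : ℤ} (hj : -1 ≤ j) (k : ℤ) :
    basisFun φ ψ j k = dil (generator φ ψ j) j.toNat k := by
  unfold basisFun generator
  split_ifs with hfather
  · subst hfather
    rfl
  · rw [Int.toNat_of_nonneg (by lia)]

lemma translations_toNat (A T : ℝ) (j : ℤ) : translations A T j.toNat = translations A T j := by
  ext k
  rw [mem_translations, mem_translations, Int.toNat_eq_max, max_eq_left (le_max_right j 0)]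

lemma sum_Icc_neg_one {M : Type*} [AddCommMonoid M] (F : ℤ → M) (m : ℕ) :
    ∑ j ∈ Finset.Icc (-1 : ℤ) m, F j = F (-1) + ∑ l ∈ Finset.range (m + 1), F l := by
  have hIcc : Finset.Icc (-1 : ℤ) m =
      insert (-1) ((Finset.range (m + 1)).map Nat.castEmbedding) := by
    ext j
    simp only [Finset.mem_Icc, Finset.mem_insert, Finset.mem_map, Finset.mem_range,
      Nat.castEmbedding_apply]
    refine ⟨fun hj => ?_, ?_⟩
    · rcases hj.1.eq_or_lt with hj1 | hj1
      · exact .inl hj1.symm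
      · exact .inr ⟨j.toNat, by lia, Int.toNat_of_nonneg (by lia)⟩
    · rintro (rfl | ⟨l, hl, rfl⟩) <;> lia
  have hnot : (-1 : ℤ) ∉ (Finset.range (m + 1)).map Nat.castEmbedding := by
    simp only [Finset.mem_map, Nat.castEmbedding_apply, not_exists]
    lia
  rw [hIcc, Finset.sum_insert hnot, Finset.sum_map]
  rfl

/-- The constant in `sum_two_rpow_half_le`. -/
noncomputable def geomConst : ℝ := 1 + √2 / (√2 - 1)

lemma geomConst_nonneg : 0 ≤ geomConst := by
  have : 0 < √2 - 1 := sub_pos.2 Real.one_lt_sqrt_two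
  unfold geomConst
  positivity

lemma two_rpow_half_natCast (l : ℕ) : (2 : ℝ) ^ ((l : ℝ) / 2) = √2 ^ l := by
  rw [Real.sqrt_eq_rpow, ← Real.rpow_natCast, ← Real.rpow_mul two_pos.le]
  ring_nf

lemma sum_two_rpow_half_le (j₁ : ℕ) :
    ∑ j ∈ Finset.Icc (-1 : ℤ) j₁, (2 : ℝ) ^ ((j.toNat : ℝ) / 2) ≤
      geomConst * (2 : ℝ) ^ ((j₁ : ℝ) / 2) := by
  have one_lt : 1 < √2 := Real.one_lt_sqrt_two
  have : 0 < √2 - 1 := sub_pos.2 one_lt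
  rw [sum_Icc_neg_one]
  simp only [Int.toNat_natCast, two_rpow_half_natCast]
  rw [geom_sum_eq one_lt.ne', show (-1 : ℤ).toNat = 0 from rfl, pow_zero, geomConst, add_mul,
    one_mul, div_mul_eq_mul_div, pow_succ']
  gcongr
  · exact one_le_pow₀ one_lt.le
  · linarith

lemma eLpNorm_mul_sum_abs_rpow_le {ι Ω : Type*} [MeasurableSpace Ω] {P : Measure Ω}
    [IsFiniteMeasure P] {a : ι → Ω → ℝ} {S : Finset ι} {p c M : ℝ} (hp : 0 < p) (hc : 0 ≤ c)
    (ha : ∀ k ∈ S, MemLp (a k) (ENNReal.ofReal p) P)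
    (hM : ∑ k ∈ S, ∫ ω, |a k ω| ^ p ∂P ≤ M) :
    eLpNorm (fun ω => c * (∑ k ∈ S, |a k ω| ^ p) ^ (1 / p)) (ENNReal.ofReal p) P ≤
      ENNReal.ofReal (c * M ^ (1 / p)) := by
  have integrable_term : ∀ k ∈ S, Integrable (fun ω => |a k ω| ^ p) P := fun k hk =>
    integrable_abs_rpow hp.le le_rfl (ha k hk)
  have sum_nonneg : ∀ ω, 0 ≤ ∑ k ∈ S, |a k ω| ^ p := fun ω => by positivity
  have integral_nonneg : ∀ k, 0 ≤ ∫ ω, |a k ω| ^ p ∂P := fun k =>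
    integral_nonneg fun ω => by positivity
  refine (eLpNorm_le_of_ae_abs_rpow_le hp
    ((integrable_finsetSum S integrable_term).const_mul (c ^ p)) (ae_of_all _ fun ω => ?_)).trans
      (ENNReal.ofReal_le_ofReal ?_)
  · rw [abs_of_nonneg (by positivity), Real.mul_rpow hc (by positivity),
      ← Real.rpow_mul (sum_nonneg ω), one_div_mul_cancel hp.ne', Real.rpow_one]
  · rw [integral_const_mul, integral_finsetSum S integrable_term, Real.mul_rpow (by positivity)
      (Finset.sum_nonneg fun k _ => integral_nonneg k), ← Real.rpow_mul hc,
      mul_one_div_cancel hp.ne', Real.rpow_one]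
    have := Finset.sum_nonneg fun k (_ : k ∈ S) => integral_nonneg k
    gcongr

lemma two_rpow_mul_rpow_one_div_eq {M p : ℝ} (hM : 0 ≤ M) (hp : 0 < p) (n l : ℕ) :
    (2 : ℝ) ^ ((l : ℝ) * (1 / 2 - 1 / p)) * (M * ((n : ℝ) ^ (-(p / 2)) * 2 ^ l)) ^ (1 / p) =
      M ^ (1 / p) * ((n : ℝ) ^ (-(1 / 2) : ℝ) * (2 : ℝ) ^ ((l : ℝ) / 2)) := by
  have hn : ((n : ℝ) ^ (-(p / 2))) ^ (1 / p) = (n : ℝ) ^ (-(1 / 2) : ℝ) := by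
    rw [← Real.rpow_mul n.cast_nonneg]
    congr 1
    field_simp
  have hl : (2 : ℝ) ^ ((l : ℝ) * (1 / 2 - 1 / p)) * ((2 : ℝ) ^ l) ^ (1 / p) =
      (2 : ℝ) ^ ((l : ℝ) / 2) := by
    rw [← Real.rpow_natCast, ← Real.rpow_mul two_pos.le, ← Real.rpow_add two_pos]
    ring_nf
  rw [Real.mul_rpow hM (by positivity), Real.mul_rpow (by positivity) (by positivity), hn, ← hl]
  ring

section Sample

variable {φ ψ f : ℝ → ℝ} {A B T F s p L α τ : ℝ} {q : ℝ≥0∞} {n j₁ : ℕ} {Ω : Type*}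
  {X : Fin n → Ω → ℝ} {W : Fin n → ℤ → ℤ → Ω → ℝ}

lemma IsWaveletPair.generator (h : IsWaveletPair A B φ ψ) (j : ℤ) :
    IsLocalized A B (generator φ ψ j) := by
  unfold LDPWavelet.generator
  split_ifs
  exacts [h.father, h.mother]

lemma IsWaveletPair.sum_proj_ae_eq (h : IsWaveletPair A B φ ψ) (hf : Integrable f volume)
    (hT : Function.support f ⊆ Icc (-T) T) (j₁ : ℕ) :
    ∑ j ∈ Finset.Icc (-1 : ℤ) j₁, proj A T (LDPWavelet.generator φ ψ j) j.toNat f =ᵐ[volume]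
      proj A T φ (j₁ + 1 : ℕ) f := by
  have telescope := h.proj_add_ae_eq_sum hf hT 0 (j₁ + 1)
  simp only [zero_add] at telescope
  rw [sum_Icc_neg_one]
  refine Filter.EventuallyEq.trans (.of_eq ?_) telescope.symm
  congr 1

/-- The error of the empirical coefficient with the index `(j, k)`. -/
noncomputable def coeffError (φ ψ : ℝ → ℝ) (A α : ℝ) (j₁ : ℕ) (f : ℝ → ℝ) (X : Fin n → Ω → ℝ)
    (W : Fin n → ℤ → ℤ → Ω → ℝ) (j k : ℤ) (ω : Ω) : ℝ :=
  (1 / (n : ℝ)) * ∑ i, privateView φ ψ A α j₁ j k (X i ω) (W i j k ω) -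
    coeff f (generator φ ψ j) j.toNat k

/-- The bound for the `L^p` norm of the error of the estimated expansion at level `j` that results
from the errors of the coefficients, see `IsLocalized.eLpNorm_sum_dil_le`. -/
noncomputable def levelError (φ ψ : ℝ → ℝ) (A B T p α : ℝ) (j₁ : ℕ) (f : ℝ → ℝ)
    (X : Fin n → Ω → ℝ) (W : Fin n → ℤ → ℤ → Ω → ℝ) (j : ℤ) (ω : Ω) : ℝ :=
  synthConst A B p * (2 : ℝ) ^ ((j.toNat : ℝ) * (1 / 2 - 1 / p)) *
    (∑ k ∈ translations A T j, |coeffError φ ψ A α j₁ f X W j k ω| ^ p) ^ (1 / p)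

lemma levelError_nonneg (hA : 0 ≤ A) (hB : 0 ≤ B) (j : ℤ) (ω : Ω) :
    0 ≤ levelError φ ψ A B T p α j₁ f X W j ω := by
  have := synthConst_nonneg hA hB p
  unfold levelError
  positivity

lemma IsWaveletPair.linEstimator_sub_ae_eq (h : IsWaveletPair A B φ ψ) (hf : Integrable f volume)
    (hT : Function.support f ⊆ Icc (-T) T) (ω : Ω) :
    (fun x => linEstimator φ ψ A T j₁ n
        (fun i j k => privateView φ ψ A α j₁ j k (X i ω) (W i j k ω)) x - f x) =ᵐ[volume]
      ∑ j ∈ Finset.Icc (-1 : ℤ) j₁, (fun x => ∑ k ∈ translations A T j,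
        coeffError φ ψ A α j₁ f X W j k ω * dil (LDPWavelet.generator φ ψ j) j.toNat k x) +
        (proj A T φ (j₁ + 1 : ℕ) f - f) := by
  filter_upwards [h.sum_proj_ae_eq hf hT j₁] with x hx
  rw [Finset.sum_apply] at hx
  rw [Pi.add_apply, Finset.sum_apply, Pi.sub_apply, ← hx, linEstimator, ← add_sub_assoc,
    ← Finset.sum_add_distrib]
  congr 1
  refine Finset.sum_congr rfl fun j hj => ?_
  rw [proj, translations_toNat, ← Finset.sum_add_distrib]
  refine Finset.sum_congr rfl fun k _ => ?_
  rw [basisFun_eq_dil φ ψ (Finset.mem_Icc.1 hj).1, coeffError]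
  ring

lemma IsWaveletPair.eLpNorm_linEstimator_sub_le (h : IsWaveletPair A B φ ψ) (hs : 0 < s)
    (hp : 1 ≤ p) (hq : q ≠ 0) (hL : 0 ≤ L) (hf : MemDensityClass φ ψ s p q L T f) (ω : Ω) :
    eLpNorm (fun x => linEstimator φ ψ A T j₁ n
        (fun i j k => privateView φ ψ A α j₁ j k (X i ω) (W i j k ω)) x - f x)
      (ENNReal.ofReal p) volume ≤
    ENNReal.ofReal (∑ j ∈ Finset.Icc (-1 : ℤ) j₁, levelError φ ψ A B T p α j₁ f X W j ω +
      biasConst A B s p L * (2 : ℝ) ^ (-(j₁ * s))) := by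
  have one_le_p := ENNReal.one_le_ofReal.2 hp
  have hA := h.father.radius_nonneg
  have hB := h.father.bound_nonneg
  have hbias := biasConst_nonneg (p := p) hA hB hs hL
  have hlevel := fun j => levelError_nonneg (φ := φ) (ψ := ψ) (T := T) (p := p) (α := α)
    (j₁ := j₁) (f := f) (X := X) (W := W) hA hB j ω
  have measurable_level : ∀ j, AEStronglyMeasurable (fun x => ∑ k ∈ translations A T j,
      coeffError φ ψ A α j₁ f X W j k ω * dil (LDPWavelet.generator φ ψ j) j.toNat k x) volume :=
    fun j => Finset.aestronglyMeasurable_fun_sum _ fun k _ =>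
      ((h.generator j).aestronglyMeasurable_dil _ k).const_mul _
  rw [eLpNorm_congr_ae (h.linEstimator_sub_ae_eq hf.integrable hf.support_subset ω),
    ENNReal.ofReal_add (Finset.sum_nonneg fun j _ => hlevel j) (by positivity),
    ENNReal.ofReal_sum_of_nonneg fun j _ => hlevel j]
  refine (eLpNorm_add_le (Finset.aestronglyMeasurable_sum _ fun j _ => measurable_level j)
    ((h.father.memLp_two_proj _).1.sub hf.integrable.1) one_le_p).trans (add_le_add ?_ ?_)
  · refine (eLpNorm_sum_le (fun j _ => measurable_level j) one_le_p).trans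
      (Finset.sum_le_sum fun j _ => ?_)
    exact_mod_cast (h.generator j).eLpNorm_sum_dil_le hp j.toNat (translations A T j) _
  · refine (h.eLpNorm_proj_sub_le hs hp hq hL hf (j₁ + 1)).trans (ENNReal.ofReal_le_ofReal ?_)
    gcongr
    · exact one_le_two
    · exact j₁.le_succ

lemma IsWaveletPair.ae_abs_dil_generator_le (h : IsWaveletPair A B φ ψ) (j k : ℤ) :
    ∀ᵐ x, |dil (LDPWavelet.generator φ ψ j) j.toNat k x| ≤
      (cell A j.toNat k).indicator (fun _ => B * (2 : ℝ) ^ ((j.toNat : ℝ) / 2)) x := by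
  filter_upwards [(h.generator j).ae_abs_dil_le] with x hx
  have := hx j.toNat k
  rwa [Int.cast_natCast] at this

variable [MeasurableSpace Ω] {P : Measure Ω}

lemma IsSample.iIndepFun_level {I : Set (ℤ × ℤ)} (hs : IsSample P f n I X W) {j k : ℤ}
    (h : (j, k) ∈ I) :
    iIndepFun (β := fun _ : Fin n ⊕ Fin n => ℝ) (Sum.elim X fun i => W i j k) P := by
  have hinj : Function.Injective
      (Sum.map id fun i => (i, ⟨(j, k), h⟩) : Fin n ⊕ Fin n → Fin n ⊕ (Fin n × I)) :=
    Function.Injective.sumMap Function.injective_id fun a b hab => (Prod.mk.inj hab).1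
  convert hs.indep.precomp hinj using 1
  ext (i | i) <;> rfl

lemma IsWaveletPair.linRisk_le_eLpNorm (h : IsWaveletPair A B φ ψ) (hs : 0 < s) (hp : 1 ≤ p)
    (hq : q ≠ 0) (hL : 0 ≤ L) (hf : MemDensityClass φ ψ s p q L T f) :
    linRisk P φ ψ A T α p j₁ n f X W ≤
      eLpNorm (∑ j ∈ Finset.Icc (-1 : ℤ) j₁, levelError φ ψ A B T p α j₁ f X W j +
        fun _ => biasConst A B s p L * (2 : ℝ) ^ (-(j₁ * s))) (ENNReal.ofReal p) P ^ p := by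
  have hp0 : 0 < p := by linarith
  rw [eLpNorm_eq_lintegral_rpow_enorm_toReal (ENNReal.ofReal_pos.2 hp0).ne' ENNReal.ofReal_ne_top,
    ENNReal.toReal_ofReal hp0.le, ← ENNReal.rpow_mul, one_div_mul_cancel hp0.ne',
    ENNReal.rpow_one, linRisk]
  gcongr with ω
  refine (h.eLpNorm_linEstimator_sub_le hs hp hq hL hf ω).trans ?_
  rw [Pi.add_apply, Finset.sum_apply]
  exact Real.ofReal_le_enorm _

variable [IsProbabilityMeasure P]

lemma IsWaveletPair.memLp_coeffError (h : IsWaveletPair A B φ ψ) (hp : 0 < p)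
    (hsam : IsSample P f n (indexSet A T j₁) X W) {j k : ℤ} (hj : j ∈ Finset.Icc (-1 : ℤ) j₁)
    (hk : k ∈ translations A T j) :
    MemLp (coeffError φ ψ A α j₁ f X W j k) (ENNReal.ofReal p) P := by
  have hB := h.father.bound_nonneg
  unfold coeffError
  simpa only [privateView, basisFun_eq_dil φ ψ (Finset.mem_Icc.1 hj).1] using
    memLp_coeff_error (τ := noiseLevel φ ψ A α j₁ j) hsam.law_X
      (fun i => hsam.law_W i (j, k) ⟨hj, hk⟩)
      ((h.generator j).aestronglyMeasurable_dil j.toNat k) (by positivity)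
      (h.ae_abs_dil_generator_le j k) hp (coeff f (LDPWavelet.generator φ ψ j) j.toNat k)

lemma IsWaveletPair.integral_abs_coeffError_rpow_le (h : IsWaveletPair A B φ ψ) (hn : 1 ≤ n)
    (hp : 1 ≤ p) (hf : Integrable f volume) (hf0 : ∀ x, 0 ≤ f x)
    (hsam : IsSample P f n (indexSet A T j₁) X W) {j k : ℤ} (hj : j ∈ Finset.Icc (-1 : ℤ) j₁)
    (hk : k ∈ translations A T j) :
    ∫ ω, |coeffError φ ψ A α j₁ f X W j k ω| ^ p ∂P ≤
      coeffErrorBound p n (B * (2 : ℝ) ^ ((j.toNat : ℝ) / 2)) (cellMass A f j.toNat k)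
        (noiseLevel φ ψ A α j₁ j) := by
  have hB := h.father.bound_nonneg
  simpa only [coeffError, coeff, cellMass, privateView,
    basisFun_eq_dil φ ψ (Finset.mem_Icc.1 hj).1] using
    integral_abs_coeff_error_rpow_le (τ := noiseLevel φ ψ A α j₁ j) hn hp hsam.law_X
      (fun i => hsam.law_W i (j, k) ⟨hj, hk⟩) (hsam.iIndepFun_level ⟨hj, hk⟩) hf hf0
      ((h.generator j).aestronglyMeasurable_dil j.toNat k) (measurableSet_cell A j.toNat k)
      (by positivity) (h.ae_abs_dil_generator_le j k)

lemma IsWaveletPair.sum_integral_abs_coeffError_rpow_le (h : IsWaveletPair A B φ ψ) (hT : 0 ≤ T)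
    (hn : 1 ≤ n) (hp : 1 ≤ p) (hf : MemDensityClass φ ψ s p q L T f) (hF : 0 ≤ F)
    (hfF : eLpNorm f (ENNReal.ofReal p) volume ≤ ENNReal.ofReal F)
    (hsam : IsSample P f n (indexSet A T j₁) X W) {j : ℤ} (hj : j ∈ Finset.Icc (-1 : ℤ) j₁)
    (hτ : |noiseLevel φ ψ A α j₁ j| ≤ τ) :
    ∑ k ∈ translations A T j, ∫ ω, |coeffError φ ψ A α j₁ f X W j k ω| ^ p ∂P ≤
      levelConst A B T F p * (1 + τ ^ p + highMoment p n j₁) *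
        ((n : ℝ) ^ (-(p / 2)) * 2 ^ j.toNat) := by
  have hA := h.father.radius_nonneg
  have hB := h.father.bound_nonneg
  have := levelConst_nonneg (F := F) (p := p) hA hB hT
  have hj_le : j.toNat ≤ j₁ := Int.toNat_le.2 (Finset.mem_Icc.1 hj).2
  have bound_le := sum_coeffErrorBound_le hA hB hT hf.integrable hf.nonneg hf.integral_eq_one hp
    hF hfF hn hj_le (noiseLevel φ ψ A α j₁ j)
  rw [translations_toNat] at bound_le
  refine (Finset.sum_le_sum fun k hk => h.integral_abs_coeffError_rpow_le hn hp hf.integrable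
    hf.nonneg hsam hj hk).trans (bound_le.trans ?_)
  gcongr

/-- The constant in the bound of the stochastic error. -/
noncomputable def stochConst (A B T F p : ℝ) : ℝ :=
  synthConst A B p * levelConst A B T F p ^ (1 / p)

lemma stochConst_nonneg (hA : 0 ≤ A) (hB : 0 ≤ B) (hT : 0 ≤ T) : 0 ≤ stochConst A B T F p :=
  mul_nonneg (synthConst_nonneg hA hB p) (Real.rpow_nonneg (levelConst_nonneg hA hB hT) _)

lemma IsWaveletPair.eLpNorm_levelError_le (h : IsWaveletPair A B φ ψ) (hT : 0 ≤ T) (hn : 1 ≤ n)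
    (hp : 1 ≤ p) (hf : MemDensityClass φ ψ s p q L T f) (hF : 0 ≤ F)
    (hfF : eLpNorm f (ENNReal.ofReal p) volume ≤ ENNReal.ofReal F)
    (hsam : IsSample P f n (indexSet A T j₁) X W) {j : ℤ} (hj : j ∈ Finset.Icc (-1 : ℤ) j₁)
    (hτ : |noiseLevel φ ψ A α j₁ j| ≤ τ) :
    eLpNorm (levelError φ ψ A B T p α j₁ f X W j) (ENNReal.ofReal p) P ≤
      ENNReal.ofReal (stochConst A B T F p * (1 + τ ^ p + highMoment p n j₁) ^ (1 / p) *
        (n : ℝ) ^ (-(1 / 2) : ℝ) * (2 : ℝ) ^ ((j.toNat : ℝ) / 2)) := by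
  have hp0 : 0 < p := by linarith
  have hA := h.father.radius_nonneg
  have hB := h.father.bound_nonneg
  have hτ0 : 0 ≤ τ := (abs_nonneg _).trans hτ
  have := synthConst_nonneg hA hB p
  have hlevel := levelConst_nonneg (F := F) (p := p) hA hB hT
  have := highMoment_nonneg p n j₁
  have hsize : 0 ≤ 1 + τ ^ p + highMoment p n j₁ := by positivity
  refine (eLpNorm_mul_sum_abs_rpow_le hp0 (by positivity)
    (fun k hk => h.memLp_coeffError hp0 hsam hj hk)
    (h.sum_integral_abs_coeffError_rpow_le hT hn hp hf hF hfF hsam hj hτ)).trans_eq ?_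
  rw [mul_assoc (synthConst A B p), two_rpow_mul_rpow_one_div_eq (by positivity) hp0,
    Real.mul_rpow hlevel hsize, stochConst]
  ring_nf

lemma IsWaveletPair.aestronglyMeasurable_levelError (h : IsWaveletPair A B φ ψ) (hp : 0 < p)
    (hsam : IsSample P f n (indexSet A T j₁) X W) {j : ℤ} (hj : j ∈ Finset.Icc (-1 : ℤ) j₁) :
    AEStronglyMeasurable (levelError φ ψ A B T p α j₁ f X W j) P :=
  (((Finset.aemeasurable_fun_sum _ fun _ hk =>
    (h.memLp_coeffError hp hsam hj hk).1.aemeasurable.abs.pow_const p).pow_const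
      (1 / p)).const_mul _).aestronglyMeasurable

lemma IsWaveletPair.linRisk_le (h : IsWaveletPair A B φ ψ) (hs : 0 < s) (hp : 1 ≤ p) (hq : q ≠ 0)
    (hL : 0 ≤ L) (hT : 0 ≤ T) (hn : 1 ≤ n) (hf : MemDensityClass φ ψ s p q L T f) (hF : 0 ≤ F)
    (hfF : eLpNorm f (ENNReal.ofReal p) volume ≤ ENNReal.ofReal F)
    (hsam : IsSample P f n (indexSet A T j₁) X W) (hτ : ∀ j, |noiseLevel φ ψ A α j₁ j| ≤ τ) :
    linRisk P φ ψ A T α p j₁ n f X W ≤ ENNReal.ofReal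
      ((stochConst A B T F p * (1 + τ ^ p + highMoment p n j₁) ^ (1 / p) *
          (n : ℝ) ^ (-(1 / 2) : ℝ) * (geomConst * (2 : ℝ) ^ ((j₁ : ℝ) / 2)) +
        biasConst A B s p L * (2 : ℝ) ^ (-(j₁ * s))) ^ p) := by
  have hp0 : 0 < p := by linarith
  have one_le_p := ENNReal.one_le_ofReal.2 hp
  have hA := h.father.radius_nonneg
  have hB := h.father.bound_nonneg
  have hτ0 : 0 ≤ τ := (abs_nonneg _).trans (hτ 0)
  have := biasConst_nonneg (p := p) hA hB hs hL
  have := stochConst_nonneg (F := F) (p := p) hA hB hT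
  have := highMoment_nonneg p n j₁
  have := geomConst_nonneg
  have measurable_level : ∀ j ∈ Finset.Icc (-1 : ℤ) j₁,
      AEStronglyMeasurable (levelError φ ψ A B T p α j₁ f X W j) P := fun j hj =>
    h.aestronglyMeasurable_levelError hp0 hsam hj
  refine (h.linRisk_le_eLpNorm hs hp hq hL hf).trans ?_
  rw [← ENNReal.ofReal_rpow_of_nonneg (by positivity) hp0.le,
    ENNReal.ofReal_add (by positivity) (by positivity)]
  gcongr
  refine (eLpNorm_add_le (Finset.aestronglyMeasurable_sum _ measurable_level)
    aestronglyMeasurable_const one_le_p).trans (add_le_add ?_ ?_)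
  · refine (eLpNorm_sum_le measurable_level one_le_p).trans ((Finset.sum_le_sum fun j hj =>
      h.eLpNorm_levelError_le hT hn hp hf hF hfF hsam hj (hτ j)).trans ?_)
    rw [← ENNReal.ofReal_sum_of_nonneg fun j _ => by positivity, ← Finset.mul_sum]
    gcongr
    exact sum_two_rpow_half_le j₁
  · rw [eLpNorm_const _ (ENNReal.ofReal_pos.2 hp0).ne' (IsProbabilityMeasure.ne_zero P),
      measure_univ, ENNReal.one_rpow, mul_one, Real.enorm_eq_ofReal (by positivity)]

end Sample

/-! ### Rates of convergence -/

lemma supNorm_nonneg (g : ℝ → ℝ) : 0 ≤ supNorm g := ENNReal.toReal_nonneg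

/-- The constant in `abs_noiseLevel_le`. -/
noncomputable def noiseConst (φ ψ : ℝ → ℝ) (A : ℝ) : ℝ :=
  4 * (2 * (⌈A⌉ : ℝ) + 1) * (supNorm φ + supNorm ψ * (√2 / (√2 - 1)))

section Rates

variable {φ ψ : ℝ → ℝ} {A s p α κ b c t : ℝ} {n j₁ : ℕ}

lemma noiseConst_nonneg (hA : 0 ≤ A) : 0 ≤ noiseConst φ ψ A := by
  have := supNorm_nonneg φ
  have := supNorm_nonneg ψ
  have : 0 < √2 - 1 := sub_pos.2 Real.one_lt_sqrt_two
  have : 0 ≤ ⌈A⌉ := Int.ceil_nonneg hA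
  unfold noiseConst
  positivity

lemma abs_noiseLevel_le (hA : 0 ≤ A) (hα : 0 < α) (j₁ : ℕ) (j : ℤ) :
    |noiseLevel φ ψ A α j₁ j| ≤ noiseConst φ ψ A * ((2 : ℝ) ^ ((j₁ : ℝ) / 2) / α) := by
  have hφ := supNorm_nonneg φ
  have hψ := supNorm_nonneg ψ
  have : 0 < √2 - 1 := sub_pos.2 Real.one_lt_sqrt_two
  have : 0 ≤ ⌈A⌉ := Int.ceil_nonneg hA
  have one_le : (1 : ℝ) ≤ (2 : ℝ) ^ ((j₁ : ℝ) / 2) := Real.one_le_rpow one_le_two (by positivity)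
  unfold noiseLevel noiseConst
  split_ifs
  · rw [abs_of_nonneg (by positivity)]
    calc _ = 4 * (2 * (⌈A⌉ : ℝ) + 1) * supNorm φ * (1 / α) := by ring
      _ ≤ _ := by
        gcongr
        exact le_add_of_nonneg_right (by positivity)
  · rw [abs_of_nonneg (by positivity)]
    calc _ = 4 * (2 * (⌈A⌉ : ℝ) + 1) * (supNorm ψ * (√2 / (√2 - 1))) *
          ((2 : ℝ) ^ ((j₁ : ℝ) / 2) / α) := by ring
      _ ≤ _ := by
        gcongr
        exact le_add_of_nonneg_left hφ

lemma two_rpow_half_rpow (j₁ : ℕ) (p : ℝ) :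
    ((2 : ℝ) ^ ((j₁ : ℝ) / 2)) ^ p = ((2 : ℝ) ^ j₁) ^ (p / 2) := by
  rw [← Real.rpow_natCast, ← Real.rpow_mul two_pos.le, ← Real.rpow_mul two_pos.le]
  ring_nf

lemma noise_rate_eq (hα : 0 < α) (n j₁ : ℕ) (p : ℝ) :
    ((2 : ℝ) ^ ((j₁ : ℝ) / 2) / α) ^ p * ((2 : ℝ) ^ j₁ / n) ^ (p / 2) =
      ((2 : ℝ) ^ (2 * j₁) / (n * α ^ 2)) ^ (p / 2) := by
  rw [Real.div_rpow (by positivity) hα.le, two_rpow_half_rpow, ← sq_rpow_half hα.le,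
    ← Real.div_rpow (by positivity) (by positivity), ← Real.mul_rpow (by positivity)
    (by positivity), div_mul_div_comm, ← pow_add, ← two_mul, mul_comm (α ^ 2)]

/-- The term with the `p`-th moments is absorbed by the sampling rate if `2 ^ j₁ ≤ κ * n`, and by
the noise rate if `α ≤ κ`. -/
lemma highMoment_mul_le (hα : 0 < α) (hκ : 0 < κ) (hn : 1 ≤ n)
    (h : p ≤ 2 ∨ (2 : ℝ) ^ j₁ ≤ κ * n ∨ α ≤ κ) :
    highMoment p n j₁ * ((2 : ℝ) ^ j₁ / n) ^ (p / 2) ≤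
      κ ^ (p / 2 - 1) * ((2 : ℝ) ^ j₁ / n) ^ (p / 2) +
        κ ^ p * ((2 : ℝ) ^ (2 * j₁) / (n * α ^ 2)) ^ (p / 2) := by
  have one_le_n : (1 : ℝ) ≤ n := Nat.one_le_cast.2 hn
  rw [← noise_rate_eq hα, ← mul_assoc, ← add_mul]
  refine mul_le_mul_of_nonneg_right ?_ (by positivity)
  unfold highMoment
  split_ifs with hp
  · positivity
  rw [not_le] at hp
  rcases h with hp_le | hj₁ | hακ
  · exact absurd hp_le hp.not_ge
  · refine le_add_of_le_of_nonneg ?_ (by positivity)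
    exact Real.rpow_le_rpow (by positivity) ((div_le_iff₀ (by linarith)).2 hj₁) (by linarith)
  · refine le_add_of_nonneg_of_le (by positivity) ?_
    calc ((2 : ℝ) ^ j₁ / n) ^ (p / 2 - 1) ≤ ((2 : ℝ) ^ j₁) ^ (p / 2 - 1) :=
          Real.rpow_le_rpow (by positivity) (div_le_self (by positivity) one_le_n) (by linarith)
      _ ≤ ((2 : ℝ) ^ j₁) ^ (p / 2) :=
          Real.rpow_le_rpow_of_exponent_le (one_le_pow₀ one_le_two) (by linarith)
      _ = ((2 : ℝ) ^ ((j₁ : ℝ) / 2)) ^ p := (two_rpow_half_rpow j₁ p).symm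
      _ ≤ (κ * ((2 : ℝ) ^ ((j₁ : ℝ) / 2) / α)) ^ p := by
          refine Real.rpow_le_rpow (by positivity) ?_ (by linarith)
          rw [mul_div_assoc', le_div_iff₀ hα, mul_comm]
          gcongr
      _ = κ ^ p * ((2 : ℝ) ^ ((j₁ : ℝ) / 2) / α) ^ p := Real.mul_rpow hκ.le (by positivity)

lemma moment_size_mul_le (hα : 0 < α) (hκ : 0 < κ) (ht : 0 ≤ t) (hn : 1 ≤ n)
    (h : p ≤ 2 ∨ (2 : ℝ) ^ j₁ ≤ κ * n ∨ α ≤ κ) :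
    (1 + (t * ((2 : ℝ) ^ ((j₁ : ℝ) / 2) / α)) ^ p + highMoment p n j₁) *
        ((2 : ℝ) ^ j₁ / n) ^ (p / 2) ≤
      (1 + κ ^ (p / 2 - 1) + t ^ p + κ ^ p) *
        (((2 : ℝ) ^ (2 * j₁) / (n * α ^ 2)) ^ (p / 2) + ((2 : ℝ) ^ j₁ / n) ^ (p / 2)) := by
  have noise_rate := noise_rate_eq hα n j₁ p
  have high_le := highMoment_mul_le hα hκ hn h
  have : 0 ≤ κ ^ (p / 2 - 1) := by positivity
  have : 0 ≤ κ ^ p := by positivity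
  have : 0 ≤ t ^ p := by positivity
  set N := ((2 : ℝ) ^ (2 * j₁) / (n * α ^ 2)) ^ (p / 2)
  set S := ((2 : ℝ) ^ j₁ / n) ^ (p / 2)
  have hN : 0 ≤ N := by positivity
  have hS : 0 ≤ S := by positivity
  calc _ = S + t ^ p * N + highMoment p n j₁ * S := by
        rw [Real.mul_rpow ht (by positivity), add_mul, add_mul, one_mul, mul_assoc, noise_rate]
    _ ≤ S + t ^ p * N + (κ ^ (p / 2 - 1) * S + κ ^ p * N) := by gcongr
    _ = 1 * S + κ ^ (p / 2 - 1) * S + t ^ p * N + κ ^ p * N := by ring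
    _ ≤ 1 * (N + S) + κ ^ (p / 2 - 1) * (N + S) + t ^ p * (N + S) + κ ^ p * (N + S) := by
        gcongr <;> linarith
    _ = _ := by ring

lemma stochastic_term_rpow_eq {Q : ℝ} (hp : 0 < p) (hb : 0 ≤ b) (hc : 0 ≤ c) (hQ : 0 ≤ Q)
    (n j₁ : ℕ) :
    (c * Q ^ (1 / p) * (n : ℝ) ^ (-(1 / 2) : ℝ) * (b * (2 : ℝ) ^ ((j₁ : ℝ) / 2))) ^ p =
      (c * b) ^ p * (Q * ((2 : ℝ) ^ j₁ / n) ^ (p / 2)) := by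
  have hn : ((n : ℝ) ^ (-(1 / 2) : ℝ)) ^ p = ((n : ℝ) ^ (p / 2))⁻¹ := by
    rw [← Real.rpow_mul n.cast_nonneg, ← Real.rpow_neg n.cast_nonneg]
    ring_nf
  have hQp : (Q ^ (1 / p)) ^ p = Q := by
    rw [← Real.rpow_mul hQ, one_div_mul_cancel hp.ne', Real.rpow_one]
  rw [Real.mul_rpow (by positivity) (by positivity), Real.mul_rpow (by positivity)
    (by positivity), Real.mul_rpow hc (by positivity), Real.mul_rpow hb (by positivity),
    Real.mul_rpow hc hb, hn, hQp, two_rpow_half_rpow, Real.div_rpow (by positivity)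
    n.cast_nonneg]
  ring

/-- The constant in `risk_bound_le`. -/
noncomputable def rateConst (p κ b c t : ℝ) : ℝ :=
  2 ^ p * (1 + b ^ p + c ^ p * (1 + κ ^ (p / 2 - 1) + t ^ p + κ ^ p))

lemma rateConst_pos (hκ : 0 < κ) (hb : 0 ≤ b) (hc : 0 ≤ c) (ht : 0 ≤ t) :
    0 < rateConst p κ b c t := by
  unfold rateConst
  positivity

lemma risk_bound_le {g : ℝ} (hp : 0 < p) (hα : 0 < α) (hκ : 0 < κ) (hb : 0 ≤ b) (hc : 0 ≤ c)
    (hg : 0 ≤ g) (ht : 0 ≤ t) (hn : 1 ≤ n) (h : p ≤ 2 ∨ (2 : ℝ) ^ j₁ ≤ κ * n ∨ α ≤ κ) :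
    (c * (1 + (t * ((2 : ℝ) ^ ((j₁ : ℝ) / 2) / α)) ^ p + highMoment p n j₁) ^ (1 / p) *
        (n : ℝ) ^ (-(1 / 2) : ℝ) * (g * (2 : ℝ) ^ ((j₁ : ℝ) / 2)) +
      b * (2 : ℝ) ^ (-(j₁ * s))) ^ p ≤
      rateConst p κ b (c * g) t * ((2 : ℝ) ^ (-((j₁ : ℝ) * p * s))
        + ((2 : ℝ) ^ (2 * j₁) / (n * α ^ 2)) ^ (p / 2) + ((2 : ℝ) ^ j₁ / n) ^ (p / 2)) := by
  have := highMoment_nonneg p n j₁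
  have bias_eq : ((2 : ℝ) ^ (-(j₁ * s))) ^ p = (2 : ℝ) ^ (-((j₁ : ℝ) * p * s)) := by
    rw [← Real.rpow_mul two_pos.le]
    ring_nf
  refine (add_rpow_le_two_rpow_mul (by positivity) (by positivity) hp.le).trans ?_
  rw [stochastic_term_rpow_eq hp hg hc (by positivity), Real.mul_rpow hb (by positivity), bias_eq,
    rateConst, mul_assoc (2 ^ p)]
  have stochastic_le := moment_size_mul_le hα hκ ht hn h
  set N := ((2 : ℝ) ^ (2 * j₁) / (n * α ^ 2)) ^ (p / 2)
  set S := ((2 : ℝ) ^ j₁ / n) ^ (p / 2)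
  set R := (2 : ℝ) ^ (-((j₁ : ℝ) * p * s))
  set K := 1 + κ ^ (p / 2 - 1) + t ^ p + κ ^ p
  have hN : 0 ≤ N := by positivity
  have hS : 0 ≤ S := by positivity
  have hR : 0 ≤ R := by positivity
  have : 0 ≤ K := by positivity
  refine mul_le_mul_of_nonneg_left ?_ (by positivity)
  calc _ ≤ (c * g) ^ p * (K * (N + S)) + b ^ p * R := by gcongr
    _ ≤ (c * g) ^ p * (K * (R + N + S)) + b ^ p * (R + N + S) + (R + N + S) := by
        refine le_add_of_le_of_nonneg ?_ (by positivity)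
        gcongr <;> linarith
    _ = _ := by ring

lemma bias_rate_le {r u v z : ℝ} (hr : 0 ≤ r) (hc : 0 < c) (hu : 0 < u) (hv : 0 < v)
    (h : c * min u v ≤ z) : z ^ (-r) ≤ c ^ (-r) * max (u ^ (-r)) (v ^ (-r)) := by
  have hmin : 0 < min u v := lt_min hu hv
  calc z ^ (-r) ≤ (c * min u v) ^ (-r) :=
        Real.rpow_le_rpow_of_nonpos (by positivity) h (neg_nonpos.2 hr)
    _ = c ^ (-r) * min u v ^ (-r) := Real.mul_rpow hc.le hmin.le
    _ ≤ c ^ (-r) * max (u ^ (-r)) (v ^ (-r)) := by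
        gcongr
        rcases min_choice u v with h | h <;> rw [h]
        exacts [le_max_left _ _, le_max_right _ _]

lemma stochastic_rate_le {m x z : ℝ} (hm : 0 ≤ m) (hd : 0 < 2 * s + m) (hp : 0 ≤ p) (hc : 0 ≤ c)
    (hx : 0 < x) (hz : 0 ≤ z) (h : z ≤ c * x ^ (1 / (2 * s + m))) :
    (z ^ m / x) ^ (p / 2) ≤ c ^ (m * (p / 2)) * x ^ (-(p * s / (2 * s + m))) := by
  have exponent : (1 / (2 * s + m) * m - 1) * (p / 2) = -(p * s / (2 * s + m)) := by
    field_simp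
    ring
  calc (z ^ m / x) ^ (p / 2) ≤ ((c * x ^ (1 / (2 * s + m))) ^ m / x) ^ (p / 2) := by gcongr
    _ = (c ^ m * x ^ (1 / (2 * s + m) * m - 1)) ^ (p / 2) := by
        rw [Real.mul_rpow hc (by positivity), ← Real.rpow_mul hx.le, mul_div_assoc,
          Real.rpow_sub_one hx.ne']
    _ = c ^ (m * (p / 2)) * x ^ (-(p * s / (2 * s + m))) := by
        rw [Real.mul_rpow (by positivity) (by positivity), ← Real.rpow_mul hc,
          ← Real.rpow_mul hx.le, exponent]

lemma balanced_rate_le {c₁ c₂ x y z : ℝ} (hs : 0 < s) (hp : 0 < p) (hc₁ : 0 < c₁) (hc₂ : 0 < c₂)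
    (hx : 0 < x) (hy : 0 < y) (hz : 0 < z)
    (hlower : c₁ * min (x ^ (1 / (2 * s + 2))) (y ^ (1 / (2 * s + 1))) ≤ z)
    (hupper : z ≤ c₂ * min (x ^ (1 / (2 * s + 2))) (y ^ (1 / (2 * s + 1)))) :
    z ^ (-(p * s)) + (z ^ 2 / x) ^ (p / 2) + (z / y) ^ (p / 2) ≤
      (c₁ ^ (-(p * s)) + c₂ ^ p + c₂ ^ (p / 2)) *
        max (x ^ (-(p * s / (2 * s + 2)))) (y ^ (-(p * s / (2 * s + 1)))) := by
  have bias_le := bias_rate_le (r := p * s) (by positivity) hc₁ (by positivity) (by positivity)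
    hlower
  have noise_le := stochastic_rate_le two_pos.le (by positivity) hp.le hc₂.le hx hz.le
    (hupper.trans (mul_le_mul_of_nonneg_left (min_le_left _ _) hc₂.le))
  have sampling_le := stochastic_rate_le one_pos.le (by positivity) hp.le hc₂.le hy hz.le
    (hupper.trans (mul_le_mul_of_nonneg_left (min_le_right _ _) hc₂.le))
  rw [← Real.rpow_mul hx.le, ← Real.rpow_mul hy.le, mul_neg, mul_neg, one_div_mul_eq_div,
    one_div_mul_eq_div] at bias_le
  rw [Real.rpow_two, mul_div_cancel₀ p two_ne_zero] at noise_le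
  rw [Real.rpow_one, one_mul] at sampling_le
  rw [add_mul, add_mul]
  refine add_le_add (add_le_add bias_le (noise_le.trans ?_)) (sampling_le.trans ?_)
  · gcongr
    exact le_max_left _ _
  · gcongr
    exact le_max_right _ _

end Rates

/-! ### Risk bounds over the density class -/

section Boundedness

variable {φ ψ g : ℝ → ℝ} {A B : ℝ}

lemma IsLocalized.mono_bound {B' : ℝ} (h : IsLocalized A B g) (hB : B ≤ B') :
    IsLocalized A B' g where
  radius_nonneg := h.radius_nonneg
  bound_nonneg := h.bound_nonneg.trans hB
  aestronglyMeasurable := h.aestronglyMeasurable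
  ae_abs_le := h.ae_abs_le.mono fun _ hx => hx.trans hB
  support_subset := h.support_subset

lemma IsLocalized.memLp_top_dil (h : IsLocalized A B g) (j k : ℤ) : MemLp (dil g j k) ∞ volume := by
  have := h.bound_nonneg
  refine memLp_top_of_bound (h.aestronglyMeasurable_dil j k) (B * (2 : ℝ) ^ ((j : ℝ) / 2)) ?_
  filter_upwards [h.ae_abs_dil_le] with x hx
  exact (hx j k).trans (indicator_le_self' (fun _ _ => by positivity) x)

lemma OrthonormalTranslates.radius_nonneg (h : OrthonormalTranslates g)
    (hA : Function.support g ⊆ Icc (-A) A) : 0 ≤ A := by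
  by_contra! hneg
  rw [Icc_eq_empty (by linarith), subset_empty_iff, Function.support_eq_empty_iff] at hA
  have norm_eq_one := h.inner_eq 0 0
  simp only [dil_zero_zero, hA, Pi.zero_apply, mul_zero, integral_zero, if_true, zero_ne_one]
    at norm_eq_one

lemma OrthonormalTranslates.isLocalized (h : OrthonormalTranslates g) (hb : MemLp g ∞ volume)
    (hA : Function.support g ⊆ Icc (-A) A) : IsLocalized A (supNorm g) g where
  radius_nonneg := h.radius_nonneg hA
  bound_nonneg := supNorm_nonneg g
  aestronglyMeasurable := hb.1
  ae_abs_le := by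
    filter_upwards [enorm_ae_le_eLpNormEssSup g volume] with x hx
    rw [← eLpNorm_exponent_top] at hx
    simpa only [supNorm, toReal_enorm, Real.norm_eq_abs] using ENNReal.toReal_mono hb.2.ne hx
  support_subset := hA

lemma IsMotherWavelet.memLp_top (hψ : IsMotherWavelet φ ψ) (hφ : IsLocalized A B φ)
    (ho : OrthonormalTranslates φ) (hA : Function.support ψ ⊆ Icc (-A) A) :
    MemLp ψ ∞ volume := by
  have mem_spanSpace : hψ.orthonormal.memLp.toLp ψ ∈ spanSpace ψ 0 := by
    refine Submodule.le_topologicalClosure _ (Submodule.subset_span ⟨0, ?_⟩)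
    rw [dil_zero_zero]
    exact hψ.orthonormal.memLp.coeFn_toLp
  rw [hψ.span_eq] at mem_spanSpace
  have proj_eq := hφ.toLp_proj ho hψ.orthonormal.memLp hA zero_le_one
  rw [Submodule.starProjection_eq_self_iff.2 mem_spanSpace.1, MemLp.toLp_eq_toLp_iff] at proj_eq
  exact (memLp_congr_ae proj_eq).1
    (memLp_finsetSum _ fun k _ => (hφ.memLp_top_dil 1 k).const_mul _)

lemma IsMotherWavelet.isWaveletPair (hψ : IsMotherWavelet φ ψ) (hφ : GeneratesMRA φ)
    (hb : MemLp φ ∞ volume) (hφA : Function.support φ ⊆ Icc (-A) A)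
    (hψA : Function.support ψ ⊆ Icc (-A) A) :
    IsWaveletPair A (max (supNorm φ) (supNorm ψ)) φ ψ := by
  have father := hφ.orthonormal.isLocalized hb hφA
  exact ⟨father.mono_bound (le_max_left _ _),
    (hψ.orthonormal.isLocalized (hψ.memLp_top father hφ.orthonormal hψA) hψA).mono_bound
      (le_max_right _ _), hφ, hψ⟩

lemma FatherAssumption.memLp_top {N : ℕ} (hφ : FatherAssumption φ N) : MemLp φ ∞ volume := by
  obtain ⟨Φ, ⟨M, hM⟩, -, hle, -, -⟩ := hφ.majorant
  exact memLp_top_of_bound hφ.mra.orthonormal.memLp.1 M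
    (ae_of_all _ fun x => (hle x).trans (hM ⟨|x|, abs_nonneg x, rfl⟩))

end Boundedness

variable {φ ψ : ℝ → ℝ} {A B s p L T : ℝ} {q : ℝ≥0∞}

lemma SupRiskLE.mono {n j₁ : ℕ} {α C C' : ℝ} (h : SupRiskLE.{u} φ ψ A s p q L T n α j₁ C)
    (hC : C ≤ C') : SupRiskLE.{u} φ ψ A s p q L T n α j₁ C' := fun f hf Ω _ P _ X W hsam =>
  (h f hf Ω P X W hsam).trans (ENNReal.ofReal_le_ofReal hC)

lemma IsWaveletPair.exists_supRiskLE (h : IsWaveletPair A B φ ψ) (hs : 0 < s) (hp : 1 ≤ p)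
    (hq : q ≠ 0) (hL : 0 ≤ L) (hT : 0 ≤ T) {κ : ℝ} (hκ : 0 < κ) :
    ∃ C : ℝ, 0 < C ∧ ∀ (n : ℕ) (α : ℝ) (j₁ : ℕ), 1 ≤ n → 0 < α →
      (p ≤ 2 ∨ (2 : ℝ) ^ j₁ ≤ κ * n ∨ α ≤ κ) →
      SupRiskLE.{u} φ ψ A s p q L T n α j₁
        (C * ((2 : ℝ) ^ (-((j₁ : ℝ) * p * s))
          + ((2 : ℝ) ^ (2 * j₁) / (n * α ^ 2)) ^ (p / 2)
          + ((2 : ℝ) ^ j₁ / n) ^ (p / 2))) := by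
  have hp0 : 0 < p := by linarith
  have hA := h.father.radius_nonneg
  have hB := h.father.bound_nonneg
  have hbias := biasConst_nonneg (p := p) hA hB hs hL
  have hnoise := noiseConst_nonneg (φ := φ) (ψ := ψ) hA
  have hgeom := geomConst_nonneg
  have := synthConst_nonneg hA hB p
  set F := synthConst A B p * L + biasConst A B s p L
  have hstoch := stochConst_nonneg (F := F) (p := p) hA hB hT
  refine ⟨rateConst p κ (biasConst A B s p L) (stochConst A B T F p * geomConst)
    (noiseConst φ ψ A), rateConst_pos hκ hbias (by positivity) hnoise,
    fun n α j₁ hn hα hcase f hf Ω _ P _ X W hsam => ?_⟩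
  exact (h.linRisk_le hs hp hq hL hT hn hf (by positivity)
    (h.eLpNorm_density_le hs hp hq hL hf) hsam (abs_noiseLevel_le hA hα j₁)).trans
      (ENNReal.ofReal_le_ofReal (risk_bound_le hp0 hα hκ hbias hstoch hgeom hnoise hn hcase))

lemma IsWaveletPair.exists_supRiskLE_of_balanced (h : IsWaveletPair A B φ ψ) (hs : 0 < s)
    (hp : 1 ≤ p) (hq : q ≠ 0) (hL : 0 ≤ L) (hT : 0 ≤ T) {c₁ c₂ : ℝ} (hc₁ : 0 < c₁)
    (hc₂ : 0 < c₂) :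
    ∃ C : ℝ, 0 < C ∧ ∀ (n : ℕ) (α : ℝ) (j₁ : ℕ), 1 ≤ n → 0 < α →
      c₁ * min ((n * α ^ 2) ^ (1 / (2 * s + 2))) ((n : ℝ) ^ (1 / (2 * s + 1))) ≤ (2 : ℝ) ^ j₁ →
      (2 : ℝ) ^ j₁ ≤ c₂ * min ((n * α ^ 2) ^ (1 / (2 * s + 2))) ((n : ℝ) ^ (1 / (2 * s + 1))) →
      SupRiskLE.{u} φ ψ A s p q L T n α j₁
        (C * max ((n * α ^ 2) ^ (-(p * s / (2 * s + 2))))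
          ((n : ℝ) ^ (-(p * s / (2 * s + 1))))) := by
  have hp0 : 0 < p := by linarith
  obtain ⟨C, hC, risk_le⟩ := h.exists_supRiskLE.{u} hs hp hq hL hT hc₂
  refine ⟨C * (c₁ ^ (-(p * s)) + c₂ ^ p + c₂ ^ (p / 2)), by positivity,
    fun n α j₁ hn hα hlower hupper => ?_⟩
  have one_le_n : (1 : ℝ) ≤ n := Nat.one_le_cast.2 hn
  have n_pos : (0 : ℝ) < n := by linarith
  have resolution_le : (2 : ℝ) ^ j₁ ≤ c₂ * n := by
    refine hupper.trans ?_
    gcongr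
    calc _ ≤ (n : ℝ) ^ (1 / (2 * s + 1)) := min_le_right _ _
      _ ≤ (n : ℝ) ^ (1 : ℝ) := Real.rpow_le_rpow_of_exponent_le one_le_n
          ((div_le_one (by positivity)).2 (by linarith))
      _ = n := Real.rpow_one _
  have bias_eq : (2 : ℝ) ^ (-((j₁ : ℝ) * p * s)) = ((2 : ℝ) ^ j₁) ^ (-(p * s)) := by
    rw [← Real.rpow_natCast_mul two_pos.le, mul_neg, mul_assoc]
  refine (risk_le n α j₁ hn hα (.inr (.inl resolution_le))).mono ?_
  rw [bias_eq, pow_mul', mul_assoc C]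
  gcongr
  exact balanced_rate_le hs hp0 hc₁ hc₂ (by positivity) n_pos (by positivity) hlower hupper

end LDPWavelet

open LDPWavelet in
theorem proposition4p1_general {φ ψ : ℝ → ℝ} {A s p L T : ℝ} {q : ℝ≥0∞}
    (hφ : GeneratesMRA φ) (hb : MemLp φ ∞ volume) (hψ : IsMotherWavelet φ ψ)
    (hφA : Function.support φ ⊆ Icc (-A) A) (hψA : Function.support ψ ⊆ Icc (-A) A)
    (hs : 0 < s) (hp : 1 ≤ p) (hq : q ≠ 0) (hL : 0 ≤ L) (hT : 0 ≤ T) :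
    (∀ κ : ℝ, 0 < κ → ∃ C : ℝ, 0 < C ∧ ∀ (n : ℕ) (α : ℝ) (j₁ : ℕ), 1 ≤ n → 0 < α →
      (p ≤ 2 ∨ (2 : ℝ) ^ j₁ ≤ κ * n ∨ α ≤ κ) →
      SupRiskLE.{u} φ ψ A s p q L T n α j₁
        (C * ((2 : ℝ) ^ (-((j₁ : ℝ) * p * s))
          + ((2 : ℝ) ^ (2 * j₁) / (n * α ^ 2)) ^ (p / 2)
          + ((2 : ℝ) ^ j₁ / n) ^ (p / 2)))) ∧
    (∀ c₁ c₂ : ℝ, 0 < c₁ → 0 < c₂ → ∃ C : ℝ, 0 < C ∧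
      ∀ (n : ℕ) (α : ℝ) (j₁ : ℕ), 1 ≤ n → 0 < α →
      c₁ * min ((n * α ^ 2) ^ (1 / (2 * s + 2))) ((n : ℝ) ^ (1 / (2 * s + 1))) ≤ (2 : ℝ) ^ j₁ →
      (2 : ℝ) ^ j₁ ≤ c₂ * min ((n * α ^ 2) ^ (1 / (2 * s + 2))) ((n : ℝ) ^ (1 / (2 * s + 1))) →
      SupRiskLE.{u} φ ψ A s p q L T n α j₁
        (C * max ((n * α ^ 2) ^ (-(p * s / (2 * s + 2))))
          ((n : ℝ) ^ (-(p * s / (2 * s + 1)))))) := by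
  have pair := hψ.isWaveletPair hφ hb hφA hψA
  exact ⟨fun κ hκ => pair.exists_supRiskLE hs hp hq hL hT hκ,
    fun c₁ c₂ hc₁ hc₂ => pair.exists_supRiskLE_of_balanced hs hp hq hL hT hc₁ hc₂⟩

theorem proposition4p1 (φ ψ : ℝ → ℝ) (A : ℝ) (N : ℕ) (s p : ℝ) (q : ℝ≥0∞) (L T : ℝ)
    (hs : 0 < s) (hsN : s < N + 1) (hp : 1 ≤ p) (hq : 1 ≤ q) (hL : 0 < L) (hT : 0 < T)
    (hφ : LDPWavelet.FatherAssumption φ N) (hψ : LDPWavelet.IsMotherWavelet φ ψ)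
    (hφA : Function.support φ ⊆ Icc (-A) A) (hψA : Function.support ψ ⊆ Icc (-A) A) :
    (∀ κ : ℝ, 0 < κ → ∃ C : ℝ, 0 < C ∧ ∀ (n : ℕ) (α : ℝ) (j₁ : ℕ), 1 ≤ n → 0 < α →
      (p ≤ 2 ∨ (2 : ℝ) ^ j₁ ≤ κ * n ∨ α ≤ κ) →
      LDPWavelet.SupRiskLE.{u} φ ψ A s p q L T n α j₁
        (C * ((2 : ℝ) ^ (-((j₁ : ℝ) * p * s))
          + ((2 : ℝ) ^ (2 * j₁) / (n * α ^ 2)) ^ (p / 2)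
          + ((2 : ℝ) ^ j₁ / n) ^ (p / 2)))) ∧
    (∀ c₁ c₂ : ℝ, 0 < c₁ → 0 < c₂ → ∃ C : ℝ, 0 < C ∧
      ∀ (n : ℕ) (α : ℝ) (j₁ : ℕ), 1 ≤ n → 0 < α →
      c₁ * min ((n * α ^ 2) ^ (1 / (2 * s + 2))) ((n : ℝ) ^ (1 / (2 * s + 1))) ≤ (2 : ℝ) ^ j₁ →
      (2 : ℝ) ^ j₁ ≤ c₂ * min ((n * α ^ 2) ^ (1 / (2 * s + 2))) ((n : ℝ) ^ (1 / (2 * s + 1))) →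
      LDPWavelet.SupRiskLE.{u} φ ψ A s p q L T n α j₁
        (C * max ((n * α ^ 2) ^ (-(p * s / (2 * s + 2)))) ((n : ℝ) ^ (-(p * s / (2 * s + 1)))))) :=
  proposition4p1_general hφ.mra hφ.memLp_top hψ hφA hψA hs hp (zero_lt_one.trans_le hq).ne' hL.le
    hT.le
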